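/- Let $k\in\{1,2,3\}$ and let $G$ be a finite simple connected graph (the empty graph is allowed). Notation. A path decomposition of a graph $G$ of length $l$ is a sequence $(X_1,\dots,X_l)$ of subsets of $V(G)$ with $\bigcup_i X_i=V(G)$, such that every edge is contained in some $X_i$, and $X_i\cap X_j\subseteq X_p$ whenever $i\le p\le j$; its width is $\max_i|X_i|-1$. For $A\subseteq V(G)$ let $N_G(A)$ be the set of vertices outside $A$ with a neighbour in $A$, and $\delta_G(A)$ the set of vertices of $A$ with a neighbour outside $A$. For $S\subseteq V(G)$, an $S$-component is a connected component $H$ of $G-S$ with $N_G(V(H))=S$. Let $\mathcal C^1(S)$ be the set of $S$-components with exactly one vertex ($S$-leaves), and $\mathcal C^2(S)$ the set of all other $S$-components ($S$-branches). Fix, for each $S$, an arbitrary enumeration $v_1(S),v_2(S),\dots$ of the $S$-leaves. A set $S$ is a bottleneck set if $S\ne\emptyset$ and $|\mathcal C^2(S)|\ge 13$. For non-empty $S$ let $\mathcal Q(S)$ be the set of triples $(\mathbb G,f,l)$ with $\mathbb G\subseteq\mathcal C^2(S)$, $f:\mathcal C^2(S)\to\{0,1\}$, $0\le l\le|\mathcal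 C^1(S)|$, such that: if $S$ is a bottleneck set, then $|\mathbb G|\ge|\mathcal C^2(S)|-12$ and $f$ is constant on $\mathbb G$; if $S$ is not a bottleneck set, then $\mathbb G=\emptyset$. The weighted digraph $\mathcal G_k$. Its vertices are the pairs $v=(X,R)$, where $X\subseteq V(G)$, $|X|\le k+1$ and $R$ assigns to each non-empty $S\subseteq X$ a triple $R(S)=(\mathbb G_S,f_S,l_S)\in\mathcal Q(S)$, together with a sink $t$; the source is $s=(\emptyset,\emptyset)$. Put $$\mathcal V_v=X\cup\bigcup_{\emptyset\ne S\subseteq X}\Big(\{v_1(S),\dots,v_{l_S}(S)\}\cup\bigcup_{H\in\mathcal C^2(S),\,f_S(H)=1}V(H)\Big).$$ There is an edge from $v$ to $t$, of weight $0$, iff $\mathcal V_v=V(G)$. For $v=(X,R)\neq v'=(X',R')$ there is an edge from $v$ to $v'$ iff $\mathcal V_v\subseteq\mathcal V_{v'}$, $(X'\setminus\delta_G(\mathcal V_v))\cap\mathcal V_v=\emptyset$, and one of the following holds. (1) Step edge, of weight $1$: $\mathcal V_{v'}\setminus\mathcal V_v\subseteq X'$ and $\delta_G(\mathcal V_v)=X'\cap\mathcal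 V_v$. (2) Jump edge: $\mathcal V_{v'}\setminus\mathcal V_v\not\subseteq X'$ and there is a bottleneck set $S\subseteq X\cap X'$ such that, writing $R(S)=(\mathbb G_S,f_S,l_S)$, $R'(S)=(\mathbb G'_S,f'_S,l'_S)$, $\bar S=X\cap X'$ and $Y_S=\{v_{l_S+1}(S),\dots,v_{l'_S}(S)\}\cup\bigcup_{H\in\mathbb G'_S}V(H)$, we have $\mathcal V_{v'}\setminus\mathcal V_v=Y_S$, $\delta_G(\mathcal V_v)=\bar S$, $X'=\bar S$, and $G[Y_S]$ has a path decomposition of width at most $k-|\bar S|$. The weight is the minimum length of such a path decomposition of $G[Y_S]$. The weighted length of a directed path is the sum of the weights of its edges. Theorem. For every integer $l\ge 0$, $\mathcal G_k$ contains a directed $s$–$t$ path of weighted length at most $l$ if and only if $G$ has a path decomposition of width at most $k$ and length $l$. Moreover, an integer $l$ is the minimum weighted length of an $s$–$t$ path in $\mathcal G_k$ if and only if it is the minimum length of a path decomposition of $G$ of width at most $k$. -/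

import Mathlib

/-- The width `max |X i| - 1` of a finite sequence of bags (it is `-1` for the empty sequence and for
sequences of empty bags). -/
noncomputable def bagWidth {W : Type*} {l : ℕ} (X : Fin l → Set W) : ℤ :=
  ((Finset.univ.sup fun i => (X i).ncard : ℕ) : ℤ) - 1

/-- `X` is a path decomposition of `G`, of length `l`. -/
structure IsPathDecomposition {W : Type*} (G : SimpleGraph W) {l : ℕ} (X : Fin l → Set W) :
    Prop where
  cover : ⋃ i, X i = Set.univ
  edge : ∀ u v, G.Adj u v → ∃ i, u ∈ X i ∧ v ∈ X i
  interval : ∀ i j k, i ≤ j → j ≤ k → X i ∩ X k ⊆ X j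

/-- `G` has a path decomposition of width at most `w` and of length (exactly) `l`. -/
def HasPathDecomposition {W : Type*} (G : SimpleGraph W) (w : ℤ) (l : ℕ) : Prop :=
  ∃ X : Fin l → Set W, IsPathDecomposition G X ∧ bagWidth X ≤ w

namespace PathLen

/-- The neighbourhood `N_G(A)` of a vertex set. -/
def nbhd {V : Type*} (G : SimpleGraph V) (A : Set V) : Set V :=
  {v | v ∉ A ∧ ∃ a ∈ A, G.Adj a v}

/-- The border in `G` of the induced subgraph `G[A]`. -/
def border {V : Type*} (G : SimpleGraph V) (A : Set V) : Set V :=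
  {v | v ∈ A ∧ ∃ u, u ∉ A ∧ G.Adj v u}

/-- The `S`-components of `G` (given by their vertex sets): the connected components `H` of `G - S`
with `N_G(V(H)) = S`. -/
def components {V : Type*} (G : SimpleGraph V) (S : Set V) : Set (Set V) :=
  {H | (∃ c : (G.induce Sᶜ).ConnectedComponent, H = Subtype.val '' c.supp) ∧ nbhd G H = S}

/-- The `S`-leaves: the vertices that form a one-vertex `S`-component. -/
def leaves {V : Type*} (G : SimpleGraph V) (S : Set V) : Set V :=
  {v | {v} ∈ components G S}

/-- The `S`-branches: the `S`-components with more than one vertex. -/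
def branches {V : Type*} (G : SimpleGraph V) (S : Set V) : Set (Set V) :=
  {H | H ∈ components G S ∧ ¬ ∃ v, H = {v}}

/-- Bottleneck sets. -/
def IsBottleneck {V : Type*} (G : SimpleGraph V) (S : Set V) : Prop :=
  S.Nonempty ∧ 13 ≤ (branches G S).ncard

/-- A triple `(𝔾, f, l)`: a set of `S`-branches, a 0/1-labelling of the `S`-branches, a number. -/
structure Triple {V : Type*} (G : SimpleGraph V) (S : Set V) where
  green : Set (branches G S)
  f : branches G S → Bool
  l : ℕ

/-- The set `𝒬(S)` of admissible triples. -/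
def admissible {V : Type*} (G : SimpleGraph V) (S : Set V) : Set (Triple G S) :=
  {T | T.l ≤ (leaves G S).ncard ∧
    (IsBottleneck G S →
      (branches G S).ncard ≤ T.green.ncard + 12 ∧ ∀ H ∈ T.green, ∀ H' ∈ T.green, T.f H = T.f H') ∧
    (¬ IsBottleneck G S → T.green = ∅)}

/-- The pairs `(X, R)` with `|X| ≤ k + 1` and `R ∈ ℛ(X)`, that is, `R` selects a triple from `𝒬(S)`
for each non-empty `S ⊆ X`. -/
structure Node {V : Type*} (G : SimpleGraph V) (k : ℕ) where
  X : Set V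
  card_le : X.ncard ≤ k + 1
  R : ∀ S : {S : Set V // S.Nonempty ∧ S ⊆ X}, admissible G S.1

/-- The pair `(∅, ∅)`. -/
def Node.empty {V : Type*} (G : SimpleGraph V) (k : ℕ) : Node G k where
  X := ∅
  card_le := by simp
  R := fun S => absurd (Set.subset_empty_iff.mp S.2.2) S.2.1.ne_empty

/-- An enumeration `v_1(S), v_2(S), …` of the `S`-leaves, for every `S` (indices start from `0`
here). -/
abbrev LeafEnum {V : Type*} (G : SimpleGraph V) : Type _ :=
  ∀ S : Set V, Fin (leaves G S).ncard ≃ leaves G S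

/-- The set `{v_{a+1}(S), …, v_b(S)}` of `S`-leaves. -/
def leafRange {V : Type*} {G : SimpleGraph V} (e : LeafEnum G) (S : Set V) (a b : ℕ) : Set V :=
  {x | ∃ i : Fin (leaves G S).ncard, a ≤ i.val ∧ i.val < b ∧ x = (e S i : V)}

/-- The set `𝒱_v` of the vertices of `G` that are covered at the node `v`. -/
def Node.covered {V : Type*} {G : SimpleGraph V} {k : ℕ} (e : LeafEnum G) (v : Node G k) : Set V :=
  v.X ∪ ⋃ S : {S : Set V // S.Nonempty ∧ S ⊆ v.X},
    (leafRange e S.1 0 (v.R S).1.l ∪ ⋃ H ∈ {H | (v.R S).1.f H = true}, (H : Set V))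

/-- The set `Y_S` for a pair of nodes `v = (X, R)`, `v' = (X', R')` and a non-empty set
`S ⊆ X ∩ X'`. -/
def jumpSet {V : Type*} {G : SimpleGraph V} {k : ℕ} (e : LeafEnum G) (v v' : Node G k) (S : Set V)
    (hS : S.Nonempty) (hv : S ⊆ v.X) (hv' : S ⊆ v'.X) : Set V :=
  leafRange e S (v.R ⟨S, hS, hv⟩).1.l (v'.R ⟨S, hS, hv'⟩).1.l ∪
    ⋃ H ∈ (v'.R ⟨S, hS, hv'⟩).1.green, (H : Set V)

/-- The requirements common to step edges and jump edges. -/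
def PreEdge {V : Type*} {G : SimpleGraph V} {k : ℕ} (e : LeafEnum G) (v v' : Node G k) : Prop :=
  v ≠ v' ∧ v.covered e ⊆ v'.covered e ∧ (v'.X \ border G (v.covered e)) ∩ v.covered e = ∅

/-- There is a step edge from `v` to `v'`. -/
def StepEdge {V : Type*} {G : SimpleGraph V} {k : ℕ} (e : LeafEnum G) (v v' : Node G k) : Prop :=
  PreEdge e v v' ∧ v'.covered e \ v.covered e ⊆ v'.X ∧
    border G (v.covered e) = v'.X ∩ v.covered e

/-- There is a jump edge from `v` to `v'`. -/
def JumpEdge {V : Type*} {G : SimpleGraph V} {k : ℕ} (e : LeafEnum G) (v v' : Node G k) : Prop :=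
  PreEdge e v v' ∧ ¬ v'.covered e \ v.covered e ⊆ v'.X ∧
    ∃ (S : Set V) (hS : IsBottleneck G S) (hv : S ⊆ v.X) (hv' : S ⊆ v'.X),
      v'.covered e \ v.covered e = jumpSet e v v' S hS.1 hv hv' ∧
      border G (v.covered e) = v.X ∩ v'.X ∧
      v'.X = v.X ∩ v'.X ∧
      ∃ t : ℕ, HasPathDecomposition (G.induce (jumpSet e v v' S hS.1 hv hv'))
        ((k : ℤ) - (v.X ∩ v'.X).ncard) t

/-- The vertices of the auxiliary digraph: the pairs `(X, R)` and the sink `t`. -/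
inductive Vertex {V : Type*} (G : SimpleGraph V) (k : ℕ) where
  | node (v : Node G k) : Vertex G k
  | sink : Vertex G k

/-- The source `s = (∅, ∅)`. -/
def Vertex.source {V : Type*} (G : SimpleGraph V) (k : ℕ) : Vertex G k :=
  .node (Node.empty G k)

/-- The auxiliary digraph `𝒢_k`. -/
def auxDigraph {V : Type*} {G : SimpleGraph V} (e : LeafEnum G) (k : ℕ) :
    Digraph (Vertex G k) where
  Adj
    | .node v, .node v' => StepEdge e v v' ∨ JumpEdge e v v'
    | .node v, .sink => v.covered e = Set.univ
    | .sink, _ => False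

open scoped Classical in
/-- The edge weights of `𝒢_k`: step edges have weight `1`, edges to the sink have weight `0`, and the
weight of a jump edge is the least length of a path decomposition of width at most `k - |X ∩ X'|` of
`G[Y_S]`, where `Y_S = 𝒱_{v'} \ 𝒱_v` on a jump edge. (Values off the edge set are irrelevant.) -/
noncomputable def weight {V : Type*} {G : SimpleGraph V} (e : LeafEnum G) (k : ℕ) :
    Vertex G k → Vertex G k → ℕ
  | .node v, .node v' =>
      if v'.covered e \ v.covered e ⊆ v'.X then 1
      else sInf {t : ℕ | HasPathDecomposition (G.induce (v'.covered e \ v.covered e))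
        ((k : ℤ) - (v.X ∩ v'.X).ncard) t}
  | _, _ => 0

/-- `𝒢_k` has a directed path `P 0, P 1, …, P m` (without repeated vertices) from the source to the
sink whose weighted length is `l`. -/
def HasPath {V : Type*} {G : SimpleGraph V} (e : LeafEnum G) (k l : ℕ) : Prop :=
  ∃ (m : ℕ) (P : Fin (m + 1) → Vertex G k), Function.Injective P ∧
    P 0 = Vertex.source G k ∧ P (Fin.last m) = Vertex.sink ∧
    (∀ i : Fin m, (auxDigraph e k).Adj (P i.castSucc) (P i.succ)) ∧
    ∑ i : Fin m, weight e k (P i.castSucc) (P i.succ) = l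

end PathLen

/-! A path decomposition of width at most `k` amounts to a growing sequence of vertex sets from `∅`
to `V(G)` in which the bag of a step `B ⊆ C` is `δ(B) ∪ (C \ B)` and has at most `m = k + 1`
vertices (`Reach`). A node of the digraph stands for its covered set, a step edge is one such step,
and a jump edge is a run of steps inside `G[Y_S]` with the border held in every bag. Hence a
source–sink path yields a decomposition (`reach_of_hasPath`).

For the converse, a state `F` is the covered set of a suitable node as soon as the `S`-leaves enter
in the order of their enumeration and no `S` has at least 13 branches finished and at least 13
unfinished at `F` (`Viol`). Leaves of the same `S` are twins, so an automorphism of `G` puts them in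
order (`Lin.exists_leafInit`). Violations are confined to intervals that jump edges can skip. For
this one takes a schedule with as few states as possible, then with as many low states (border at
most `m - 3`, hence at most 1 since `m ≤ 4`) as possible, then with as many sets `S` as possible
whose branches, up to twelve, are processed consecutively (`Star`).

Two exchange arguments exploit this choice. A branch started at a state that is not low must be
processed slowly, with at least `m - 2` border vertices elsewhere all the time; otherwise its start
could be deferred, which creates a new low state (`exists_deferral`). A slow branch `C` uses at
least `|C| - 1` steps of its own, so slow branches can be taken out and processed one after another
elsewhere at no cost (`exists_gather`), without destroying `Star` for another set (`Star.gather`).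
Optimality then turns every violation into `Star` (`Optimal.star_of_viol`).

Finally, crossing intervals of consecutive processing belong to the same `S` and merge, so the
states outside all intervals are linked by step edges and by jump edges over maximal intervals
(`Kept.next`, `exists_path`). -/

namespace PathLen

/-! ### Borders, connectedness through cuts, and `S`-components -/

section Basics

variable {V : Type*} {G : SimpleGraph V}

/-- Connectedness of a vertex set, phrased through cuts. -/
def Conn (G : SimpleGraph V) (H : Set V) : Prop :=
  H.Nonempty ∧ ∀ A : Set V, (H ∩ A).Nonempty → ¬ H ⊆ A → ∃ x ∈ H ∩ A, ∃ y ∈ H \ A, G.Adj x y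

theorem border_subset (A : Set V) : border G A ⊆ A := fun _ h => h.1

theorem border_empty : border G (∅ : Set V) = ∅ := by
  ext; simp [border]

theorem border_univ : border G (Set.univ : Set V) = ∅ := by
  ext; simp [border]

/-- A border vertex stays one in every smaller set that contains it. -/
theorem border_anti {A B : Set V} (h : A ⊆ B) {v : V} (hv : v ∈ border G B) (hA : v ∈ A) :
    v ∈ border G A := by
  obtain ⟨_, u, hu, hadj⟩ := hv
  exact ⟨hA, u, fun h' => hu (h h'), hadj⟩

theorem Conn.exists_border {H A : Set V} (hH : Conn G H) (h1 : (H ∩ A).Nonempty) (h2 : ¬ H ⊆ A) :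
    ∃ x ∈ H, x ∈ border G A := by
  obtain ⟨x, hx, y, hy, hadj⟩ := hH.2 A h1 h2
  exact ⟨x, hx.1, hx.2, y, hy.2, hadj⟩

theorem Conn.subset_of_inter {H Y : Set V} (hH : Conn G H) (hd : Disjoint H (nbhd G Y))
    (h : (H ∩ Y).Nonempty) : H ⊆ Y := by
  by_contra hn
  obtain ⟨x, hx, y, hy, hadj⟩ := hH.2 Y h hn
  exact Set.disjoint_left.1 hd hy.1 ⟨hy.2, x, hx.2, hadj⟩

/-- Used to show that a component containing a vertex of another one also swallows an attachment
vertex of it, and through that vertex further components. -/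
theorem Conn.insert {H : Set V} (hH : Conn G H) {a : V} (ha : a ∈ nbhd G H) :
    Conn G (insert a H) := by
  obtain ⟨haH, b, hb, hadj⟩ := ha
  refine ⟨Set.insert_nonempty _ _, fun A h1 h2 => ?_⟩
  by_cases hHA : H ⊆ A
  · have haA : a ∉ A := fun h => h2 (Set.insert_subset h hHA)
    exact ⟨b, ⟨Or.inr hb, hHA hb⟩, a, ⟨Or.inl rfl, haA⟩, hadj⟩
  · by_cases hm : (H ∩ A).Nonempty
    · obtain ⟨x, hx, y, hy, hxy⟩ := hH.2 A hm hHA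
      exact ⟨x, ⟨Or.inr hx.1, hx.2⟩, y, ⟨Or.inr hy.1, hy.2⟩, hxy⟩
    · have hbA : b ∉ A := fun h => hm ⟨b, hb, h⟩
      have haA : a ∈ A := by
        obtain ⟨x, hx | hx, hxA⟩ := h1
        · exact hx ▸ hxA
        · exact absurd ⟨x, hx, hxA⟩ hm
      exact ⟨a, ⟨Or.inl rfl, haA⟩, b, ⟨Or.inr hb, hbA⟩, hadj.symm⟩

theorem conn_supp {S : Set V} (c : (G.induce Sᶜ).ConnectedComponent) :
    Conn G (Subtype.val '' c.supp) := by
  obtain ⟨x, hx⟩ := c.nonempty_supp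
  classical
  refine ⟨⟨_, x, hx, rfl⟩, fun A h1 h2 => ?_⟩
  obtain ⟨_, ⟨u, hu, rfl⟩, huA⟩ := h1
  obtain ⟨_, ⟨w, hw, rfl⟩, hwA⟩ := Set.not_subset.1 h2
  obtain ⟨p⟩ := SimpleGraph.ConnectedComponent.exact
    ((SimpleGraph.ConnectedComponent.mem_supp_iff c u).1 hu |>.trans
      ((SimpleGraph.ConnectedComponent.mem_supp_iff c w).1 hw).symm)
  obtain ⟨d, hd, h3, h4⟩ := p.exists_boundary_dart (Subtype.val ⁻¹' A) huA hwA
  have key : ∀ z ∈ p.support, z ∈ c.supp := by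
    intro z hz
    rw [SimpleGraph.ConnectedComponent.mem_supp_iff] at hu ⊢
    rw [← hu]
    exact SimpleGraph.ConnectedComponent.sound ⟨(p.takeUntil z hz).reverse⟩
  exact ⟨d.fst, ⟨⟨_, key _ (p.dart_fst_mem_support_of_mem_darts hd), rfl⟩, h3⟩, d.snd,
    ⟨⟨_, key _ (p.dart_snd_mem_support_of_mem_darts hd), rfl⟩, h4⟩, d.adj⟩

/-- Every vertex outside `S` lies in a connected component of `G - S`. -/
theorem exists_supp {S : Set V} {x : V} (hx : x ∉ S) :
    ∃ c : (G.induce Sᶜ).ConnectedComponent, x ∈ Subtype.val '' c.supp ∧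
      Disjoint (Subtype.val '' c.supp) S ∧ nbhd G (Subtype.val '' c.supp) ⊆ S := by
  refine ⟨(G.induce Sᶜ).connectedComponentMk ⟨x, hx⟩, ⟨⟨x, hx⟩, rfl, rfl⟩, ?_, ?_⟩
  · rw [Set.disjoint_left]
    rintro _ ⟨u, _, rfl⟩
    exact u.2
  · rintro y ⟨hy, _, ⟨u, hu, rfl⟩, hadj⟩
    by_contra hyS
    refine hy ⟨⟨y, hyS⟩, ?_, rfl⟩
    rw [SimpleGraph.ConnectedComponent.mem_supp_iff] at hu ⊢
    rw [← hu]
    refine SimpleGraph.ConnectedComponent.sound (SimpleGraph.Adj.reachable ?_)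
    exact hadj.symm

/-- Removes the induced subgraph from the picture: from here on components are plain sets, connected
in the sense of cuts, with prescribed neighbourhood. -/
theorem mem_components_iff {S H : Set V} :
    H ∈ components G S ↔ Conn G H ∧ nbhd G H = S := by
  constructor
  · rintro ⟨⟨c, rfl⟩, h⟩
    exact ⟨conn_supp c, h⟩
  · rintro ⟨hH, hS⟩
    refine ⟨?_, hS⟩
    obtain ⟨x, hx⟩ := hH.1
    have hd : Disjoint H S := by
      rw [Set.disjoint_left]
      intro y hy hyS
      rw [← hS] at hyS
      exact hyS.1 hy
    obtain ⟨c, hc, hcS, hcn⟩ := exists_supp (G := G) (Set.disjoint_left.1 hd hx)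
    refine ⟨c, Set.Subset.antisymm ?_ ?_⟩
    · exact hH.subset_of_inter (hd.mono_right hcn) ⟨x, hx, hc⟩
    · exact (conn_supp c).subset_of_inter (hS ▸ hcS) ⟨x, hc, hx⟩

section Components

variable {S H : Set V}

theorem comp_conn (h : H ∈ components G S) : Conn G H := (mem_components_iff.1 h).1

theorem comp_nbhd (h : H ∈ components G S) : nbhd G H = S := h.2

theorem comp_disjoint (h : H ∈ components G S) : Disjoint H S := by
  rw [Set.disjoint_left]
  intro y hy hyS
  rw [← comp_nbhd h] at hyS
  exact hyS.1 hy

theorem comp_adj (h : H ∈ components G S) {x y : V} (hx : x ∈ H) (hxy : G.Adj x y) :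
    y ∈ H ∨ y ∈ S := by
  by_cases hy : y ∈ H
  · exact Or.inl hy
  · right
    rw [← comp_nbhd h]
    exact ⟨hy, x, hx, hxy⟩

theorem comp_exists_adj (h : H ∈ components G S) {s : V} (hs : s ∈ S) :
    ∃ x ∈ H, G.Adj s x := by
  rw [← comp_nbhd h] at hs
  obtain ⟨_, a, ha, hadj⟩ := hs
  exact ⟨a, ha, hadj.symm⟩

theorem comp_subset_of_inter {K : Set V} (h : H ∈ components G S) (hK : Conn G K)
    (hd : Disjoint K S) (hi : (K ∩ H).Nonempty) : K ⊆ H :=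
  hK.subset_of_inter (by rwa [comp_nbhd h]) hi

theorem comp_eq_of_inter {K : Set V} (h : H ∈ components G S) (hK : K ∈ components G S)
    (hi : (K ∩ H).Nonempty) : K = H :=
  Set.Subset.antisymm (comp_subset_of_inter h (comp_conn hK) (comp_disjoint hK) hi)
    (comp_subset_of_inter hK (comp_conn h) (comp_disjoint h) (by rwa [Set.inter_comm]))

theorem branch_pairwiseDisjoint (𝒟 : Set (Set V)) (h : 𝒟 ⊆ components G S) :
    𝒟.PairwiseDisjoint id := by
  intro K hK H hH hne
  by_contra hn
  exact hne (comp_eq_of_inter (h hH) (h hK) (Set.not_disjoint_iff_nonempty_inter.1 hn))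

theorem branch_two_le [Finite V] (h : H ∈ branches G S) : 2 ≤ H.ncard := by
  by_contra hn
  have h1 : 0 < H.ncard := (Set.ncard_pos (Set.toFinite _)).2 (comp_conn h.1).1
  exact h.2 (Set.ncard_eq_one.1 (by omega))

/-- Disjoint sets each of which meets `B` are at most `|B|` many. -/
theorem ncard_le_of_meets [Finite V] {𝒟 : Set (Set V)} {B : Set V}
    (hd : 𝒟.PairwiseDisjoint id) (h : ∀ C ∈ 𝒟, (C ∩ B).Nonempty) : 𝒟.ncard ≤ B.ncard := by
  rcases 𝒟.eq_empty_or_nonempty with rfl | ⟨C₀, hC₀⟩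
  · simp
  have : Nonempty V := ⟨(h C₀ hC₀).choose⟩
  choose! f hf using h
  refine Set.ncard_le_ncard_of_injOn f (fun C hC => (hf C hC).2) ?_ (Set.toFinite _)
  intro C hC D hD hCD
  by_contra hne
  exact Set.disjoint_left.1 (hd hC hD hne) (hf C hC).1 (by rw [hCD]; exact (hf D hD).1)

end Components

theorem conn_univ [Nonempty V] (hG : G.Preconnected) : Conn G (Set.univ : Set V) := by
  refine ⟨Set.univ_nonempty, fun A h1 h2 => ?_⟩
  obtain ⟨u, -, hu⟩ := h1
  obtain ⟨w, -, hw⟩ := Set.not_subset.1 h2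
  obtain ⟨p⟩ := hG u w
  obtain ⟨d, _, h3, h4⟩ := p.exists_boundary_dart A hu hw
  exact ⟨_, ⟨trivial, h3⟩, _, ⟨trivial, h4⟩, d.adj⟩

theorem nbhd_nonempty (hG : G.Preconnected) {H : Set V} (h1 : H.Nonempty) (h2 : H ≠ Set.univ) :
    (nbhd G H).Nonempty := by
  obtain ⟨x, hx⟩ := h1
  have : Nonempty V := ⟨x⟩
  obtain ⟨x, hx, y, hy, hadj⟩ := (conn_univ hG).2 H ⟨x, trivial, hx⟩
    (fun h => h2 (Set.univ_subset_iff.1 h))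
  exact ⟨y, hy.2, x, hx.2, hadj⟩

/-- The leaves of a fixed `S` are therefore twins, which is what makes their enumeration irrelevant.
-/
theorem mem_leaves_iff {S : Set V} {v : V} : v ∈ leaves G S ↔ G.neighborSet v = S := by
  have h1 : Conn G {v} := by
    refine ⟨⟨v, rfl⟩, fun A h1 h2 => ?_⟩
    obtain ⟨x, hx, hxA⟩ := h1
    exact absurd (Set.singleton_subset_iff.2 (hx ▸ hxA)) h2
  have h2 : nbhd G {v} = G.neighborSet v := by
    ext y
    simp only [nbhd, Set.mem_ofPred_eq, Set.mem_singleton_iff, exists_eq_left,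
      SimpleGraph.mem_neighborSet]
    exact ⟨fun h => h.2, fun h => ⟨h.ne', h⟩⟩
  change {v} ∈ components G S ↔ _
  rw [mem_components_iff, h2]
  exact ⟨fun h => h.2, fun h => ⟨h1, h⟩⟩

end Basics

/-! ### Path decompositions as growing sequences of vertex sets -/

section Reach

variable {V : Type*} {G : SimpleGraph V} {m n : ℕ}

/-- `Reach G m n A B`: the set `A` can be enlarged to `B` in `n` steps, each of them with a bag of
at most `m` vertices, where the bag of a step `B ⊆ C` consists of the border of `B` and `C \ B`. -/
inductive Reach (G : SimpleGraph V) (m : ℕ) : ℕ → Set V → Set V → Prop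
  | refl (A : Set V) : Reach G m 0 A A
  | step {n : ℕ} {A B C : Set V} : Reach G m n A B → B ⊆ C →
      (border G B).ncard + (C \ B).ncard ≤ m → Reach G m (n + 1) A C

theorem Reach.subset {A B : Set V} (h : Reach G m n A B) : A ⊆ B := by
  induction h with
  | refl => exact subset_rfl
  | step _ h1 _ ih => exact ih.trans h1

theorem Reach.trans {p : ℕ} {A B C : Set V} (h : Reach G m n A B) (h' : Reach G m p B C) :
    Reach G m (n + p) A C := by
  induction h' with
  | refl => exact h
  | step _ h1 h2 ih => exact (ih h).step h1 h2

theorem Reach.pad {A : Set V} (h : Reach G m n A Set.univ) {p : ℕ} (hp : n ≤ p) :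
    Reach G m p A Set.univ := by
  induction hp with
  | refl => exact h
  | step _ ih => exact ih.step subset_rfl (by simp [border_univ])

theorem Reach.exists_seq {A B : Set V} (h : Reach G m n A B) :
    ∃ a : ℕ → Set V, a 0 = A ∧ a n = B ∧
      ∀ i < n, a i ⊆ a (i + 1) ∧ (border G (a i)).ncard + (a (i + 1) \ a i).ncard ≤ m := by
  induction h with
  | refl A => exact ⟨fun _ => A, rfl, rfl, by simp⟩
  | @step n A B C _ h1 h2 ih =>
    obtain ⟨a, ha0, han, ha⟩ := ih
    refine ⟨fun i => if i ≤ n then a i else C, by simpa using ha0, by simp, fun i hi => ?_⟩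
    rcases Nat.lt_succ_iff_lt_or_eq.1 hi with hi | rfl
    · simpa [hi.le, Nat.succ_le_of_lt hi] using ha i hi
    · simpa [han] using ⟨h1, h2⟩

theorem reach_of_seq {a : ℕ → Set V}
    (ha : ∀ i < n, a i ⊆ a (i + 1) ∧ (border G (a i)).ncard + (a (i + 1) \ a i).ncard ≤ m) :
    Reach G m n (a 0) (a n) := by
  induction n with
  | zero => exact .refl _
  | succ n ih =>
    exact (ih fun i hi => ha i (by omega)).step (ha n (by omega)).1 (ha n (by omega)).2

theorem bagWidth_le_iff {l : ℕ} {X : Fin l → Set V} :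
    bagWidth X ≤ (m : ℤ) - 1 ↔ ∀ i, (X i).ncard ≤ m := by
  unfold bagWidth
  rw [sub_le_sub_iff_right, Nat.cast_le, Finset.sup_le_iff]
  simp

/-- The set attached to time `i` is the union of the first `i` bags: a border vertex has a neighbour
that appears only later, so the interval property puts it into bag `i`. Conversely the bags are `δ(a
i) ∪ (a (i + 1) \ a i)`; an edge is covered when its later end enters. -/
theorem hasPathDecomposition_iff_reach [Finite V] :
    HasPathDecomposition G ((m : ℤ) - 1) n ↔ Reach G m n ∅ Set.univ := by
  constructor
  · rintro ⟨X, hX, hw⟩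
    rw [bagWidth_le_iff] at hw
    have key : ∀ i (hi : i < n),
        border G (⋃ j : Fin n, ⋃ _ : j.val < i, X j) ⊆ X ⟨i, hi⟩ ∧
        (⋃ j : Fin n, ⋃ _ : j.val < i + 1, X j) \ (⋃ j : Fin n, ⋃ _ : j.val < i, X j)
          ⊆ X ⟨i, hi⟩ := by
      intro i hi
      constructor
      · rintro v ⟨hv, u, hu, hadj⟩
        simp only [Set.mem_iUnion, not_exists] at hv hu
        obtain ⟨j, hj, hvj⟩ := hv
        obtain ⟨p, hvp, hup⟩ := hX.edge v u hadj
        have hp : i ≤ p.val := by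
          by_contra hlt
          exact hu p (by omega) hup
        exact hX.interval j ⟨i, hi⟩ p hj.le hp ⟨hvj, hvp⟩
      · rintro v ⟨hv, hv'⟩
        simp only [Set.mem_iUnion, not_exists] at hv hv'
        obtain ⟨j, hj, hvj⟩ := hv
        have : j.val = i := by
          by_contra hne
          exact hv' j (by omega) hvj
        have hji : j = ⟨i, hi⟩ := Fin.ext this
        rwa [← hji]
    have h := reach_of_seq (G := G) (m := m) (n := n)
      (a := fun i => ⋃ j : Fin n, ⋃ _ : j.val < i, X j) (by
        intro i hi
        refine ⟨fun v hv => ?_, ?_⟩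
        · simp only [Set.mem_iUnion] at hv ⊢
          obtain ⟨j, hj, hvj⟩ := hv
          exact ⟨j, by omega, hvj⟩
        · rw [← Set.ncard_union_eq _ (Set.toFinite _) (Set.toFinite _)]
          · exact (Set.ncard_le_ncard (Set.union_subset (key i hi).1 (key i hi).2)
              (Set.toFinite _)).trans (hw _)
          · exact Set.disjoint_sdiff_right.mono_left (border_subset _))
    have h1 : (⋃ j : Fin n, ⋃ _ : j.val < 0, X j) = ∅ := by simp
    have h2 : (⋃ j : Fin n, ⋃ _ : j.val < n, X j) = Set.univ := by
      rw [← hX.cover]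
      simp
    simpa only [h1, h2] using h
  · intro h
    obtain ⟨a, ha0, han, ha⟩ := h.exists_seq
    have hmono : ∀ i j, i ≤ j → j ≤ n → a i ⊆ a j := by
      intro i j hij
      induction hij with
      | refl => exact fun _ => subset_rfl
      | @step j hij ih => exact fun hj => (ih (by omega)).trans (ha j (by omega)).1
    have hfirst : ∀ j ≤ n, ∀ v ∈ a j, ∃ i < j, v ∈ a (i + 1) \ a i := by
      intro j
      induction j with
      | zero => intro _ v hv; rw [ha0] at hv; exact hv.elim
      | succ j ih =>
        intro hj v hv
        by_cases hvj : v ∈ a j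
        · obtain ⟨i, hi, h⟩ := ih (by omega) v hvj
          exact ⟨i, by omega, h⟩
        · exact ⟨j, by omega, hv, hvj⟩
    refine ⟨fun i => border G (a i) ∪ (a (i + 1) \ a i), ⟨?_, ?_, ?_⟩, ?_⟩
    · refine Set.eq_univ_of_forall fun v => ?_
      obtain ⟨i, hi, h⟩ := hfirst n le_rfl v (han ▸ trivial)
      exact Set.mem_iUnion.2 ⟨⟨i, hi⟩, Or.inr h⟩
    · have main : ∀ u v, G.Adj u v → ∀ i (hi : i < n) j, j < n → u ∈ a (i + 1) \ a i →
          v ∈ a (j + 1) \ a j → i ≤ j →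
          ∃ p : Fin n, u ∈ border G (a p) ∪ (a (p + 1) \ a p) ∧
            v ∈ border G (a p) ∪ (a (p + 1) \ a p) := by
        intro u v huv i hi j hj hu hv hij
        refine ⟨⟨j, hj⟩, ?_, Or.inr hv⟩
        rcases hij.eq_or_lt with rfl | hlt
        · exact Or.inr hu
        · exact Or.inl ⟨hmono (i + 1) j hlt hj.le hu.1, v, hv.2, huv⟩
      intro u v huv
      obtain ⟨i, hi, hu⟩ := hfirst n le_rfl u (han ▸ trivial)
      obtain ⟨j, hj, hv⟩ := hfirst n le_rfl v (han ▸ trivial)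
      rcases le_total i j with hij | hij
      · exact main u v huv i hi j hj hu hv hij
      · obtain ⟨p, h1, h2⟩ := main v u huv.symm j hj i hi hv hu hij
        exact ⟨p, h2, h1⟩
    · rintro i j p hij hjp v ⟨hvi, hvp⟩
      rcases hij.eq_or_lt with rfl | hij'
      · exact hvi
      rcases hjp.eq_or_lt with rfl | hjp'
      · exact hvp
      have hv1 : v ∈ a j := by
        refine hmono (i + 1) j hij' j.2.le ?_
        rcases hvi with h | h
        · exact (ha i i.2).1 h.1
        · exact h.1
      have hv2 : v ∈ a p := hmono j p hjp p.2.le hv1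
      rcases hvp with h | h
      · exact Or.inl (border_anti (hmono j p hjp p.2.le) h hv1)
      · exact absurd hv2 h.2
    · rw [bagWidth_le_iff]
      intro i
      exact (Set.ncard_union_le _ _).trans (ha i i.2).2

/-- All neighbours of `Y` outside `Y` are already in `A`, so the border of `A ∪ B` is at most that
of `A` plus the border of `B` inside `G[Y]`; `r` is the room left next to `δ(A)`. -/
theorem Reach.of_induce [Finite V] {A Y : Set V}
    (hY : ∀ x ∈ Y, ∀ y, G.Adj x y → y ∈ Y ∨ y ∈ A) {r : ℕ} (hr : r + (border G A).ncard ≤ m)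
    {B C : Set Y} (h : Reach (G.induce Y) r n B C) :
    Reach G m n (A ∪ Subtype.val '' B) (A ∪ Subtype.val '' C) := by
  induction h with
  | refl => exact .refl _
  | @step n B C D _ h1 h2 ih =>
    refine ih.step (Set.union_subset_union_right _ (Set.image_mono h1)) ?_
    have hb : border G (A ∪ Subtype.val '' C) ⊆
        border G A ∪ Subtype.val '' (border (G.induce Y) C) := by
      rintro v ⟨hv, u, hu, hadj⟩
      rw [Set.mem_union, not_or] at hu
      rcases hv with hv | ⟨y, hy, rfl⟩
      · exact Or.inl ⟨hv, u, hu.1, hadj⟩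
      · rcases hY y y.2 u hadj with huY | huA
        · exact Or.inr ⟨y, ⟨hy, ⟨u, huY⟩, fun h => hu.2 ⟨_, h, rfl⟩, hadj⟩, rfl⟩
        · exact absurd huA hu.1
    have hd : (A ∪ Subtype.val '' D) \ (A ∪ Subtype.val '' C) ⊆ Subtype.val '' (D \ C) := by
      rintro v ⟨hv | ⟨y, hy, rfl⟩, hv'⟩
      · exact absurd (Or.inl hv) hv'
      · exact ⟨y, ⟨hy, fun h => hv' (Or.inr ⟨y, h, rfl⟩)⟩, rfl⟩
    have e1 := (Set.ncard_le_ncard hb (Set.toFinite _)).trans (Set.ncard_union_le _ _)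
    have e2 := Set.ncard_le_ncard hd (Set.toFinite _)
    rw [Set.ncard_image_of_injective _ Subtype.val_injective] at e1 e2
    omega

/-- A vertex of `δ(A)` that is still in `δ(T)` is in every border in between, so `|δ(A)|` places of
each bag are blocked and the rest is a bag for `G[T \ A]`. -/
theorem Reach.induce [Finite V] {A B T : Set V} (h : Reach G m n A B) (hB : B ⊆ T)
    (hb : border G A ⊆ border G T) :
    Reach (G.induce (T \ A)) (m - (border G A).ncard) n ∅ (Subtype.val ⁻¹' B) := by
  induction h with
  | refl A =>
    have : (Subtype.val ⁻¹' A : Set ↑(T \ A)) = ∅ := by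
      ext ⟨x, hx⟩
      simpa using hx.2
    rw [this]
    exact .refl _
  | @step n A B C h0 h1 h2 ih =>
    refine (ih (h1.trans hB) hb).step (Set.preimage_mono h1) ?_
    have hs : border G A ∪ Subtype.val '' (border (G.induce (T \ A)) (Subtype.val ⁻¹' B)) ⊆
        border G B := by
      refine Set.union_subset (fun v hv => ?_) ?_
      · exact border_anti (h1.trans hB) (hb hv) (h0.subset hv.1)
      · rintro _ ⟨y, ⟨hy, u, hu, hadj⟩, rfl⟩
        exact ⟨hy, u, hu, hadj⟩
    have hd : Subtype.val '' (Subtype.val ⁻¹' C \ Subtype.val ⁻¹' B : Set ↑(T \ A)) ⊆ C \ B := by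
      rintro _ ⟨y, hy, rfl⟩
      exact hy
    have e1 := Set.ncard_le_ncard hs (Set.toFinite _)
    have e2 := Set.ncard_le_ncard hd (Set.toFinite _)
    rw [Set.ncard_image_of_injective _ Subtype.val_injective] at e2
    rw [Set.ncard_union_eq, Set.ncard_image_of_injective _ Subtype.val_injective] at e1
    · omega
    · rw [Set.disjoint_right]
      rintro _ ⟨y, _, rfl⟩ hy
      exact y.2.2 hy.1

end Reach

/-! ### From digraph paths to path decompositions -/

section PathToDecomposition

variable {V : Type*} {G : SimpleGraph V} {k : ℕ} {e : LeafEnum G}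

theorem Node.X_subset_covered (v : Node G k) : v.X ⊆ v.covered e := Set.subset_union_left

theorem jumpSet_adj {v v' : Node G k} {S : Set V} (hS : S.Nonempty) (hv : S ⊆ v.X)
    (hv' : S ⊆ v'.X) {x y : V} (hx : x ∈ jumpSet e v v' S hS hv hv') (hxy : G.Adj x y) :
    y ∈ jumpSet e v v' S hS hv hv' ∨ y ∈ S := by
  rcases hx with ⟨i, _, _, rfl⟩ | hx
  · right
    have h : ({(e S i : V)} : Set V) ∈ components G S := (e S i).2
    rcases comp_adj h rfl hxy with h' | h'
    · exact absurd h' hxy.ne'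
    · exact h'
  · simp only [Set.mem_iUnion] at hx
    obtain ⟨H, hH, hxH⟩ := hx
    rcases comp_adj H.2.1 hxH hxy with h' | h'
    · left
      right
      simp only [Set.mem_iUnion]
      exact ⟨H, hH, h'⟩
    · exact Or.inr h'

theorem reach_of_adj [Finite V] {v v' : Node G k} (h : (auxDigraph e k).Adj (.node v) (.node v')) :
    Reach G (k + 1) (weight e k (.node v) (.node v')) (v.covered e) (v'.covered e) := by
  rcases h with ⟨⟨_, hsub, _⟩, hX, hb⟩ | ⟨⟨_, hsub, _⟩, hX, S, hS, hv, hv', hY, hb, hX', t, ht⟩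
  · have hw : weight e k (.node v) (.node v') = 1 := by simp [weight, hX]
    rw [hw]
    refine (Reach.refl _).step hsub ?_
    rw [← Set.ncard_union_eq (Set.disjoint_sdiff_right.mono_left (border_subset _))
      (Set.toFinite _) (Set.toFinite _)]
    refine (Set.ncard_le_ncard (Set.union_subset ?_ hX) (Set.toFinite _)).trans v'.card_le
    exact hb ▸ Set.inter_subset_left
  · have hw : HasPathDecomposition (G.induce (v'.covered e \ v.covered e))
        ((k : ℤ) - (v.X ∩ v'.X).ncard) (weight e k (.node v) (.node v')) := by
      simp only [weight, hX, if_false]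
      rw [← hY] at ht
      exact Nat.sInf_mem (s := {t | HasPathDecomposition (G.induce (v'.covered e \ v.covered e))
        ((k : ℤ) - (v.X ∩ v'.X).ncard) t}) ⟨t, ht⟩
    have hc : (v.X ∩ v'.X).ncard ≤ k + 1 :=
      (Set.ncard_le_ncard Set.inter_subset_left (Set.toFinite _)).trans v.card_le
    -- The bound `|X ∩ X'| ≤ k + 1` makes the truncated subtraction exact.
    have hk : (k : ℤ) - (v.X ∩ v'.X).ncard = ((k + 1 - (v.X ∩ v'.X).ncard : ℕ) : ℤ) - 1 := by
      omega
    rw [hk, hasPathDecomposition_iff_reach] at hw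
    have h := Reach.of_induce (A := v.covered e) (m := k + 1) (fun x hx y hxy => by
      rw [hY] at hx ⊢
      exact (jumpSet_adj hS.1 hv hv' hx hxy).imp_right
        fun h => v.X_subset_covered (hv h)) (by rw [hb]; omega) hw
    rwa [Set.image_empty, Set.union_empty, Set.image_univ, Subtype.range_coe,
      Set.union_sdiff_cancel hsub] at h

theorem reach_of_hasPath [Finite V] {l : ℕ} (h : HasPath e k l) : Reach G (k + 1) l ∅ Set.univ := by
  obtain ⟨m, P, _, h0, hm, hadj, hl⟩ := h
  set w : ℕ → ℕ := fun j =>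
    if h : j < m then weight e k (P (Fin.castSucc ⟨j, h⟩)) (P (Fin.succ ⟨j, h⟩)) else 0 with hw
  have key : ∀ i (hi : i < m + 1) v, P ⟨i, hi⟩ = .node v →
      Reach G (k + 1) (∑ j ∈ Finset.range i, w j) ∅ (v.covered e) := by
    intro i
    induction i with
    | zero =>
      intro hi v hv
      have : Vertex.source G k = .node v := h0.symm.trans hv
      rw [Vertex.source, Vertex.node.injEq] at this
      subst this
      have hc : (Node.empty G k).covered e = ∅ := by
        rw [Set.eq_empty_iff_forall_notMem]
        rintro x (hx | hx)
        · exact hx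
        · obtain ⟨S, _⟩ := Set.mem_iUnion.1 hx
          exact S.2.1.ne_empty (Set.subset_empty_iff.1 S.2.2)
      rw [hc]
      exact .refl _
    | succ i ih =>
      intro hi v hv
      have ha := hadj ⟨i, by omega⟩
      have hs : P (Fin.succ ⟨i, by omega⟩) = .node v := hv
      rw [hs] at ha
      rcases hu : P (Fin.castSucc ⟨i, by omega⟩) with u | _
      · rw [hu] at ha
        rw [Finset.sum_range_succ]
        refine (ih (by omega) u hu).trans ?_
        have : w i = weight e k (.node u) (.node v) := by
          simp only [hw, show i < m by omega, dif_pos, hu, hs]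
        rw [this]
        exact reach_of_adj ha
      · rw [hu] at ha
        exact ha.elim
  obtain _ | m := m
  · have : Vertex.source G k = .sink := h0.symm.trans hm
    cases this
  have ha := hadj (Fin.last m)
  rw [Fin.succ_last, hm] at ha
  rcases hu : P (Fin.castSucc (Fin.last m)) with u | _
  · rw [hu] at ha
    have hr := key m (by omega) u hu
    have hl' : ∑ j ∈ Finset.range m, w j = l := by
      rw [← hl, Fin.sum_univ_castSucc, Fin.succ_last, hm, hu, Finset.sum_range]
      simp only [weight, add_zero]
      refine Finset.sum_congr rfl fun i _ => ?_
      simp only [hw, show i.val < m + 1 by omega, dif_pos]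
      rfl
    rw [hl', show u.covered e = Set.univ from ha] at hr
    exact hr
  · rw [hu] at ha
    exact ha.elim

end PathToDecomposition

/-! ### Schedules as families of states -/

section Schedules

variable {V : Type*} {G : SimpleGraph V} {m : ℕ} {𝒜 : Set (Set V)}

/-- A schedule: a family of vertex sets that contains the empty set and in which each set other than
`univ` can be enlarged to another set of the family by a step with a bag of at most `m` vertices. -/
structure Sched (G : SimpleGraph V) (m : ℕ) (𝒜 : Set (Set V)) : Prop where
  empty_mem : ∅ ∈ 𝒜
  step : ∀ F ∈ 𝒜, F ≠ Set.univ →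
    ∃ F' ∈ 𝒜, F ⊂ F' ∧ (border G F).ncard + (F' \ F).ncard ≤ m

/-- A schedule that is linearly ordered by inclusion. -/
structure Lin (G : SimpleGraph V) (m : ℕ) (𝒜 : Set (Set V)) : Prop extends Sched G m 𝒜 where
  chain : IsChain (· ⊆ ·) 𝒜

/-- `F'` is the successor of `F` in `𝒜`. -/
def IsNext (𝒜 : Set (Set V)) (F F' : Set V) : Prop :=
  F' ∈ 𝒜 ∧ F ⊂ F' ∧ ∀ H ∈ 𝒜, F ⊂ H → F' ⊆ H

/-- The step from `F` to its successor adds vertices of `M` only. -/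
def PureStep (𝒜 : Set (Set V)) (M F : Set V) : Prop :=
  ∃ F', IsNext 𝒜 F F' ∧ F' \ F ⊆ M

/-- The members of `𝒜` before `E` whose steps add vertices of `M` only. -/
def pureSet (𝒜 : Set (Set V)) (M E : Set V) : Set (Set V) :=
  {F | F ∈ 𝒜 ∧ F ⊂ E ∧ PureStep 𝒜 M F}

/-- Before `E`, whenever `C` is being processed, at least `m - 2` border vertices are outside `C`. -/
def SlowTo (G : SimpleGraph V) (m : ℕ) (𝒜 : Set (Set V)) (C E : Set V) : Prop :=
  ∀ F F', F ∈ 𝒜 → IsNext 𝒜 F F' → F ⊂ E → ¬ C ⊆ F → (F' ∩ C).Nonempty →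
    m ≤ (border G F \ C).ncard + 2

theorem IsNext.unique {F F₁ F₂ : Set V} (h₁ : IsNext 𝒜 F F₁) (h₂ : IsNext 𝒜 F F₂) : F₁ = F₂ :=
  Set.Subset.antisymm (h₁.2.2 _ h₂.1 h₂.2.1) (h₂.2.2 _ h₁.1 h₁.2.1)

namespace Lin

theorem total (h : Lin G m 𝒜) {A B : Set V} (hA : A ∈ 𝒜) (hB : B ∈ 𝒜) : A ⊆ B ∨ B ⊆ A :=
  h.chain.total hA hB

theorem ssubset_of_not_subset (h : Lin G m 𝒜) {A B : Set V} (hA : A ∈ 𝒜) (hB : B ∈ 𝒜)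
    (hn : ¬ B ⊆ A) : A ⊂ B :=
  ⟨(h.total hA hB).resolve_right hn, hn⟩

theorem subset_or_next_subset (h : Lin G m 𝒜) {F F' H : Set V} (hF : F ∈ 𝒜)
    (hn : IsNext 𝒜 F F') (hH : H ∈ 𝒜) : H ⊆ F ∨ F' ⊆ H := by
  by_cases hc : H ⊆ F
  · exact Or.inl hc
  · exact Or.inr (hn.2.2 H hH (h.ssubset_of_not_subset hF hH hc))

variable [Finite V]

theorem exists_least (h : Lin G m 𝒜) {p : Set V → Prop} (hp : ∃ F ∈ 𝒜, p F) :
    ∃ F ∈ 𝒜, p F ∧ ∀ H ∈ 𝒜, p H → F ⊆ H := by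
  obtain ⟨F, hF, hpF⟩ := hp
  obtain ⟨M, hM⟩ := (Set.toFinite {F | F ∈ 𝒜 ∧ p F}).exists_minimal ⟨F, hF, hpF⟩
  refine ⟨M, hM.1.1, hM.1.2, fun H hH hpH => ?_⟩
  rcases h.total hM.1.1 hH with h' | h'
  · exact h'
  · exact hM.2 ⟨hH, hpH⟩ h'

theorem exists_greatest (h : Lin G m 𝒜) {p : Set V → Prop} (hp : ∃ F ∈ 𝒜, p F) :
    ∃ F ∈ 𝒜, p F ∧ ∀ H ∈ 𝒜, p H → H ⊆ F := by
  obtain ⟨F, hF, hpF⟩ := hp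
  obtain ⟨M, hM⟩ := (Set.toFinite {F | F ∈ 𝒜 ∧ p F}).exists_maximal ⟨F, hF, hpF⟩
  refine ⟨M, hM.1.1, hM.1.2, fun H hH hpH => ?_⟩
  rcases h.total hH hM.1.1 with h' | h'
  · exact h'
  · exact hM.2 ⟨hH, hpH⟩ h'

theorem exists_next (h : Lin G m 𝒜) {F : Set V} (hF : F ∈ 𝒜) (hu : F ≠ Set.univ) :
    ∃ F', IsNext 𝒜 F F' := by
  obtain ⟨K, hK, hFK, _⟩ := h.step F hF hu
  obtain ⟨F', h1, h2, h3⟩ := h.exists_least (p := fun H => F ⊂ H) ⟨K, hK, hFK⟩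
  exact ⟨F', h1, h2, h3⟩

/-- The successor is contained in the target of the step that the schedule provides, so its bag is
no larger. -/
theorem next_bound (h : Lin G m 𝒜) {F F' : Set V} (hF : F ∈ 𝒜) (hn : IsNext 𝒜 F F') :
    (border G F).ncard + (F' \ F).ncard ≤ m := by
  have hu : F ≠ Set.univ := fun h' => hn.2.1.2 (h' ▸ Set.subset_univ _)
  obtain ⟨K, hK, hFK, hb⟩ := h.step F hF hu
  have := Set.ncard_le_ncard (Set.sdiff_subset_sdiff_left (t := F) (hn.2.2 K hK hFK))
    (Set.toFinite _)
  omega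

theorem diff_pos {F F' : Set V} (hn : F ⊂ F') : 0 < (F' \ F).ncard := by
  rw [Set.ncard_pos (Set.toFinite _)]
  exact Set.nonempty_of_ssubset hn

theorem border_lt (h : Lin G m 𝒜) {F : Set V} (hF : F ∈ 𝒜) (hu : F ≠ Set.univ) :
    (border G F).ncard + 1 ≤ m := by
  obtain ⟨F', hn⟩ := h.exists_next hF hu
  have := h.next_bound hF hn
  have := diff_pos hn.2.1
  omega

theorem univ_mem (h : Lin G m 𝒜) : Set.univ ∈ 𝒜 := by
  obtain ⟨F, hF, _, hmax⟩ := h.exists_greatest (p := fun _ => True) ⟨∅, h.empty_mem, trivial⟩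
  by_cases hu : F = Set.univ
  · exact hu ▸ hF
  · obtain ⟨K, hK, hFK, _⟩ := h.step F hF hu
    exact absurd (hmax K hK trivial) hFK.2

theorem reach (h : Lin G m 𝒜) {A B : Set V} (hA : A ∈ 𝒜) (hB : B ∈ 𝒜) (hAB : A ⊆ B) :
    Reach G m {F | F ∈ 𝒜 ∧ A ⊂ F ∧ F ⊆ B}.ncard A B := by
  induction hs : {F | F ∈ 𝒜 ∧ A ⊂ F ∧ F ⊆ B}.ncard generalizing B with
  | zero =>
    rw [Set.ncard_eq_zero (Set.toFinite _)] at hs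
    have : ¬ A ⊂ B := fun h' => by
      have : B ∈ {F | F ∈ 𝒜 ∧ A ⊂ F ∧ F ⊆ B} := ⟨hB, h', subset_rfl⟩
      rw [hs] at this
      exact this
    have : A = B := by
      by_contra hne
      exact this (hAB.ssubset_of_ne hne)
    exact this ▸ .refl _
  | succ n ih =>
    have hlt : A ⊂ B := by
      refine hAB.ssubset_of_ne ?_
      rintro rfl
      rw [Set.ncard_eq_zero (Set.toFinite _) |>.2] at hs
      · omega
      · ext F
        simp only [Set.mem_ofPred_eq, Set.mem_empty_iff_false, iff_false]
        exact fun h' => h'.2.1.2 h'.2.2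
    obtain ⟨P, hP, hPB, hmax⟩ := h.exists_greatest (p := fun F => F ⊂ B) ⟨A, hA, hlt⟩
    have hAP := hmax A hA hlt
    have hn : IsNext 𝒜 P B := ⟨hB, hPB, fun H hH hPH => by
      by_contra hc
      exact hPH.2 (hmax H hH (h.ssubset_of_not_subset hH hB hc))⟩
    refine (ih hP hAP ?_).step hPB.1 (h.next_bound hP hn)
    have : {F | F ∈ 𝒜 ∧ A ⊂ F ∧ F ⊆ B} = insert B {F | F ∈ 𝒜 ∧ A ⊂ F ∧ F ⊆ P} := by
      ext F
      simp only [Set.mem_ofPred_eq, Set.mem_insert_iff]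
      constructor
      · rintro ⟨h1, h2, h3⟩
        by_cases hFB : F = B
        · exact Or.inl hFB
        · exact Or.inr ⟨h1, h2, hmax F h1 (h3.ssubset_of_ne hFB)⟩
      · rintro (rfl | ⟨h1, h2, h3⟩)
        · exact ⟨hB, hlt, subset_rfl⟩
        · exact ⟨h1, h2, h3.trans hPB.1⟩
    rw [this, Set.ncard_insert_of_notMem (fun h' => hPB.2 h'.2.2) (Set.toFinite _)] at hs
    omega

end Lin

/-! ### Slowly processed components -/

section Slow

variable [Finite V] {C E : Set V}

theorem ncard_inter_add (F F' : Set V) (hFF : F ⊆ F') :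
    (F' ∩ C).ncard = (F ∩ C).ncard + ((F' \ F) ∩ C).ncard := by
  rw [← Set.ncard_union_eq _ (Set.toFinite _) (Set.toFinite _)]
  · rw [← Set.union_inter_distrib_right, Set.union_sdiff_cancel hFF]
  · exact Set.disjoint_sdiff_right.mono Set.inter_subset_left Set.inter_subset_left

theorem SlowTo.step_le_two (hL : Lin G m 𝒜) (hs : SlowTo G m 𝒜 C E) {F F' : Set V} (hF : F ∈ 𝒜)
    (hn : IsNext 𝒜 F F') (hE : F ⊂ E) (hC : ¬ C ⊆ F) (hC' : (F' ∩ C).Nonempty) :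
    (F' \ F).ncard ≤ 2 := by
  have h1 := hs F F' hF hn hE hC hC'
  have h2 := hL.next_bound hF hn
  have h3 := Set.ncard_le_ncard (Set.sdiff_subset : border G F \ C ⊆ _) (Set.toFinite _)
  omega

/-- A bag has two places beyond the `m - 2` border vertices outside `C`. Once `C` is begun and
unfinished, connectedness gives a border vertex in `C`, which takes one of them; the new vertex
takes the other. -/
theorem SlowTo.step_le_one (hL : Lin G m 𝒜) (hs : SlowTo G m 𝒜 C E) (hconn : Conn G C)
    {F F' : Set V} (hF : F ∈ 𝒜) (hn : IsNext 𝒜 F F') (hE : F ⊂ E) (hC : ¬ C ⊆ F)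
    (hC' : (F ∩ C).Nonempty) : (F' \ F).ncard ≤ 1 ∧ (border G F ∩ C).ncard ≤ 1 := by
  have h1 := hs F F' hF hn hE hC (hC'.mono (Set.inter_subset_inter_left _ hn.2.1.1))
  have h2 := hL.next_bound hF hn
  have h3 := Set.ncard_inter_add_ncard_sdiff_eq_ncard (border G F) C (Set.toFinite _)
  have h4 : 0 < (border G F ∩ C).ncard := by
    rw [Set.ncard_pos (Set.toFinite _)]
    obtain ⟨x, hx, hxb⟩ := hconn.exists_border (by rwa [Set.inter_comm]) hC
    exact ⟨x, hxb, hx⟩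
  have h5 := Lin.diff_pos hn.2.1
  omega

/-- At most two vertices enter in the step that starts `C`, and one at a time afterwards, so the
processed part of `C` passes through every size from 2 on. The step that reaches size `j` has no
room for vertices outside `C`. -/
theorem SlowTo.exists_step (hL : Lin G m 𝒜) (hs : SlowTo G m 𝒜 C E) (hconn : Conn G C)
    (hE : E ∈ 𝒜) {j : ℕ} (h2 : 2 ≤ j) (hj : j ≤ (E ∩ C).ncard) :
    ∃ F F', F ∈ 𝒜 ∧ IsNext 𝒜 F F' ∧ F ⊂ E ∧ F' ⊆ E ∧ ¬ C ⊆ F ∧ (F' ∩ C).Nonempty ∧ F' \ F ⊆ C ∧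
      (F' ∩ C).ncard = j := by
  obtain ⟨F, hF, hlt, hmax⟩ := hL.exists_greatest (p := fun F => (F ∩ C).ncard < j)
    ⟨∅, hL.empty_mem, by rw [Set.empty_inter, Set.ncard_empty]; omega⟩
  have hFE : F ⊂ E := by
    refine hL.ssubset_of_not_subset hF hE fun h => ?_
    have := Set.ncard_le_ncard (Set.inter_subset_inter_left C h) (Set.toFinite _)
    omega
  have hu : F ≠ Set.univ := fun h => hFE.2 (h ▸ Set.subset_univ _)
  obtain ⟨F', hn⟩ := hL.exists_next hF hu
  have hj' : j ≤ (F' ∩ C).ncard := by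
    by_contra h
    exact hn.2.1.2 (hmax F' hn.1 (not_le.1 h))
  have hCF : ¬ C ⊆ F := by
    intro h
    rw [Set.inter_eq_right.2 h] at hlt
    have := Set.ncard_le_ncard (Set.inter_subset_right : E ∩ C ⊆ C) (Set.toFinite _)
    omega
  have hne : (F' ∩ C).Nonempty := by
    rw [← Set.ncard_pos (Set.toFinite _)]
    omega
  have hadd := ncard_inter_add (C := C) F F' hn.2.1.1
  have hle := Set.ncard_le_ncard (Set.inter_subset_left : (F' \ F) ∩ C ⊆ F' \ F) (Set.toFinite _)
  have key : (F' \ F).ncard ≤ ((F' \ F) ∩ C).ncard ∧ (F' ∩ C).ncard = j := by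
    rcases (F ∩ C).eq_empty_or_nonempty with h0 | h0
    · have := hs.step_le_two hL hF hn hFE hCF hne
      rw [h0, Set.ncard_empty] at hadd
      omega
    · have := (hs.step_le_one hL hconn hF hn hFE hCF h0).1
      omega
  refine ⟨F, F', hF, hn, hFE, hn.2.2 E hE hFE, hCF, hne, ?_, key.2⟩
  rw [← Set.inter_eq_left]
  exact Set.eq_of_subset_of_ncard_le Set.inter_subset_left key.1 (Set.toFinite _)

/-- The sizes `2, …, |E ∩ C|` are reached by different steps, each spent on `C` alone. This is the
number of states that a separate processing of `E ∩ C` needs, so moving it costs nothing. -/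
theorem SlowTo.le_ncard_pureSet (hL : Lin G m 𝒜) (hs : SlowTo G m 𝒜 C E) (hconn : Conn G C)
    (hE : E ∈ 𝒜) : (E ∩ C).ncard - 1 ≤ (pureSet 𝒜 C E).ncard := by
  have hex : ∀ j ∈ Set.Icc 2 (E ∩ C).ncard, ∃ F F', F ∈ 𝒜 ∧ IsNext 𝒜 F F' ∧ F ⊂ E ∧
      F' \ F ⊆ C ∧ (F' ∩ C).ncard = j := by
    rintro j ⟨h2, hj⟩
    obtain ⟨F, F', h⟩ := hs.exists_step hL hconn hE h2 hj
    exact ⟨F, F', h.1, h.2.1, h.2.2.1, h.2.2.2.2.2.2⟩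
  choose! f f' hf using hex
  have hc : (Set.Icc 2 (E ∩ C).ncard).ncard = (E ∩ C).ncard - 1 := by
    rw [Set.ncard_eq_toFinset_card', Set.toFinset_Icc, Nat.card_Icc]
    omega
  rw [← hc]
  refine Set.ncard_le_ncard_of_injOn f (fun j hj => ?_) ?_ (Set.toFinite _)
  · obtain ⟨h1, h2, h3, h4, _⟩ := hf j hj
    exact ⟨h1, h3, f' j, h2, h4⟩
  · intro i hi j hj hij
    obtain ⟨_, h2, _, _, h5⟩ := hf i hi
    obtain ⟨_, h2', _, _, h5'⟩ := hf j hj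
    rw [hij] at h2
    rw [← h5, ← h5', h2.unique h2']

/-- The sets that occur when the part of `C` in `E` is added to `B` in the order of `𝒜`. -/
def insertion (𝒜 : Set (Set V)) (C E B : Set V) : Set (Set V) :=
  {X | ∃ F ∈ 𝒜, F ⊆ E ∧ 2 ≤ (F ∩ C).ncard ∧ X = B ∪ (F ∩ C)}

theorem ncard_insertion_le (hL : Lin G m 𝒜) (B : Set V) :
    (insertion 𝒜 C E B).ncard ≤ (E ∩ C).ncard - 1 := by
  have hc : (Set.Icc 2 (E ∩ C).ncard).ncard = (E ∩ C).ncard - 1 := by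
    rw [Set.ncard_eq_toFinset_card', Set.toFinset_Icc, Nat.card_Icc]
    omega
  set 𝒰 : Set (Set V) := {U | ∃ F ∈ 𝒜, F ⊆ E ∧ 2 ≤ (F ∩ C).ncard ∧ U = F ∩ C} with h𝒰
  have h1 : insertion 𝒜 C E B ⊆ (B ∪ ·) '' 𝒰 := by
    rintro _ ⟨F, h1, h2, h3, rfl⟩
    exact ⟨F ∩ C, ⟨F, h1, h2, h3, rfl⟩, rfl⟩
  refine ((Set.ncard_le_ncard h1 (Set.toFinite _)).trans
    (Set.ncard_image_le (Set.toFinite _))).trans ?_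
  rw [← hc]
  refine Set.ncard_le_ncard_of_injOn Set.ncard ?_ ?_ (Set.toFinite _)
  · rintro _ ⟨F, h1, h2, h3, rfl⟩
    exact ⟨h3, Set.ncard_le_ncard (Set.inter_subset_inter_left _ h2) (Set.toFinite _)⟩
  · rintro _ ⟨F, h1, h2, h3, rfl⟩ _ ⟨F', h1', h2', h3', rfl⟩ heq
    rcases hL.total h1 h1' with h | h
    · exact Set.eq_of_subset_of_ncard_le (Set.inter_subset_inter_left _ h) heq.ge (Set.toFinite _)
    · exact (Set.eq_of_subset_of_ncard_le (Set.inter_subset_inter_left _ h) heq.le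
        (Set.toFinite _)).symm

/-- The two free places next to `δ(B)` suffice: the first step adds two vertices of `C`, and later
the part of the border inside `C` and the new part of `C` have one vertex each, as in the original
slow processing. -/
theorem insertion_step (hL : Lin G m 𝒜) (hs : SlowTo G m 𝒜 C E) (hconn : Conn G C)
    (hE : E ∈ 𝒜) {B : Set V} (hBC : Disjoint B C) (hNB : nbhd G C ⊆ B)
    (hB : (border G B).ncard + 2 ≤ m) (h2 : 2 ≤ (E ∩ C).ncard) {X : Set V}
    (hX : X = B ∨ X ∈ insertion 𝒜 C E B) (hne : X ≠ B ∪ (E ∩ C)) :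
    ∃ X' ∈ insertion 𝒜 C E B, X ⊂ X' ∧ (border G X).ncard + (X' \ X).ncard ≤ m := by
  rcases hX with rfl | ⟨F, hF, hFE, hF2, rfl⟩
  · obtain ⟨F, F', hF, hn, hFE, hFE', hC, hC', hsub, hcard⟩ :=
      hs.exists_step hL hconn hE le_rfl h2
    refine ⟨X ∪ (F' ∩ C), ⟨F', hn.1, hFE', hcard.ge, rfl⟩, ?_, ?_⟩
    · refine Set.ssubset_iff_subset_ne.2 ⟨Set.subset_union_left, fun h => ?_⟩
      obtain ⟨x, hx⟩ := hC'
      exact Set.disjoint_left.1 hBC (h ▸ Or.inr hx) hx.2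
    · have : (X ∪ (F' ∩ C)) \ X ⊆ F' ∩ C := by
        rintro x ⟨h1 | h1, h2⟩
        · exact absurd h1 h2
        · exact h1
      have := Set.ncard_le_ncard this (Set.toFinite _)
      omega
  · have hlt : (F ∩ C).ncard < (E ∩ C).ncard := by
      refine Set.ncard_lt_ncard (Set.ssubset_iff_subset_ne.2
        ⟨Set.inter_subset_inter_left _ hFE, fun h => hne (by rw [h])⟩) (Set.toFinite _)
    obtain ⟨F₁, F', hF₁, hn, hFE₁, hFE', hC, hC', hsub, hcard⟩ :=
      hs.exists_step hL hconn hE (j := (F ∩ C).ncard + 1) (by omega) (by omega)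
    have hFF : F ⊆ F₁ := by
      rcases hL.subset_or_next_subset hF₁ hn hF with h | h
      · exact h
      · have := Set.ncard_le_ncard (Set.inter_subset_inter_left C h) (Set.toFinite _)
        omega
    have hle := Set.ncard_le_ncard (Set.inter_subset_inter_left C hFF) (Set.toFinite _)
    have hne1 : (F₁ ∩ C).Nonempty := by
      rw [← Set.ncard_pos (Set.toFinite _)]
      omega
    obtain ⟨hone, hb1⟩ := hs.step_le_one hL hconn hF₁ hn hFE₁ hC hne1
    have hadd := ncard_inter_add (C := C) F₁ F' hn.2.1.1
    rw [Set.inter_eq_left.2 hsub] at hadd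
    have hpos := Lin.diff_pos hn.2.1
    have heq : F ∩ C = F₁ ∩ C :=
      Set.eq_of_subset_of_ncard_le (Set.inter_subset_inter_left C hFF) (by omega) (Set.toFinite _)
    rw [heq]
    have hXX : B ∪ F₁ ∩ C ⊆ B ∪ F' ∩ C :=
      Set.union_subset_union_right _ (Set.inter_subset_inter_left _ hn.2.1.1)
    refine ⟨B ∪ (F' ∩ C), ⟨F', hn.1, hFE', by omega, rfl⟩, ⟨hXX, ?_⟩, ?_⟩
    · obtain ⟨x, hx⟩ := Set.nonempty_of_ssubset hn.2.1
      intro h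
      rcases h (Or.inr ⟨hx.1, hsub hx⟩) with h' | h'
      · exact Set.disjoint_left.1 hBC h' (hsub hx)
      · exact hx.2 h'.1
    · have e1 : border G (B ∪ F₁ ∩ C) ⊆ border G B ∪ (border G F₁ ∩ C) := by
        rintro v ⟨hv, u, hu, hadj⟩
        rw [Set.mem_union, not_or] at hu
        rcases hv with hv | hv
        · exact Or.inl ⟨hv, u, hu.1, hadj⟩
        · by_cases huC : u ∈ C
          · exact Or.inr ⟨⟨hv.1, u, fun h => hu.2 ⟨h, huC⟩, hadj⟩, hv.2⟩
          · exact absurd (hNB ⟨huC, v, hv.2, hadj⟩) hu.1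
      have e2 : (B ∪ F' ∩ C) \ (B ∪ F₁ ∩ C) ⊆ F' \ F₁ := by
        rintro x ⟨h1 | h1, h2⟩
        · exact absurd (Or.inl h1) h2
        · exact ⟨h1.1, fun h => h2 (Or.inr ⟨h, h1.2⟩)⟩
      have e3 := (Set.ncard_le_ncard e1 (Set.toFinite _)).trans (Set.ncard_union_le _ _)
      have e4 := Set.ncard_le_ncard e2 (Set.toFinite _)
      omega

end Slow

/-! ### Counting states after a set has been removed or added -/

section Compression

variable [Finite V]

/-- Represent each trace `F \ M` by the last state up to `T` that has it. Its next step changes the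
trace, so it is not pure, unless the state is `T`, which accounts for the `+ 1`. -/
theorem ncard_image_diff_le (hL : Lin G m 𝒜) (M : Set V) {T : Set V} (hT : T ∈ 𝒜) :
    {X | ∃ F ∈ 𝒜, F ⊆ T ∧ X = F \ M}.ncard ≤
      {F | F ∈ 𝒜 ∧ F ⊂ T ∧ ¬ PureStep 𝒜 M F}.ncard + 1 := by
  have h1 : {X | ∃ F ∈ 𝒜, F ⊆ T ∧ X = F \ M} ⊆
      (· \ M) '' insert T {F | F ∈ 𝒜 ∧ F ⊂ T ∧ ¬ PureStep 𝒜 M F} := by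
    rintro _ ⟨F, hF, hFT, rfl⟩
    obtain ⟨K, hK, ⟨h1, h2, h3⟩, hmax⟩ := hL.exists_greatest
      (p := fun K => F ⊆ K ∧ K ⊆ T ∧ K \ M = F \ M) ⟨F, hF, subset_rfl, hFT, rfl⟩
    refine ⟨K, ?_, h3⟩
    by_cases hKT : K = T
    · exact Or.inl hKT
    refine Or.inr ⟨hK, h2.ssubset_of_ne hKT, ?_⟩
    rintro ⟨K', hn, hsub⟩
    refine hn.2.1.2 (hmax K' hn.1 ⟨h1.trans hn.2.1.1, hn.2.2 T hT (h2.ssubset_of_ne hKT), ?_⟩)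
    rw [← h3]
    ext x
    constructor
    · rintro ⟨hx, hxM⟩
      refine ⟨?_, hxM⟩
      by_contra hxK
      exact hxM (hsub ⟨hx, hxK⟩)
    · rintro ⟨hx, hxM⟩
      exact ⟨hn.2.1.1 hx, hxM⟩
  exact (Set.ncard_le_ncard h1 (Set.toFinite _)).trans
    ((Set.ncard_image_le (Set.toFinite _)).trans (Set.ncard_insert_le _ _))

theorem ncard_image_union_le (hL : Lin G m 𝒜) (M T : Set V) :
    {X | ∃ F ∈ 𝒜, T ⊆ F ∧ X = F ∪ M}.ncard ≤
      {F | F ∈ 𝒜 ∧ T ⊆ F ∧ ¬ PureStep 𝒜 M F}.ncard := by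
  have h1 : {X | ∃ F ∈ 𝒜, T ⊆ F ∧ X = F ∪ M} ⊆
      (· ∪ M) '' {F | F ∈ 𝒜 ∧ T ⊆ F ∧ ¬ PureStep 𝒜 M F} := by
    rintro _ ⟨F, hF, hFT, rfl⟩
    obtain ⟨K, hK, ⟨h1, h3⟩, hmax⟩ := hL.exists_greatest
      (p := fun K => F ⊆ K ∧ K ∪ M = F ∪ M) ⟨F, hF, subset_rfl, rfl⟩
    refine ⟨K, ⟨hK, hFT.trans h1, ?_⟩, h3⟩
    rintro ⟨K', hn, hsub⟩
    refine hn.2.1.2 (hmax K' hn.1 ⟨h1.trans hn.2.1.1, ?_⟩)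
    rw [← h3]
    refine Set.Subset.antisymm (Set.union_subset (fun x hx => ?_) Set.subset_union_right)
      (Set.union_subset_union_left _ hn.2.1.1)
    by_cases hxK : x ∈ K
    · exact Or.inl hxK
    · exact Or.inr (hsub ⟨hx, hxK⟩)
  exact (Set.ncard_le_ncard h1 (Set.toFinite _)).trans (Set.ncard_image_le (Set.toFinite _))

end Compression

end Schedules

/-! ### The two rearrangements: deferral and gathering -/

section Rearrangement

variable {V : Type*} {G : SimpleGraph V} {m : ℕ} {𝒜 : Set (Set V)}

/-- States with an exceptionally small border. -/
def Low (G : SimpleGraph V) (m : ℕ) (F : Set V) : Prop := (border G F).ncard + 3 ≤ m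

/-- The states with an exceptionally small border in a schedule. -/
def lowSet (G : SimpleGraph V) (m : ℕ) (𝒜 : Set (Set V)) : Set (Set V) := {F | F ∈ 𝒜 ∧ Low G m F}

theorem border_diff_subset {F M : Set V} (h : ∀ x ∈ F, x ∈ nbhd G M → x ∈ border G F) :
    border G (F \ M) ⊆ border G F \ M := by
  rintro v ⟨hv, u, hu, hadj⟩
  refine ⟨?_, hv.2⟩
  by_cases huF : u ∈ F
  · have huM : u ∈ M := by
      by_contra h'
      exact hu ⟨huF, h'⟩
    exact h v hv.1 ⟨hv.2, u, huM, hadj.symm⟩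
  · exact ⟨hv.1, u, huF, hadj⟩

theorem border_union_subset {F M : Set V} (h : nbhd G M ⊆ F) :
    border G (F ∪ M) ⊆ border G F \ M := by
  rintro v ⟨hv, u, hu, hadj⟩
  rw [Set.mem_union, not_or] at hu
  have hvM : v ∉ M := fun hvM => hu.1 (h ⟨hu.2, v, hvM, hadj⟩)
  exact ⟨⟨hv.resolve_right hvM, u, hu.1, hadj⟩, hvM⟩

theorem nbhd_biUnion_subset {S : Set V} {ℳ : Finset (Set V)}
    (hℳ : ∀ C ∈ ℳ, C ∈ components G S) : nbhd G (⋃ C ∈ ℳ, C) ⊆ S := by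
  rintro x ⟨hx, a, ha, hadj⟩
  obtain ⟨C, hC, haC⟩ := Set.mem_iUnion₂.1 ha
  rcases comp_adj (hℳ C hC) haC hadj with h | h
  · exact absurd (Set.mem_iUnion₂.2 ⟨C, hC, h⟩) hx
  · exact h

variable [Finite V]

/-- From the last state with the same trace, the step of `𝒜` changes the trace, and neither the
border nor the set of new vertices grows by deleting `M`. -/
theorem Lin.diff_step (hL : Lin G m 𝒜) {T M : Set V} (hT : T ∈ 𝒜)
    (hb : ∀ F ∈ 𝒜, F ⊆ T → border G (F \ M) ⊆ border G F) {F : Set V} (hF : F ∈ 𝒜) (hFT : F ⊆ T) :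
    F \ M = T \ M ∨ ∃ F' ∈ 𝒜, F' ⊆ T ∧ F \ M ⊂ F' \ M ∧
      (border G (F \ M)).ncard + ((F' \ M) \ (F \ M)).ncard ≤ m := by
  obtain ⟨K, hK, ⟨h1, h2, h3⟩, hmax⟩ := hL.exists_greatest
    (p := fun K => F ⊆ K ∧ K ⊆ T ∧ K \ M = F \ M) ⟨F, hF, subset_rfl, hFT, rfl⟩
  rw [← h3]
  by_cases hKT : K = T
  · exact Or.inl (by rw [hKT])
  right
  have hKT' := h2.ssubset_of_ne hKT
  obtain ⟨K', hn⟩ := hL.exists_next hK fun h => hKT'.2 (h ▸ Set.subset_univ _)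
  have hK'T := hn.2.2 T hT hKT'
  refine ⟨K', hn.1, hK'T, Set.ssubset_iff_subset_ne.2
    ⟨Set.sdiff_subset_sdiff_left hn.2.1.1, fun h => ?_⟩, ?_⟩
  · exact hn.2.1.2 (hmax K' hn.1 ⟨h1.trans hn.2.1.1, hK'T, h ▸ h3⟩)
  · have e1 := Set.ncard_le_ncard (hb K hK h2) (Set.toFinite _)
    have e2 : (K' \ M) \ (K \ M) ⊆ K' \ K := fun x hx => ⟨hx.1.1, fun h => hx.2 ⟨h, hx.1.2⟩⟩
    have e3 := Set.ncard_le_ncard e2 (Set.toFinite _)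
    have := hL.next_bound hK hn
    omega

theorem Lin.union_step (hL : Lin G m 𝒜) {T M : Set V}
    (hb : ∀ F ∈ 𝒜, T ⊆ F → border G (F ∪ M) ⊆ border G F) {F : Set V} (hF : F ∈ 𝒜) (hFT : T ⊆ F)
    (hne : F ∪ M ≠ Set.univ) :
    ∃ F' ∈ 𝒜, T ⊆ F' ∧ F ∪ M ⊂ F' ∪ M ∧
      (border G (F ∪ M)).ncard + ((F' ∪ M) \ (F ∪ M)).ncard ≤ m := by
  obtain ⟨K, hK, ⟨h1, h3⟩, hmax⟩ := hL.exists_greatest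
    (p := fun K => F ⊆ K ∧ K ∪ M = F ∪ M) ⟨F, hF, subset_rfl, rfl⟩
  rw [← h3] at hne ⊢
  obtain ⟨K', hn⟩ := hL.exists_next hK fun h => hne (by rw [h, Set.univ_union])
  refine ⟨K', hn.1, (hFT.trans h1).trans hn.2.1.1, Set.ssubset_iff_subset_ne.2
    ⟨Set.union_subset_union_left _ hn.2.1.1, fun h => ?_⟩, ?_⟩
  · exact hn.2.1.2 (hmax K' hn.1 ⟨h1.trans hn.2.1.1, h ▸ h3⟩)
  · have e1 := Set.ncard_le_ncard (hb K hK (hFT.trans h1)) (Set.toFinite _)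
    have e2 : (K' ∪ M) \ (K ∪ M) ⊆ K' \ K := fun x hx =>
      ⟨hx.1.resolve_right fun h => hx.2 (Or.inr h), fun h => hx.2 (Or.inl h)⟩
    have e3 := Set.ncard_le_ncard e2 (Set.toFinite _)
    have := hL.next_bound hK hn
    omega

/-- If a component `C` is processed alone at some point, but was started when the border was not
small, then its start can be postponed until everything else has been finished. -/
theorem exists_deferral (hL : Lin G m 𝒜) (hm : m ≤ 4) {S C F₀ E : Set V} (hS : S.Nonempty)
    (hC : C ∈ components G S) (hF₀ : F₀ ∈ 𝒜) (hF₀C : Disjoint F₀ C)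
    (hmax : ∀ H ∈ 𝒜, Disjoint H C → H ⊆ F₀) (hlow : ¬ Low G m F₀) (hE : E ∈ 𝒜)
    (hSE : S ⊆ border G E) (hEC : (E ∩ C).Nonempty) (hCE : ¬ C ⊆ E)
    (hEb : (border G E \ C).ncard + 3 ≤ m)
    (hfirst : ∀ H ∈ 𝒜, H ⊂ E → (H ∩ C).Nonempty → ¬ (border G H \ C).ncard + 3 ≤ m) :
    ∃ 𝒜', Sched G m 𝒜' ∧ 𝒜'.ncard ≤ 𝒜.ncard ∧ (lowSet G m 𝒜).ncard < (lowSet G m 𝒜').ncard := by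
  have hconn := comp_conn hC
  have hSC : S ⊆ E \ C := fun x hx =>
    ⟨(hSE hx).1, fun h => Set.disjoint_left.1 (comp_disjoint hC) h hx⟩
  have hF₀E : F₀ ⊂ E := by
    refine hL.ssubset_of_not_subset hF₀ hE fun h => ?_
    obtain ⟨x, hx, hxC⟩ := hEC
    exact Set.disjoint_left.1 hF₀C (h hx) hxC
  -- Up to `E` the component is slow: at its start because `F₀` is not low, afterwards because `E`
  -- is the first exception.
  have hslow : SlowTo G m 𝒜 C E := by
    intro F F' hF hn hFE hCF hF'
    by_cases h0 : (F ∩ C).Nonempty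
    · have := hfirst F hF hFE h0
      omega
    · have hd : Disjoint F C := Set.disjoint_iff_inter_eq_empty.2 (Set.not_nonempty_iff_eq_empty.1 h0)
      have heq : F = F₀ := by
        rcases hL.subset_or_next_subset hF hn hF₀ with h | h
        · exact Set.Subset.antisymm (hmax F hF hd) h
        · obtain ⟨x, hx, hxC⟩ := hF'
          exact absurd hxC (Set.disjoint_left.1 hF₀C (h hx))
      have : border G F \ C = border G F :=
        sdiff_eq_left.2 (hd.mono_left (border_subset _))
      rw [this, heq]
      unfold Low at hlow
      omega
  have hEu : E ≠ Set.univ := fun h => hCE (h ▸ Set.subset_univ _)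
  have hbd : ∀ F ∈ 𝒜, F ⊆ E → border G (F \ C) ⊆ border G F \ C := fun F _ hFE =>
    border_diff_subset fun x hx hxC => border_anti hFE (hSE (by rwa [comp_nbhd hC] at hxC)) hx
  have hEB : (border G (E \ C)).ncard + 3 ≤ m := by
    have := Set.ncard_le_ncard (hbd E hE subset_rfl) (Set.toFinite _)
    omega
  have hEbpos : 0 < (border G E ∩ C).ncard := by
    rw [Set.ncard_pos (Set.toFinite _)]
    obtain ⟨x, hx, hxb⟩ := hconn.exists_border (by rwa [Set.inter_comm]) hCE
    exact ⟨x, hxb, hx⟩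
  have hEsplit := Set.ncard_inter_add_ncard_sdiff_eq_ncard (border G E) C (Set.toFinite _)
  obtain ⟨E', hE'⟩ := hL.exists_next hE hEu
  have hE'b := hL.next_bound hE hE'
  have hECE : (E \ C) ∪ (E ∩ C) = E := Set.sdiff_union_inter E C
  have hstep2 : ∀ X, X = E \ C ∨ X ∈ insertion 𝒜 C E (E \ C) → X ≠ E → 2 ≤ (E ∩ C).ncard →
      ∃ X' ∈ insertion 𝒜 C E (E \ C), X ⊂ X' ∧ (border G X).ncard + (X' \ X).ncard ≤ m :=
    fun X hX hXE h2 => insertion_step hL hslow hconn hE Set.disjoint_sdiff_left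
      (by rwa [comp_nbhd hC]) (by omega) h2 hX (by rwa [hECE])
  -- Up to `E` everything but `C` is processed, then `E ∩ C` is added in its old order, and from `E`
  -- on nothing changes.
  set 𝒜' : Set (Set V) := {X | ∃ F ∈ 𝒜, F ⊆ E ∧ X = F \ C} ∪ insertion 𝒜 C E (E \ C) ∪
    {F | F ∈ 𝒜 ∧ E ⊂ F} with h𝒜'
  refine ⟨𝒜', ⟨Or.inl (Or.inl ⟨∅, hL.empty_mem, Set.empty_subset _, by simp⟩), ?_⟩, ?_, ?_⟩
  · rintro X ((⟨F, hF, hFE, rfl⟩ | hX) | ⟨hX, hEX⟩) hXu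
    · rcases hL.diff_step hE (fun F hF h => (hbd F hF h).trans Set.sdiff_subset) hF hFE with h | h
      · rw [h]
        by_cases h2 : 2 ≤ (E ∩ C).ncard
        · have hne : E \ C ≠ E := by
            intro h'
            obtain ⟨x, hx, hxC⟩ := hEC
            rw [← h'] at hx
            exact hx.2 hxC
          obtain ⟨X', h1, h2⟩ := hstep2 _ (Or.inl rfl) hne h2
          exact ⟨X', Or.inl (Or.inr h1), h2⟩
        -- Here `E ∩ C` is a single vertex and has no insertion states; it joins the step to `E'`,
        -- taking the place of the border vertex of `E` in `C`.
        · refine ⟨E', Or.inr ⟨hE'.1, hE'.2.1⟩,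
            Set.ssubset_of_subset_of_ssubset Set.sdiff_subset hE'.2.1, ?_⟩
          have e1 := Set.ncard_le_ncard (hbd E hE subset_rfl) (Set.toFinite _)
          have e2 : E' \ (E \ C) ⊆ (E' \ E) ∪ (E ∩ C) := by
            rintro x ⟨hx, hx'⟩
            by_cases hxE : x ∈ E
            · right
              refine ⟨hxE, ?_⟩
              by_contra hxC
              exact hx' ⟨hxE, hxC⟩
            · exact Or.inl ⟨hx, hxE⟩
          have e3 := (Set.ncard_le_ncard e2 (Set.toFinite _)).trans (Set.ncard_union_le _ _)
          omega
      · obtain ⟨F', h1, h2, h3⟩ := h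
        exact ⟨F' \ C, Or.inl (Or.inl ⟨F', h1, h2, rfl⟩), h3⟩
    · by_cases hXE : X = E
      · subst hXE
        exact ⟨E', Or.inr ⟨hE'.1, hE'.2.1⟩, hE'.2.1, hE'b⟩
      · have h2 : 2 ≤ (E ∩ C).ncard := by
          obtain ⟨F, _, h1, h2, _⟩ := hX
          exact h2.trans (Set.ncard_le_ncard (Set.inter_subset_inter_left _ h1) (Set.toFinite _))
        obtain ⟨X', h1, h2⟩ := hstep2 _ (Or.inr hX) hXE h2
        exact ⟨X', Or.inl (Or.inr h1), h2⟩
    · obtain ⟨X', hn⟩ := hL.exists_next hX hXu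
      exact ⟨X', Or.inr ⟨hn.1, hEX.trans hn.2.1⟩, hn.2.1, hL.next_bound hX hn⟩
  · have e1 := ncard_image_diff_le hL C hE
    have e2 := (ncard_insertion_le hL (C := C) (E := E) (E \ C)).trans
      (hslow.le_ncard_pureSet hL hconn hE)
    have e3 : {F | F ∈ 𝒜 ∧ F ⊂ E ∧ ¬ PureStep 𝒜 C F}.ncard + (pureSet 𝒜 C E).ncard =
        {F | F ∈ 𝒜 ∧ F ⊂ E}.ncard := by
      rw [← Set.ncard_union_eq _ (Set.toFinite _) (Set.toFinite _)]
      · congr 1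
        ext F
        simp only [pureSet, Set.mem_union, Set.mem_ofPred_eq]
        tauto
      · rw [Set.disjoint_left]
        exact fun F h1 h2 => h1.2.2 h2.2.2
    have e4 : {F | F ∈ 𝒜 ∧ F ⊂ E}.ncard + 1 + {F | F ∈ 𝒜 ∧ E ⊂ F}.ncard ≤ 𝒜.ncard := by
      rw [← Set.ncard_insert_of_notMem (a := E) (fun h => h.2.2 subset_rfl) (Set.toFinite _),
        ← Set.ncard_union_eq _ (Set.toFinite _) (Set.toFinite _)]
      · refine Set.ncard_le_ncard ?_ (Set.toFinite _)
        rintro F ((rfl | h) | h)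
        exacts [hE, h.1, h.1]
      · rw [Set.disjoint_left]
        rintro F (rfl | h1) h2
        · exact h2.2.2 subset_rfl
        · exact h1.2.2 h2.2.1
    have e5 := (Set.ncard_union_le ({X | ∃ F ∈ 𝒜, F ⊆ E ∧ X = F \ C} ∪ insertion 𝒜 C E (E \ C))
      {F | F ∈ 𝒜 ∧ E ⊂ F}).trans (Nat.add_le_add_right (Set.ncard_union_le _ _) _)
    rw [← h𝒜'] at e5
    omega
  -- Old low states survive: those disjoint from `C` are unchanged, and the others come after `E`.
  -- The low state `E \ C` is new, since `F₀` is the only old state it could equal.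
  · refine Set.ncard_lt_ncard ⟨?_, fun h => ?_⟩ (Set.toFinite _)
    · rintro F ⟨hF, hFl⟩
      refine ⟨?_, hFl⟩
      by_cases h0 : Disjoint F C
      · exact Or.inl (Or.inl ⟨F, hF, (hmax F hF h0).trans hF₀E.1, (sdiff_eq_left.2 h0).symm⟩)
      · have hne := Set.not_disjoint_iff_nonempty_inter.1 h0
        refine Or.inr ⟨hF, ?_⟩
        -- The border of `E` has a vertex in `C` and one in `S`, whereas `m ≤ 4` allows a low state
        -- only one border vertex.
        have hFE : F ≠ E := by
          rintro rfl
          have : 0 < (border G F \ C).ncard := by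
            rw [Set.ncard_pos (Set.toFinite _)]
            obtain ⟨s, hs⟩ := hS
            exact ⟨s, hSE hs, (hSC hs).2⟩
          unfold Low at hFl
          omega
        rcases hL.total hF hE with h | h
        · refine absurd ?_ (hfirst F hF (h.ssubset_of_ne hFE) hne)
          have := Set.ncard_le_ncard (Set.sdiff_subset : border G F \ C ⊆ _) (Set.toFinite _)
          unfold Low at hFl
          omega
        · exact h.ssubset_of_ne hFE.symm
    · have h1 : E \ C ∈ lowSet G m 𝒜' := ⟨Or.inl (Or.inl ⟨E, hE, subset_rfl, rfl⟩), hEB⟩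
      obtain ⟨h2, h3⟩ := h h1
      have h4 := hmax _ h2 Set.disjoint_sdiff_left
      have h5 : F₀ ⊆ E \ C := fun x hx => ⟨hF₀E.1 hx, Set.disjoint_left.1 hF₀C hx⟩
      rw [Set.Subset.antisymm h4 h5] at h3
      exact hlow h3

theorem exists_insertions (hL : Lin G m 𝒜) {S : Set V} (ℳ : Finset (Set V))
    (hℳ : ∀ C ∈ ℳ, C ∈ branches G S ∧ SlowTo G m 𝒜 C Set.univ) {B : Set V}
    (hBd : ∀ C ∈ ℳ, Disjoint B C) (hSB : S ⊆ B) (hb : (border G B).ncard + 2 ≤ m) :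
    ∃ ℐ : Set (Set V), ℐ.ncard ≤ ∑ C ∈ ℳ, (C.ncard - 1) ∧
      (ℳ.Nonempty → B ∪ ⋃ C ∈ ℳ, C ∈ ℐ) ∧
      ∀ X, X = B ∨ X ∈ ℐ → X ≠ B ∪ ⋃ C ∈ ℳ, C →
        ∃ X' ∈ ℐ, X ⊂ X' ∧ (border G X).ncard + (X' \ X).ncard ≤ m := by
  classical
  induction ℳ using Finset.induction_on generalizing B with
  | empty =>
    refine ⟨∅, by simp, by simp, fun X hX hne => ?_⟩
    rcases hX with rfl | h
    · simp at hne
    · exact h.elim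
  | insert C ℳ hCℳ ih =>
    obtain ⟨hC, hslow⟩ := hℳ C (Finset.mem_insert_self _ _)
    have hNB : nbhd G C ⊆ B := by rwa [comp_nbhd hC.1]
    have hb1 : (border G (B ∪ C)).ncard + 2 ≤ m := by
      have := Set.ncard_le_ncard ((border_union_subset hNB).trans Set.sdiff_subset) (Set.toFinite _)
      omega
    obtain ⟨ℐ, h1, h2, h3⟩ := ih (fun D hD => hℳ D (Finset.mem_insert_of_mem hD)) (B := B ∪ C)
      (fun D hD => Set.disjoint_union_left.2 ⟨hBd D (Finset.mem_insert_of_mem hD), by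
        by_contra hn
        have := comp_eq_of_inter (hℳ D (Finset.mem_insert_of_mem hD)).1.1 hC.1
          (Set.not_disjoint_iff_nonempty_inter.1 hn)
        exact hCℳ (this ▸ hD)⟩) (hSB.trans Set.subset_union_left) hb1
    have hset : B ∪ ⋃ D ∈ insert C ℳ, D = B ∪ C ∪ ⋃ D ∈ ℳ, D := by
      rw [Finset.set_biUnion_insert, Set.union_assoc]
    rw [hset]
    refine ⟨insertion 𝒜 C Set.univ B ∪ ℐ, ?_, fun _ => ?_, fun X hX hne => ?_⟩
    · rw [Finset.sum_insert hCℳ]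
      have e1 := ncard_insertion_le hL (C := C) (E := Set.univ) B
      rw [Set.univ_inter] at e1
      have e2 := Set.ncard_union_le (insertion 𝒜 C Set.univ B) ℐ
      omega
    · rcases ℳ.eq_empty_or_nonempty with rfl | hne
      · left
        refine ⟨Set.univ, hL.univ_mem, subset_rfl, ?_, by simp⟩
        rw [Set.univ_inter]
        exact branch_two_le hC
      · exact Or.inr (h2 hne)
    · by_cases hXB : X = B ∪ C
      · obtain ⟨X', h4, h5⟩ := h3 X (Or.inl hXB) hne
        exact ⟨X', Or.inr h4, h5⟩
      · have hcase : (X = B ∨ X ∈ insertion 𝒜 C Set.univ B) ∨ X ∈ ℐ := by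
          rcases hX with h | h | h
          exacts [Or.inl (Or.inl h), Or.inl (Or.inr h), Or.inr h]
        rcases hcase with h | h
        · obtain ⟨X', h4, h5⟩ := insertion_step hL hslow (comp_conn hC.1) hL.univ_mem
            (hBd C (Finset.mem_insert_self _ _)) hNB hb
            (by rw [Set.univ_inter]; exact branch_two_le hC) h (by rwa [Set.univ_inter])
          exact ⟨X', Or.inl h4, h5⟩
        · obtain ⟨X', h4, h5⟩ := h3 X (Or.inr h) hne
          exact ⟨X', Or.inr h4, h5⟩

/-- A step adds at least one vertex, so it cannot be pure for two disjoint branches, and the counts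
for single branches add up. -/
theorem sum_le_ncard_pureSet (hL : Lin G m 𝒜) {S : Set V} (ℳ : Finset (Set V))
    (hℳ : ∀ C ∈ ℳ, C ∈ branches G S ∧ SlowTo G m 𝒜 C Set.univ) :
    ∑ C ∈ ℳ, (C.ncard - 1) ≤ (pureSet 𝒜 (⋃ C ∈ ℳ, C) Set.univ).ncard := by
  classical
  induction ℳ using Finset.induction_on with
  | empty => simp
  | insert C ℳ hCℳ ih =>
    obtain ⟨hC, hslow⟩ := hℳ C (Finset.mem_insert_self _ _)
    have h1 := ih fun D hD => hℳ D (Finset.mem_insert_of_mem hD)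
    have h2 := hslow.le_ncard_pureSet hL (comp_conn hC.1) hL.univ_mem
    rw [Set.univ_inter] at h2
    rw [Finset.sum_insert hCℳ, Finset.set_biUnion_insert]
    refine (Nat.add_le_add h2 h1).trans ?_
    rw [← Set.ncard_union_eq _ (Set.toFinite _) (Set.toFinite _)]
    · refine Set.ncard_le_ncard ?_ (Set.toFinite _)
      rintro F (⟨h3, h4, F', h5, h6⟩ | ⟨h3, h4, F', h5, h6⟩)
      · exact ⟨h3, h4, F', h5, h6.trans Set.subset_union_left⟩
      · exact ⟨h3, h4, F', h5, h6.trans Set.subset_union_right⟩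
    · rw [Set.disjoint_left]
      rintro F ⟨_, _, F', h5, h6⟩ ⟨_, _, F'', h5', h6'⟩
      obtain rfl := h5.unique h5'
      obtain ⟨x, hx⟩ := Set.nonempty_of_ssubset h5.2.1
      have hxC := h6 hx
      obtain ⟨D, hD, hxD⟩ := Set.mem_iUnion₂.1 (h6' hx)
      have := comp_eq_of_inter (hℳ D (Finset.mem_insert_of_mem hD)).1.1 hC.1 ⟨x, hxC, hxD⟩
      exact hCℳ (this ▸ hD)

/-- Slowly processed `S`-branches can be processed one after the other at a state `T` whose border
contains `S` and is not too large. -/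
theorem exists_gather (hL : Lin G m 𝒜) {S T : Set V} {ℳ : Finset (Set V)} (hne : ℳ.Nonempty)
    (hℳ : ∀ C ∈ ℳ, C ∈ branches G S ∧ SlowTo G m 𝒜 C Set.univ) (hT : T ∈ 𝒜)
    (hST : S ⊆ border G T) (hTb : (border G T).ncard + 2 ≤ m) :
    ∃ 𝒜', Sched G m 𝒜' ∧ 𝒜'.ncard ≤ 𝒜.ncard ∧
      (lowSet G m 𝒜).ncard ≤ (lowSet G m 𝒜').ncard ∧
      (∀ F ∈ 𝒜, F ⊆ T → F \ (⋃ C ∈ ℳ, C) ∈ 𝒜') ∧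
      (∀ F ∈ 𝒜, T ⊆ F → F ∪ (⋃ C ∈ ℳ, C) ∈ 𝒜') := by
  classical
  set M : Set V := ⋃ C ∈ ℳ, C with hM
  have hNM : nbhd G M ⊆ S := nbhd_biUnion_subset fun C hC => (hℳ C hC).1.1
  have hSM : Disjoint S M := by
    rw [Set.disjoint_left]
    intro x hx hxM
    obtain ⟨C, hC, hxC⟩ := Set.mem_iUnion₂.1 hxM
    exact Set.disjoint_left.1 (comp_disjoint (hℳ C hC).1.1) hxC hx
  have hd : ∀ F ∈ 𝒜, F ⊆ T → border G (F \ M) ⊆ border G F := fun F _ hFT =>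
    (border_diff_subset fun x hx hxM => border_anti hFT (hST (hNM hxM)) hx).trans Set.sdiff_subset
  have hu : ∀ F ∈ 𝒜, T ⊆ F → border G (F ∪ M) ⊆ border G F := fun F _ hFT =>
    (border_union_subset (hNM.trans ((hST.trans (border_subset _)).trans hFT))).trans
      Set.sdiff_subset
  have hTM : T \ M ∪ M = T ∪ M := Set.sdiff_union_self
  obtain ⟨ℐ, hℐ1, hℐ2, hℐ3⟩ := exists_insertions hL ℳ hℳ (B := T \ M)
    (fun C hC => Set.disjoint_sdiff_left.mono_right
      fun x hx => Set.mem_iUnion₂.2 ⟨C, hC, hx⟩)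
    (fun x hx => ⟨(hST hx).1, Set.disjoint_left.1 hSM hx⟩)
    (by
      have := Set.ncard_le_ncard (hd T hT subset_rfl) (Set.toFinite _)
      omega)
  rw [← hM, hTM] at hℐ2 hℐ3
  -- No vertex of a slow branch enters right after a low state. Hence low states already differ
  -- outside `M`, and the map below is injective on them.
  have hlow : ∀ F₁ ∈ 𝒜, ∀ F₂ ∈ 𝒜, Low G m F₁ → F₁ ⊂ F₂ → ¬ F₂ \ F₁ ⊆ M := by
    intro F₁ h1 F₂ h2 hl hlt hsub
    obtain ⟨F', hn⟩ := hL.exists_next h1 fun h => hlt.2 (h ▸ Set.subset_univ _)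
    obtain ⟨x, hx⟩ := Set.nonempty_of_ssubset hn.2.1
    obtain ⟨C, hC, hxC⟩ := Set.mem_iUnion₂.1 (hsub ⟨hn.2.2 F₂ h2 hlt hx.1, hx.2⟩)
    have h3 := (hℳ C hC).2 F₁ F' h1 hn (hlt.trans_subset (Set.subset_univ _))
      (fun h => hx.2 (h hxC)) ⟨x, hx.1, hxC⟩
    have h4 := Set.ncard_le_ncard (Set.sdiff_subset : border G F₁ \ C ⊆ _) (Set.toFinite _)
    unfold Low at hl
    omega
  set 𝒜' : Set (Set V) := {X | ∃ F ∈ 𝒜, F ⊆ T ∧ X = F \ M} ∪ ℐ ∪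
    {X | ∃ F ∈ 𝒜, T ⊆ F ∧ X = F ∪ M} with h𝒜'
  refine ⟨𝒜', ⟨Or.inl (Or.inl ⟨∅, hL.empty_mem, Set.empty_subset _, by simp⟩), ?_⟩, ?_, ?_,
    fun F hF hFT => Or.inl (Or.inl ⟨F, hF, hFT, rfl⟩), fun F hF hFT => Or.inr ⟨F, hF, hFT, rfl⟩⟩
  · have hU : ∀ F ∈ 𝒜, T ⊆ F → F ∪ M ≠ Set.univ → ∃ X' ∈ 𝒜', F ∪ M ⊂ X' ∧
        (border G (F ∪ M)).ncard + (X' \ (F ∪ M)).ncard ≤ m := by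
      intro F hF hFT hX
      obtain ⟨F', h1, h2, h3⟩ := hL.union_step hu hF hFT hX
      exact ⟨F' ∪ M, Or.inr ⟨F', h1, h2, rfl⟩, h3⟩
    have hI : ∀ X, X = T \ M ∨ X ∈ ℐ → X ≠ Set.univ → ∃ X' ∈ 𝒜', X ⊂ X' ∧
        (border G X).ncard + (X' \ X).ncard ≤ m := by
      intro X hX hXu
      by_cases hXT : X = T ∪ M
      · subst hXT
        exact hU T hT subset_rfl hXu
      · obtain ⟨X', h1, h2⟩ := hℐ3 X hX hXT
        exact ⟨X', Or.inl (Or.inr h1), h2⟩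
    rintro X ((⟨F, hF, hFT, rfl⟩ | hX) | ⟨F, hF, hFT, rfl⟩) hXu
    · rcases hL.diff_step hT hd hF hFT with h | ⟨F', h1, h2, h3⟩
      · exact hI _ (Or.inl h) hXu
      · exact ⟨F' \ M, Or.inl (Or.inl ⟨F', h1, h2, rfl⟩), h3⟩
    · exact hI X (Or.inr hX) hXu
    · exact hU F hF hFT hXu
  · have e1 := ncard_image_diff_le hL M hT
    have e2 := ncard_image_union_le hL M T
    have e3 := hℐ1.trans (sum_le_ncard_pureSet hL ℳ hℳ)
    rw [← hM] at e3
    have e4 : {F | F ∈ 𝒜 ∧ F ⊂ T ∧ ¬ PureStep 𝒜 M F}.ncard +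
        {F | F ∈ 𝒜 ∧ T ⊆ F ∧ ¬ PureStep 𝒜 M F}.ncard + (pureSet 𝒜 M Set.univ).ncard ≤
        𝒜.ncard := by
      rw [← Set.ncard_union_eq _ (Set.toFinite _) (Set.toFinite _),
        ← Set.ncard_union_eq _ (Set.toFinite _) (Set.toFinite _)]
      · refine Set.ncard_le_ncard ?_ (Set.toFinite _)
        rintro F ((h | h) | h)
        exacts [h.1, h.1, h.1]
      · rw [Set.disjoint_left]
        rintro F (h1 | h1) h2
        exacts [h1.2.2 h2.2.2, h1.2.2 h2.2.2]
      · rw [Set.disjoint_left]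
        exact fun F h1 h2 => h1.2.1.2 h2.2.1
    -- `T ∪ M` ends the insertions and begins the last family; counting it once cancels the `+ 1`
    -- from the states before `T`.
    have hTI : T ∪ M ∈ ℐ := hℐ2 hne
    have e5 : 𝒜' = {X | ∃ F ∈ 𝒜, F ⊆ T ∧ X = F \ M} ∪ ((ℐ \ {T ∪ M}) ∪
        {X | ∃ F ∈ 𝒜, T ⊆ F ∧ X = F ∪ M}) := by
      have hmem : T ∪ M ∈ {X | ∃ F ∈ 𝒜, T ⊆ F ∧ X = F ∪ M} := ⟨T, hT, subset_rfl, rfl⟩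
      rw [h𝒜', Set.union_assoc]
      congr 1
      ext X
      by_cases hX : X = T ∪ M
      · subst hX
        exact ⟨fun _ => Or.inr hmem, fun _ => Or.inr hmem⟩
      · simp [hX]
    have e6 := Set.ncard_sdiff_singleton_add_one hTI (Set.toFinite _)
    have e7 := (Set.ncard_union_le {X | ∃ F ∈ 𝒜, F ⊆ T ∧ X = F \ M} ((ℐ \ {T ∪ M}) ∪
        {X | ∃ F ∈ 𝒜, T ⊆ F ∧ X = F ∪ M})).trans
        (Nat.add_le_add_left (Set.ncard_union_le _ _) _)
    rw [← e5] at e7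
    omega
  · refine Set.ncard_le_ncard_of_injOn (fun F => if F ⊆ T then F \ M else F ∪ M) ?_ ?_
      (Set.toFinite _)
    · rintro F ⟨hF, hFl⟩
      have hmono : ∀ X, border G X ⊆ border G F → Low G m X := fun X hX => by
        have := Set.ncard_le_ncard hX (Set.toFinite _)
        unfold Low at hFl ⊢
        omega
      by_cases hFT : F ⊆ T
      · simp only [hFT, if_true]
        exact ⟨Or.inl (Or.inl ⟨F, hF, hFT, rfl⟩), hmono _ (hd F hF hFT)⟩
      · simp only [hFT, if_false]
        have hTF := (hL.total hT hF).resolve_right hFT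
        exact ⟨Or.inr ⟨F, hF, hTF, rfl⟩, hmono _ (hu F hF hTF)⟩
    · have main : ∀ F₁ ∈ lowSet G m 𝒜, ∀ F₂ ∈ lowSet G m 𝒜, F₁ ⊂ F₂ →
          (if F₁ ⊆ T then F₁ \ M else F₁ ∪ M) ≠ (if F₂ ⊆ T then F₂ \ M else F₂ ∪ M) := by
        rintro F₁ ⟨h1, hl1⟩ F₂ ⟨h2, _⟩ hlt heq
        refine hlow F₁ h1 F₂ h2 hl1 hlt fun x hx => ?_
        by_contra hxM
        have hx2 : x ∈ (if F₂ ⊆ T then F₂ \ M else F₂ ∪ M) := by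
          split_ifs
          exacts [⟨hx.1, hxM⟩, Or.inl hx.1]
        rw [← heq] at hx2
        split_ifs at hx2
        · exact hx.2 hx2.1
        · exact hx2.elim hx.2 hxM
      intro F₁ h1 F₂ h2 heq
      by_contra hne
      rcases hL.total h1.1 h2.1 with h | h
      · exact main F₁ h1 F₂ h2 (h.ssubset_of_ne hne) heq
      · exact main F₂ h2 F₁ h1 (h.ssubset_of_ne (Ne.symm hne)) heq.symm

end Rearrangement

/-! ### Consecutive processing, violations and optimal schedules -/

section Optimal

variable {V : Type*} {G : SimpleGraph V} {m : ℕ} {𝒜 : Set (Set V)}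

/-- In the schedule `𝒜`, all but at most twelve `S`-branches are processed consecutively, together
with nothing else but `S`-components. -/
def Star (G : SimpleGraph V) (𝒜 : Set (Set V)) (S : Set V) : Prop :=
  S.Nonempty ∧ ∃ T₁ ∈ 𝒜, ∃ T₂ ∈ 𝒜, ∃ 𝒟 ⊆ components G S, T₁ ⊆ T₂ ∧ T₂ \ T₁ = ⋃₀ 𝒟 ∧ S ⊆ T₁ ∧
    S ⊆ border G T₂ ∧ (branches G S).ncard ≤ (𝒟 ∩ branches G S).ncard + 12 ∧
    26 ≤ (branches G S).ncard

/-- At `F`, more than twelve `S`-branches are finished and more than twelve are not. -/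
def Viol (G : SimpleGraph V) (S F : Set V) : Prop :=
  13 ≤ {C | C ∈ branches G S ∧ C ⊆ F}.ncard ∧ 13 ≤ {C | C ∈ branches G S ∧ ¬ C ⊆ F}.ncard

theorem Reach.exists_sched {l : ℕ} (h : Reach G m l ∅ Set.univ) :
    ∃ 𝒜, Sched G m 𝒜 ∧ 𝒜.ncard ≤ l + 1 := by
  obtain ⟨a, ha0, hal, ha⟩ := h.exists_seq
  refine ⟨a '' Set.Iic l, ⟨⟨0, Nat.zero_le _, ha0⟩, ?_⟩, ?_⟩
  · rintro _ ⟨i, hi, rfl⟩ hu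
    -- The sequence may stall, so the step is taken from the last index with the same set.
    obtain ⟨j, ⟨hj1, hj2⟩, hj3⟩ : ∃ j, (i ≤ j ∧ j ≤ l ∧ a j = a i) ∧
        ∀ j', i ≤ j' → j' ≤ l → a j' = a i → j' ≤ j := by
      obtain ⟨j, hj⟩ := ((Set.finite_Iic l).subset (s := Set.Iic l)
        (t := {j | i ≤ j ∧ j ≤ l ∧ a j = a i}) fun j hj => hj.2.1).exists_maximal
        ⟨i, le_rfl, hi, rfl⟩
      exact ⟨j, hj.1, fun j' h1 h2 h3 => (le_total j' j).elim id fun h' => hj.2 ⟨h1, h2, h3⟩ h'⟩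
    have hjl : j < l := hj2.1.lt_of_ne fun h' => hu (by rw [← hj2.2, h', hal])
    obtain ⟨h1, h2⟩ := ha j hjl
    rw [hj2.2] at h1 h2
    refine ⟨a (j + 1), ⟨j + 1, hjl, rfl⟩, h1.ssubset_of_ne fun h' => ?_, h2⟩
    have := hj3 (j + 1) (by omega) hjl h'.symm
    omega
  · refine (Set.ncard_image_le (Set.toFinite _)).trans ?_
    rw [Set.ncard_eq_toFinset_card', Set.toFinset_Iic, Nat.card_Iic]

variable [Finite V]

/-- A slowly processed component does not contain a vertex of `S₁` together with two
`S₁`-branches that are processed after that vertex. -/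
theorem not_slow_of_two_branches (hL : Lin G m 𝒜) {S S₁ C T₁ : Set V} (hC : C ∈ components G S)
    (hs : SlowTo G m 𝒜 C Set.univ) {s : V} (hsC : s ∈ C) (hsS : s ∈ S₁) (hT₁ : T₁ ∈ 𝒜)
    (hsT : s ∈ T₁) {𝒟 : Set (Set V)} (h𝒟 : 𝒟 ⊆ branches G S₁) (h𝒟C : ∀ D ∈ 𝒟, D ⊆ C)
    (h𝒟T : ∀ D ∈ 𝒟, Disjoint D T₁) : 𝒟.ncard < 2 := by
  by_contra hcard
  obtain ⟨D₁, hD₁, D₂, hD₂, hne⟩ :=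
    (Set.one_lt_ncard (Set.toFinite 𝒟)).1 (by omega : 1 < 𝒟.ncard)
  obtain ⟨F, hF, hFd, hmax⟩ := hL.exists_greatest (p := fun F => ∀ D ∈ 𝒟, Disjoint D F)
    ⟨T₁, hT₁, h𝒟T⟩
  have hsF : s ∈ F := hmax T₁ hT₁ h𝒟T hsT
  have hnot : ∀ K, (∃ D ∈ 𝒟, ¬ D ⊆ K) → ¬ C ⊆ K := by
    rintro K ⟨D, hD, hDK⟩ h
    exact hDK ((h𝒟C D hD).trans h)
  have hCF : ¬ C ⊆ F := by
    refine hnot F ⟨D₁, hD₁, fun h => ?_⟩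
    obtain ⟨x, hx⟩ := (comp_conn (h𝒟 hD₁).1).1
    exact Set.disjoint_left.1 (hFd D₁ hD₁) hx (h hx)
  have hun : ∀ {K : Set V}, ¬ C ⊆ K → K ≠ Set.univ := fun h h' => h (h' ▸ Set.subset_univ _)
  have hun' : ∀ {K : Set V}, ¬ C ⊆ K → K ⊂ Set.univ := fun h =>
    (Set.subset_univ _).ssubset_of_ne (hun h)
  obtain ⟨F', hn⟩ := hL.exists_next hF (hun hCF)
  have h1 := (hs.step_le_one hL (comp_conn hC) hF hn (hun' hCF) hCF ⟨s, hsF, hsC⟩).1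
  have hD : ∃ D ∈ 𝒟, ¬ Disjoint D F' := by
    by_contra h
    push Not at h
    exact hn.2.1.2 (hmax F' hn.1 h)
  obtain ⟨D, hD, hDF'⟩ := hD
  obtain ⟨u, huD, huF'⟩ := Set.not_disjoint_iff.1 hDF'
  have huF : u ∉ F := Set.disjoint_left.1 (hFd D hD) huD
  have honly : ∀ v ∈ F', v ∉ F → v = u := fun v hv hvF =>
    (Set.ncard_le_one (Set.toFinite _)).1 h1 v ⟨hv, hvF⟩ u ⟨huF', huF⟩
  have hDn : ¬ D ⊆ F' := by
    intro h
    have : D ⊆ {u} := fun v hv => honly v (h hv) (Set.disjoint_left.1 (hFd D hD) hv)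
    have h2 := Set.ncard_le_ncard this (Set.toFinite _)
    rw [Set.ncard_singleton] at h2
    have := branch_two_le (h𝒟 hD)
    omega
  have hD' : ∃ D' ∈ 𝒟, D' ≠ D := by
    by_cases h : D₁ = D
    · exact ⟨D₂, hD₂, fun h' => hne (h.trans h'.symm)⟩
    · exact ⟨D₁, hD₁, h⟩
  obtain ⟨D', hD', hDD'⟩ := hD'
  have hCF' := hnot F' ⟨D, hD, hDn⟩
  obtain ⟨F'', hn'⟩ := hL.exists_next hn.1 (hun hCF')
  have hsF' := hn.2.1.1 hsF
  have h3 := (hs.step_le_one hL (comp_conn hC) hn.1 hn' (hun' hCF') hCF' ⟨s, hsF', hsC⟩).2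
  obtain ⟨w, hw, hsw⟩ := comp_exists_adj (h𝒟 hD').1 hsS
  have hwF' : w ∉ F' := by
    intro h
    have := honly w h (Set.disjoint_left.1 (hFd D' hD') hw)
    rw [this] at hw
    exact hDD' (comp_eq_of_inter (h𝒟 hD).1 (h𝒟 hD').1 ⟨u, hw, huD⟩)
  obtain ⟨x, hx, hxb⟩ := (comp_conn (h𝒟 hD).1).exists_border ⟨u, huD, huF'⟩ hDn
  -- Right after the first of the branches is begun, `C` holds two border vertices: `s`, which still
  -- has a neighbour in `D'`, and a vertex of the unfinished `D`. Slowness permits only one.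
  have hsx := (Set.ncard_le_one (Set.toFinite _)).1 h3 s ⟨⟨hsF', w, hwF', hsw⟩, hsC⟩ x
    ⟨hxb, h𝒟C D hD hx⟩
  exact Set.disjoint_left.1 (comp_disjoint (h𝒟 hD).1) hx (hsx ▸ hsS)

/-- Gathering `S`-branches keeps the other consecutively processed groups of branches together. -/
theorem Star.gather (hL : Lin G m 𝒜) (hm : m ≤ 4) {S T Q : Set V}
    {ℳ : Finset (Set V)} (hℳ : ∀ C ∈ ℳ, C ∈ branches G S ∧ SlowTo G m 𝒜 C Set.univ)
    (hT : T ∈ 𝒜) (hST : S ⊆ border G T) (hTb : (border G T).ncard + 2 ≤ m)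
    (hQ : Q ∈ 𝒜) (hSQ : S ⊆ border G Q) (hMQ : (⋃ C ∈ ℳ, C) ⊆ Q)
    (hcase : (border G T = S ∧ S.ncard ≤ 1) ∨
      ∃ C₀ ∈ ℳ, Disjoint T C₀ ∧ ∃ T', IsNext 𝒜 T T' ∧ (T' ∩ C₀).Nonempty)
    {𝒜' : Set (Set V)} (h₁ : ∀ F ∈ 𝒜, F ⊆ T → F \ (⋃ C ∈ ℳ, C) ∈ 𝒜')
    (h₂ : ∀ F ∈ 𝒜, T ⊆ F → F ∪ (⋃ C ∈ ℳ, C) ∈ 𝒜') {S₁ : Set V} (hne : S₁ ≠ S)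
    (hstar : Star G 𝒜 S₁) : Star G 𝒜' S₁ := by
  obtain ⟨hS₁, T₁, hT₁, T₂, hT₂, 𝒟, h𝒟, hTT, hY, hS₁T, hS₁b, hcard, hN⟩ := hstar
  set M : Set V := ⋃ C ∈ ℳ, C with hM
  have hCM : ∀ C ∈ ℳ, C ⊆ M := fun C hC x hx => Set.mem_iUnion₂.2 ⟨C, hC, hx⟩
  have hDT : ∀ D ∈ 𝒟, D ⊆ T₂ \ T₁ := fun D hD => hY ▸ Set.subset_sUnion_of_mem hD
  have hDT₁ : ∀ D ∈ 𝒟, Disjoint D T₁ := fun D hD =>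
    Set.disjoint_sdiff_left.mono_left (hDT D hD)
  -- no gathered component meets `S₁`
  have hdis : Disjoint S₁ M := by
    rw [Set.disjoint_left]
    intro s hs hsM
    obtain ⟨C, hC, hsC⟩ := Set.mem_iUnion₂.1 hsM
    have hCS := (hℳ C hC).1.1
    have hsS : s ∉ S := Set.disjoint_left.1 (comp_disjoint hCS) hsC
    -- `𝒟` has at least `26 - 12 = 14` branches of `S₁`. Those disjoint from `S` hang on `s` and lie
    -- in `C`, so there is at most one; at most `|S| ≤ 2` others meet `S`.
    have hsmall := not_slow_of_two_branches hL hCS (hℳ C hC).2 hsC hs hT₁ (hS₁T hs)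
      (𝒟 := {D | D ∈ 𝒟 ∩ branches G S₁ ∧ Disjoint D S}) (fun D hD => hD.1.2)
      (fun D hD => by
        have hins := (comp_conn (h𝒟 hD.1.1)).insert (a := s) (by rwa [comp_nbhd (h𝒟 hD.1.1)])
        exact (Set.subset_insert _ _).trans (comp_subset_of_inter hCS hins
          (Set.disjoint_insert_left.2 ⟨hsS, hD.2⟩) ⟨s, Set.mem_insert _ _, hsC⟩))
      (fun D hD => hDT₁ D hD.1.1)
    have hmeet : {D | D ∈ 𝒟 ∩ branches G S₁ ∧ ¬ Disjoint D S}.ncard ≤ S.ncard :=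
      ncard_le_of_meets (branch_pairwiseDisjoint _ fun D hD => h𝒟 hD.1.1)
        fun D hD => Set.not_disjoint_iff_nonempty_inter.1 hD.2
    have hS2 := Set.ncard_le_ncard hST (Set.toFinite _)
    have hsplit : (𝒟 ∩ branches G S₁).ncard ≤
        {D | D ∈ 𝒟 ∩ branches G S₁ ∧ Disjoint D S}.ncard +
        {D | D ∈ 𝒟 ∩ branches G S₁ ∧ ¬ Disjoint D S}.ncard := by
      refine (Set.ncard_le_ncard (fun D hD => ?_) (Set.toFinite _)).trans (Set.ncard_union_le _ _)
      by_cases h : Disjoint D S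
      · exact Or.inl ⟨hD, h⟩
      · exact Or.inr ⟨hD, h⟩
    omega
  have hCS₁ : ∀ C ∈ ℳ, Disjoint C S₁ := fun C hC => (hdis.mono_right (hCM C hC)).symm
  have hfinish : Disjoint (T₂ \ T₁) M → Star G 𝒜' S₁ := by
    intro hYM
    -- If `T` were strictly inside the interval, then either `S₁` would lie in the border `S` of
    -- size at most 1 and equal it, or the step from `T` would put a vertex of `C₀` into `T₂ \ T₁`.
    have hout : T ⊆ T₁ ∨ T₂ ⊆ T := by
      by_contra hno
      push Not at hno
      have hlt₁ := hL.ssubset_of_not_subset hT₁ hT hno.1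
      have hlt₂ := hL.ssubset_of_not_subset hT hT₂ hno.2
      rcases hcase with ⟨hb, hS1⟩ | ⟨C₀, hC₀, hTC₀, T', hn, x, hx, hxC⟩
      · have hsub : S₁ ⊆ S := fun x hx => hb ▸ border_anti hlt₂.1 (hS₁b hx) (hlt₁.1 (hS₁T hx))
        have := (Set.ncard_pos (Set.toFinite S₁)).2 hS₁
        exact hne (Set.eq_of_subset_of_ncard_le hsub (by omega) (Set.toFinite _))
      · refine Set.disjoint_left.1 hYM ⟨hn.2.2 T₂ hT₂ hlt₂ hx, fun h => ?_⟩ (hCM C₀ hC₀ hxC)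
        exact Set.disjoint_left.1 hTC₀ (hlt₁.1 h) hxC
    rcases hout with h | h
    · refine ⟨hS₁, T₁ ∪ M, h₂ T₁ hT₁ h, T₂ ∪ M, h₂ T₂ hT₂ (h.trans hTT), 𝒟, h𝒟,
        Set.union_subset_union_left _ hTT, ?_, hS₁T.trans Set.subset_union_left, ?_, hcard, hN⟩
      · rw [← hY]
        ext x
        constructor
        · rintro ⟨hx | hx, hx'⟩
          · exact ⟨hx, fun h => hx' (Or.inl h)⟩
          · exact absurd (Or.inr hx) hx'
        · rintro ⟨hx, hx'⟩
          exact ⟨Or.inl hx, fun h => h.elim hx' (Set.disjoint_left.1 hYM ⟨hx, hx'⟩)⟩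
      · intro s hs
        obtain ⟨hsT, w, hw, hsw⟩ := hS₁b hs
        by_cases hwM : w ∈ M
        · obtain ⟨C, hC, hwC⟩ := Set.mem_iUnion₂.1 hwM
          have hsS : s ∈ S := by
            rcases comp_adj (hℳ C hC).1.1 hwC hsw.symm with h' | h'
            · exact absurd (hCM C hC h') (Set.disjoint_left.1 hdis hs)
            · exact h'
          obtain ⟨_, z, hz, hsz⟩ := hSQ hsS
          refine ⟨Or.inl hsT, z, ?_, hsz⟩
          rintro (h' | h')
          · rcases hL.total hT₂ hQ with h'' | h''
            · exact hz (h'' h')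
            · exact hw (h'' (hMQ hwM))
          · exact hz (hMQ h')
        · exact ⟨Or.inl hsT, w, fun h => h.elim hw hwM, hsw⟩
    · refine ⟨hS₁, T₁ \ M, h₁ T₁ hT₁ (hTT.trans h), T₂ \ M, h₁ T₂ hT₂ h, 𝒟, h𝒟,
        Set.sdiff_subset_sdiff_left hTT, ?_, fun x hx => ⟨hS₁T hx, Set.disjoint_left.1 hdis hx⟩,
        fun x hx => border_anti Set.sdiff_subset (hS₁b hx)
          ⟨(hS₁b hx).1, Set.disjoint_left.1 hdis hx⟩, hcard, hN⟩
      rw [← hY]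
      ext x
      constructor
      · rintro ⟨⟨hx, hxM⟩, hx'⟩
        exact ⟨hx, fun h => hx' ⟨h, hxM⟩⟩
      · rintro ⟨hx, hx'⟩
        exact ⟨⟨hx, Set.disjoint_left.1 hYM ⟨hx, hx'⟩⟩, fun h => hx' h.1⟩
  by_cases hYM : Disjoint (T₂ \ T₁) M
  · exact hfinish hYM
  obtain ⟨x, hxY, hxM⟩ := Set.not_disjoint_iff.1 hYM
  rw [hY] at hxY
  obtain ⟨D, hD, hxD⟩ := hxY
  obtain ⟨C, hC, hxC⟩ := Set.mem_iUnion₂.1 hxM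
  -- If `S ⊆ S₁`, then `C` and `D` coincide, which forces `S = S₁`. Otherwise `D` contains some `b ∈
  -- S \ S₁` and through it all of `M`, so that `T` lies between `T₁` and `T₂` and the gathering
  -- takes place inside the interval.
  by_cases hSS : S ⊆ S₁
  · have hCD := comp_subset_of_inter (h𝒟 hD) (comp_conn (hℳ C hC).1.1) (hCS₁ C hC) ⟨x, hxC, hxD⟩
    have hDC := comp_subset_of_inter (hℳ C hC).1.1 (comp_conn (h𝒟 hD))
      ((comp_disjoint (h𝒟 hD)).mono_right hSS) ⟨x, hxD, hxC⟩
    have heq := Set.Subset.antisymm hCD hDC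
    exact absurd ((comp_nbhd (h𝒟 hD)).symm.trans (heq ▸ comp_nbhd (hℳ C hC).1.1)) hne
  · obtain ⟨b, hbS, hbS₁⟩ := Set.not_subset.1 hSS
    have hins : ∀ C' ∈ ℳ, (insert b C' ∩ D).Nonempty → insert b C' ⊆ D := fun C' hC' h =>
      comp_subset_of_inter (h𝒟 hD) ((comp_conn (hℳ C' hC').1.1).insert
        (by rwa [comp_nbhd (hℳ C' hC').1.1])) (Set.disjoint_insert_left.2 ⟨hbS₁, hCS₁ C' hC'⟩) h
    have hbD : b ∈ D := hins C hC ⟨x, Or.inr hxC, hxD⟩ (Set.mem_insert _ _)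
    have hMD : M ⊆ D := Set.iUnion₂_subset fun C' hC' =>
      (Set.subset_insert _ _).trans (hins C' hC' ⟨b, Set.mem_insert _ _, hbD⟩)
    have hMT := hMD.trans (hDT D hD)
    have hT₁T : T₁ ⊆ T := (hL.total hT₁ hT).resolve_right fun h =>
      (hDT D hD hbD).2 (h (hST hbS).1)
    have hTT₂ : T ⊆ T₂ := by
      refine (hL.total hT hT₂).resolve_right fun h => ?_
      obtain ⟨_, w, hw, hbw⟩ := hST hbS
      rcases comp_adj (h𝒟 hD) hbD hbw with h' | h'
      · exact hw (h (hDT D hD h').1)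
      · exact hw (h (hTT (hS₁T h')))
    have e1 : T₁ \ M = T₁ := sdiff_eq_left.2 (Set.disjoint_right.2 fun x hx => (hMT hx).2)
    have e2 : T₂ ∪ M = T₂ := Set.union_eq_left.2 fun x hx => (hMT hx).1
    exact ⟨hS₁, T₁, e1 ▸ h₁ T₁ hT₁ hT₁T, T₂, e2 ▸ h₂ T₂ hT₂ hTT₂, 𝒟, h𝒟, hTT, hY, hS₁T, hS₁b,
      hcard, hN⟩

theorem ncard_branches_meeting_le (hL : Lin G m 𝒜) (hm : m ≤ 4) {S F F' : Set V} (hF : F ∈ 𝒜)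
    (hn : IsNext 𝒜 F F') :
    {C | C ∈ branches G S ∧ (C ∩ (border G F ∪ F' \ F)).Nonempty}.ncard ≤ 4 := by
  have h1 : {C | C ∈ branches G S ∧ (C ∩ (border G F ∪ F' \ F)).Nonempty}.ncard ≤
      (border G F ∪ F' \ F).ncard :=
    ncard_le_of_meets (branch_pairwiseDisjoint _ fun C hC => hC.1.1) fun C hC => hC.2
  have h2 := Set.ncard_union_le (border G F) (F' \ F)
  have h3 := hL.next_bound hF hn
  omega

/-- Every branch has a neighbour of `s`. If `s` is missing, each finished branch has a border
vertex; if `s` is inside but not on the border, each unfinished one does. Thirteen disjoint branches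
are too many for a border of at most three vertices. -/
theorem Viol.subset_border (hL : Lin G m 𝒜) (hm : m ≤ 4) {S F : Set V} (hF : F ∈ 𝒜)
    (h : Viol G S F) : S ⊆ border G F := by
  intro s hs
  have hu : F ≠ Set.univ := by
    rintro rfl
    have : {C | C ∈ branches G S ∧ ¬ C ⊆ Set.univ} = ∅ := by
      ext C
      simp
    have h2 := h.2
    rw [this, Set.ncard_empty] at h2
    omega
  have hb := hL.border_lt hF hu
  have hsF : s ∈ F := by
    by_contra hsF
    have : {C | C ∈ branches G S ∧ C ⊆ F}.ncard ≤ (border G F).ncard :=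
      ncard_le_of_meets (branch_pairwiseDisjoint _ fun C hC => hC.1.1) fun C hC => by
        obtain ⟨x, hx, hsx⟩ := comp_exists_adj hC.1.1 hs
        exact ⟨x, hx, hC.2 hx, s, hsF, hsx.symm⟩
    have := h.1
    omega
  by_contra hsb
  have : {C | C ∈ branches G S ∧ ¬ C ⊆ F}.ncard ≤ (border G F).ncard :=
    ncard_le_of_meets (branch_pairwiseDisjoint _ fun C hC => hC.1.1) fun C hC => by
      obtain ⟨x, hx, hsx⟩ := comp_exists_adj hC.1.1 hs
      have hxF : x ∈ F := by
        by_contra hxF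
        exact hsb ⟨hsF, x, hxF, hsx⟩
      obtain ⟨y, hy, hyb⟩ := (comp_conn hC.1.1).exists_border ⟨x, hx, hxF⟩ hC.2
      exact ⟨y, hy, hyb⟩
  have := h.2
  omega

/-- The properties of an optimal schedule that are used below. -/
structure Optimal (G : SimpleGraph V) (m : ℕ) (𝒜 : Set (Set V)) : Prop extends Lin G m 𝒜 where
  low : ∀ ℬ, Sched G m ℬ → ℬ.ncard ≤ 𝒜.ncard → (lowSet G m ℬ).ncard ≤ (lowSet G m 𝒜).ncard
  star : ∀ ℬ, Sched G m ℬ → ℬ.ncard ≤ 𝒜.ncard → (lowSet G m 𝒜).ncard ≤ (lowSet G m ℬ).ncard →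
    {S | Star G ℬ S}.ncard ≤ {S | Star G 𝒜 S}.ncard

theorem exists_chain_from (h : Sched G m 𝒜) {F : Set V} (hF : F ∈ 𝒜) :
    ∃ 𝒞 ⊆ 𝒜, F ∈ 𝒞 ∧ IsChain (· ⊆ ·) 𝒞 ∧ (∀ H ∈ 𝒞, F ⊆ H) ∧ ∀ H ∈ 𝒞, H ≠ Set.univ →
      ∃ H' ∈ 𝒞, H ⊂ H' ∧ (border G H).ncard + (H' \ H).ncard ≤ m := by
  induction hk : (Fᶜ).ncard using Nat.strong_induction_on generalizing F with
  | _ k ih =>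
    by_cases hu : F = Set.univ
    · refine ⟨{F}, Set.singleton_subset_iff.2 hF, rfl, Set.subsingleton_singleton.isChain, ?_, ?_⟩
      · rintro H rfl
        exact subset_rfl
      · rintro H rfl h'
        exact absurd hu h'
    · obtain ⟨F', hF', hlt, hb⟩ := h.step F hF hu
      obtain ⟨𝒞, h1, h2, h3, h4, h5⟩ := ih (F'ᶜ).ncard
        (hk ▸ Set.ncard_lt_ncard (compl_lt_compl_iff_lt.2 hlt) (Set.toFinite _)) hF' rfl
      refine ⟨insert F 𝒞, Set.insert_subset hF h1, Or.inl rfl,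
        h3.insert fun H hH _ => Or.inl (hlt.1.trans (h4 H hH)), ?_, ?_⟩
      · rintro H (rfl | hH)
        · exact subset_rfl
        · exact hlt.1.trans (h4 H hH)
      · rintro H (rfl | hH) hHu
        · exact ⟨F', Or.inr h2, hlt, hb⟩
        · obtain ⟨H', h6, h7⟩ := h5 H hH hHu
          exact ⟨H', Or.inr h6, h7⟩

/-- A lexicographic choice among finitely many families. A schedule need not be a chain, which
spares the rearranged families that check; one of minimal size is a chain because it contains a
chain that is a schedule. -/
theorem exists_optimal (h : ∃ 𝒜, Sched G m 𝒜) :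
    ∃ 𝒜, Optimal G m 𝒜 ∧ ∀ ℬ, Sched G m ℬ → 𝒜.ncard ≤ ℬ.ncard := by
  obtain ⟨𝒜₁, h1, hmin⟩ := Set.exists_min_image {𝒜 | Sched G m 𝒜} Set.ncard (Set.toFinite _) h
  obtain ⟨𝒜₂, h2, hlow⟩ := Set.exists_max_image {𝒜 | Sched G m 𝒜 ∧ 𝒜.ncard ≤ 𝒜₁.ncard}
    (fun 𝒜 => (lowSet G m 𝒜).ncard) (Set.toFinite _) ⟨𝒜₁, h1, le_rfl⟩
  obtain ⟨𝒜₃, h3, hstar⟩ := Set.exists_max_image {𝒜 | Sched G m 𝒜 ∧ 𝒜.ncard ≤ 𝒜₁.ncard ∧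
    (lowSet G m 𝒜₂).ncard ≤ (lowSet G m 𝒜).ncard}
    (fun 𝒜 => {S | Star G 𝒜 S}.ncard) (Set.toFinite _) ⟨𝒜₂, h2.1, h2.2, le_rfl⟩
  have hmin₃ : ∀ ℬ, Sched G m ℬ → 𝒜₃.ncard ≤ ℬ.ncard := fun ℬ hℬ => h3.2.1.trans (hmin ℬ hℬ)
  refine ⟨𝒜₃, ⟨⟨h3.1, ?_⟩, fun ℬ hℬ hc => ?_, fun ℬ hℬ hc hl => ?_⟩, hmin₃⟩
  · obtain ⟨𝒞, hsub, h0, hch, _, hst⟩ := exists_chain_from h3.1 h3.1.empty_mem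
    have := Set.eq_of_subset_of_ncard_le hsub (hmin₃ 𝒞 ⟨h0, hst⟩) (Set.toFinite _)
    exact this ▸ hch
  · exact (hlow ℬ ⟨hℬ, hc.trans h3.2.1⟩).trans h3.2.2
  · exact hstar ℬ ⟨hℬ, hc.trans h3.2.1, h3.2.2.trans hl⟩

end Optimal

/-! ### In an optimal schedule every violation yields consecutive processing -/

section ViolStar

variable {V : Type*} [Finite V] {G : SimpleGraph V} {m : ℕ} {𝒜 : Set (Set V)}

/-- In an optimal schedule, a component that is started when the border is not small is processed
slowly. -/
theorem Optimal.slow_of_not_low (hO : Optimal G m 𝒜) (hm : m ≤ 4) {S C p q F₀ : Set V}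
    (hS : S.Nonempty) (hC : C ∈ components G S) (hp : p ∈ 𝒜) (hSp : S ⊆ p) (hpC : Disjoint p C)
    (hq : q ∈ 𝒜) (hSq : S ⊆ border G q) (hCq : C ⊆ q) (hF₀ : F₀ ∈ 𝒜) (hF₀C : Disjoint F₀ C)
    (hmax : ∀ H ∈ 𝒜, Disjoint H C → H ⊆ F₀) (hlow : ¬ Low G m F₀) :
    SlowTo G m 𝒜 C Set.univ := by
  have hL := hO.toLin
  intro F F' hF hn _ hCF hF'
  by_contra hlt
  have hFC : (F ∩ C).Nonempty := by
    rw [← Set.not_disjoint_iff_nonempty_inter]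
    intro hd
    have heq : F = F₀ := by
      rcases hL.subset_or_next_subset hF hn hF₀ with h | h
      · exact Set.Subset.antisymm (hmax F hF hd) h
      · obtain ⟨x, hx, hxC⟩ := hF'
        exact absurd hxC (Set.disjoint_left.1 hF₀C (h hx))
    have h1 : border G F \ C = border G F := sdiff_eq_left.2 (hd.mono_left (border_subset _))
    rw [h1, heq] at hlt
    unfold Low at hlow
    omega
  obtain ⟨E, hE, ⟨hEC, hEb⟩, hEmin⟩ := hL.exists_least
    (p := fun E => (E ∩ C).Nonempty ∧ (border G E \ C).ncard + 3 ≤ m) ⟨F, hF, hFC, by omega⟩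
  have hCE : ¬ C ⊆ E := fun h => hCF (h.trans (hEmin F hF ⟨hFC, by omega⟩))
  have hpE : p ⊆ E := by
    refine (hL.total hp hE).resolve_right fun h => ?_
    obtain ⟨x, hx, hxC⟩ := hEC
    exact Set.disjoint_left.1 hpC (h hx) hxC
  have hEq : E ⊆ q := (hL.total hE hq).resolve_right fun h => hCE (hCq.trans h)
  obtain ⟨ℬ, h1, h2, h3⟩ := exists_deferral hL hm hS hC hF₀ hF₀C hmax hlow hE
    (fun x hx => border_anti hEq (hSq hx) (hpE (hSp hx))) hEC hCE hEb
    (fun H hH hHE hHC hHb => hHE.2 (hEmin H hH ⟨hHC, hHb⟩))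
  have := hO.low ℬ h1 h2
  omega

/-- In an optimal schedule, no rearrangement by gathering can produce a new consecutively processed
group of branches. -/
theorem Optimal.star_of_gather (hO : Optimal G m 𝒜) (hm : m ≤ 4) {S T T₂ q : Set V}
    (hS : S.Nonempty) {ℳ : Finset (Set V)}
    (hℳ : ∀ C ∈ ℳ, C ∈ branches G S ∧ SlowTo G m 𝒜 C Set.univ)
    (hT : T ∈ 𝒜) (hT₂ : T₂ ∈ 𝒜) (hTT : T ⊆ T₂) (hq : q ∈ 𝒜) (hT₂q : T₂ ⊆ q)
    (hST : S ⊆ T) (hSq : S ⊆ border G q) (hTb : (border G T).ncard + 2 ≤ m)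
    (hℳq : ∀ C ∈ ℳ, C ⊆ q)
    (hcase : (border G T = S ∧ S.ncard ≤ 1) ∨
      ∃ C₀ ∈ ℳ, Disjoint T C₀ ∧ ∃ T', IsNext 𝒜 T T' ∧ (T' ∩ C₀).Nonempty)
    {𝒟 : Set (Set V)} (h𝒟 : 𝒟 ⊆ components G S) (hY : T₂ \ T = ⋃₀ 𝒟)
    (hcard : (branches G S).ncard ≤ ((𝒟 ∪ ℳ) ∩ branches G S).ncard + 12)
    (hN : 26 ≤ (branches G S).ncard) : Star G 𝒜 S := by
  have hL := hO.toLin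
  by_contra hno
  have hbT : S ⊆ border G T := fun x hx => border_anti (hTT.trans hT₂q) (hSq hx) (hST hx)
  rcases ℳ.eq_empty_or_nonempty with rfl | hne
  · rw [Finset.coe_empty, Set.union_empty] at hcard
    exact hno ⟨hS, T, hT, T₂, hT₂, 𝒟, h𝒟, hTT, hY, hST,
      fun x hx => border_anti hT₂q (hSq hx) (hTT (hST hx)), hcard, hN⟩
  obtain ⟨ℬ, h1, h2, h3, h4, h5⟩ := exists_gather hL hne hℳ hT hbT hTb
  set M : Set V := ⋃ C ∈ ℳ, C with hM
  have hMq : M ⊆ q := Set.iUnion₂_subset hℳq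
  have hSM : Disjoint S M := by
    rw [Set.disjoint_left]
    intro x hx hxM
    obtain ⟨C, hC, hxC⟩ := Set.mem_iUnion₂.1 hxM
    exact Set.disjoint_left.1 (comp_disjoint (hℳ C hC).1.1) hxC hx
  have hnew : Star G ℬ S := by
    refine ⟨hS, T \ M, h4 T hT subset_rfl, T₂ ∪ M, h5 T₂ hT₂ hTT, 𝒟 ∪ ℳ,
      Set.union_subset h𝒟 fun C hC => (hℳ C hC).1.1,
      Set.sdiff_subset.trans (hTT.trans Set.subset_union_left), ?_,
      fun x hx => ⟨hST hx, Set.disjoint_left.1 hSM hx⟩,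
      fun x hx => border_anti (Set.union_subset hT₂q hMq) (hSq hx) (Or.inl (hTT (hST hx))),
      hcard, hN⟩
    have hMU : ⋃₀ (ℳ : Set (Set V)) = M := by
      rw [Set.sUnion_eq_biUnion]
      rfl
    rw [Set.sUnion_union, ← hY, hMU]
    ext x
    constructor
    · rintro ⟨hx, hx'⟩
      by_cases hxM : x ∈ M
      · exact Or.inr hxM
      · exact Or.inl ⟨hx.resolve_right hxM, fun h => hx' ⟨h, hxM⟩⟩
    · rintro (⟨hx, hx'⟩ | hx)
      · exact ⟨Or.inl hx, fun h => hx' h.1⟩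
      · exact ⟨Or.inr hx, fun h => h.2 hx⟩
  have hlt : {S | Star G 𝒜 S}.ncard < {S | Star G ℬ S}.ncard := by
    refine Set.ncard_lt_ncard ⟨fun S₁ hS₁ => ?_, fun h => hno (h hnew)⟩ (Set.toFinite _)
    have hS₁S : S₁ ≠ S := by
      rintro rfl
      exact hno hS₁
    exact Star.gather hL hm hℳ hT hbT hTb hq hSq hMq hcase h4 h5 hS₁S hS₁
  have := hO.star ℬ h1 h2 h3
  omega

/-- All but eight branches are processed while `S` lies in the border, between `p` and `q`. Without
low states there, all of these are slow and are gathered at the start of one of them. With low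
states, `S` is a single vertex and the first and last low states bound a stretch that contains only
`S`-components; the slow branches are gathered at its beginning. -/
theorem Optimal.star_of_viol (hG : G.Preconnected) (hO : Optimal G m 𝒜) (hm : m ≤ 4) {S F : Set V}
    (hS : S.Nonempty) (hF : F ∈ 𝒜) (hv : Viol G S F) : Star G 𝒜 S := by
  classical
  have hL := hO.toLin
  have hN : 26 ≤ (branches G S).ncard := by
    have hsplit : {C | C ∈ branches G S ∧ C ⊆ F} ∪ {C | C ∈ branches G S ∧ ¬ C ⊆ F} =
        branches G S := by
      ext C
      simp only [Set.mem_union, Set.mem_ofPred_eq]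
      tauto
    rw [← hsplit, Set.ncard_union_eq _ (Set.toFinite _) (Set.toFinite _)]
    · have := hv.1
      have := hv.2
      omega
    · rw [Set.disjoint_left]
      exact fun C h1 h2 => h2.2 h1.2
  have hSF := hv.subset_border hL hm hF
  obtain ⟨p, hp, hSp, hpmin⟩ := hL.exists_least (p := fun H => S ⊆ H)
    ⟨F, hF, hSF.trans (border_subset _)⟩
  obtain ⟨q, hq, hSq, hqmax⟩ := hL.exists_greatest (p := fun H => S ⊆ border G H) ⟨F, hF, hSF⟩
  have hun : ∀ {H : Set V}, S ⊆ border G H → H ≠ Set.univ := by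
    rintro H h rfl
    rw [border_univ] at h
    exact hS.ne_empty (Set.subset_empty_iff.1 h)
  -- the branches that have been started at `p`
  have hE₁ : {C | C ∈ branches G S ∧ ¬ Disjoint p C}.ncard ≤ 4 := by
    obtain ⟨P, hP, hPp, hPmax⟩ := hL.exists_greatest (p := fun H => H ⊂ p)
      ⟨∅, hL.empty_mem, Set.empty_ssubset.2 (hS.mono hSp)⟩
    have hn : IsNext 𝒜 P p := ⟨hp, hPp, fun H hH hPH => by
      by_contra hc
      exact hPH.2 (hPmax H hH (hL.ssubset_of_not_subset hH hp hc))⟩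
    -- As `s` is missing at `P`, even a branch finished at `P` has a border vertex, namely a
    -- neighbour of `s`. So every branch begun at `p` meets the bag of the step to `p`.
    obtain ⟨s, hs, hsP⟩ := Set.not_subset.1 fun h => hPp.2 (hpmin P hP h)
    refine (Set.ncard_le_ncard ?_ (Set.toFinite _)).trans
      (ncard_branches_meeting_le hL hm (S := S) hP hn)
    rintro C ⟨hC, hpC⟩
    refine ⟨hC, ?_⟩
    obtain ⟨x, hxp, hxC⟩ := Set.not_disjoint_iff.1 hpC
    by_cases hxP : x ∈ P
    · by_cases hCP : C ⊆ P
      · obtain ⟨y, hy, hsy⟩ := comp_exists_adj hC.1 hs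
        exact ⟨y, hy, Or.inl ⟨hCP hy, s, hsP, hsy.symm⟩⟩
      · obtain ⟨y, hy, hyb⟩ := (comp_conn hC.1).exists_border ⟨x, hxC, hxP⟩ hCP
        exact ⟨y, hy, Or.inl hyb⟩
    · exact ⟨x, hxC, Or.inr ⟨hxp, hxP⟩⟩
  -- the branches that have not been finished at `q`
  have hE₂ : {C | C ∈ branches G S ∧ ¬ C ⊆ q}.ncard ≤ 4 := by
    obtain ⟨q', hn⟩ := hL.exists_next hq (hun hSq)
    refine (Set.ncard_le_ncard ?_ (Set.toFinite _)).trans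
      (ncard_branches_meeting_le hL hm (S := S) hq hn)
    rintro C ⟨hC, hCq⟩
    refine ⟨hC, ?_⟩
    by_cases hd : (C ∩ q).Nonempty
    · obtain ⟨y, hy, hyb⟩ := (comp_conn hC.1).exists_border hd hCq
      exact ⟨y, hy, Or.inl hyb⟩
    -- A branch untouched by this bag would keep all of `S` in the border of `q'`, against the
    -- choice of `q`.
    · by_contra hno
      refine hn.2.1.2 (hqmax q' hn.1 fun s hs => ?_)
      obtain ⟨y, hy, hsy⟩ := comp_exists_adj hC.1 hs
      refine ⟨hn.2.1.1 (hSq hs).1, y, fun hyq' => hno ⟨y, hy, Or.inr ⟨hyq', fun hyq => ?_⟩⟩, hsy⟩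
      exact hd ⟨y, hy, hyq⟩
  have hstart : ∀ C ∈ branches G S, Disjoint p C → C ⊆ q → ∃ F₀ ∈ 𝒜, Disjoint F₀ C ∧
      (∀ H ∈ 𝒜, Disjoint H C → H ⊆ F₀) ∧ p ⊆ F₀ ∧ F₀ ⊆ q := by
    intro C hC hpC hCq
    obtain ⟨F₀, h1, h2, h3⟩ := hL.exists_greatest (p := fun H => Disjoint H C) ⟨p, hp, hpC⟩
    refine ⟨F₀, h1, h2, h3, h3 p hp hpC, (hL.total h1 hq).resolve_right fun h => ?_⟩
    obtain ⟨x, hx⟩ := (comp_conn hC.1).1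
    exact Set.disjoint_left.1 h2 (h (hCq hx)) hx
  set ℳ : Finset (Set V) := (Set.toFinite {C | C ∈ branches G S ∧ Disjoint p C ∧ C ⊆ q ∧
    SlowTo G m 𝒜 C Set.univ}).toFinset with hℳdef
  have hmem : ∀ C, C ∈ ℳ ↔ C ∈ branches G S ∧ Disjoint p C ∧ C ⊆ q ∧
      SlowTo G m 𝒜 C Set.univ := fun C => by
    rw [hℳdef, Set.Finite.mem_toFinset]
    rfl
  have hℳ : ∀ C ∈ ℳ, C ∈ branches G S ∧ SlowTo G m 𝒜 C Set.univ := fun C hC =>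
    ⟨((hmem C).1 hC).1, ((hmem C).1 hC).2.2.2⟩
  have hℳq : ∀ C ∈ ℳ, C ⊆ q := fun C hC => ((hmem C).1 hC).2.2.1
  by_cases hlow : ∃ H ∈ 𝒜, Low G m H ∧ p ⊆ H ∧ H ⊆ q
  · obtain ⟨T₁, hT₁, ⟨hT₁l, hpT₁, hT₁q⟩, hT₁min⟩ := hL.exists_least hlow
    obtain ⟨T₂, hT₂, ⟨hT₂l, hpT₂, hT₂q⟩, hT₂max⟩ := hL.exists_greatest hlow
    have hTT : T₁ ⊆ T₂ := hT₁min T₂ hT₂ ⟨hT₂l, hpT₂, hT₂q⟩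
    have hSone : 0 < S.ncard := (Set.ncard_pos (Set.toFinite _)).2 hS
    have hborder : ∀ H, Low G m H → p ⊆ H → H ⊆ q → border G H = S := by
      intro H hl hpH hHq
      unfold Low at hl
      exact (Set.eq_of_subset_of_ncard_le (fun x hx => border_anti hHq (hSq hx) (hpH (hSp hx)))
        (by omega) (Set.toFinite _)).symm
    have hb₁ := hborder T₁ hT₁l hpT₁ hT₁q
    have hb₂ := hborder T₂ hT₂l hpT₂ hT₂q
    have hS1 : S.ncard ≤ 1 := by
      unfold Low at hT₁l
      rw [hb₁] at hT₁l
      omega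
    -- a set that avoids `S` is processed completely before or after a state with border `S`
    have hwhole : ∀ K H, Conn G K → Disjoint K S → border G H = S → (K ∩ H).Nonempty → K ⊆ H := by
      intro K H hK hKS hH hne
      by_contra hn
      obtain ⟨y, hy, hyb⟩ := hK.exists_border hne hn
      exact Set.disjoint_left.1 hKS hy (hH ▸ hyb)
    have hT₁two : (border G T₁).ncard + 2 ≤ m := by
      unfold Low at hT₁l
      omega
    refine hO.star_of_gather hm hS hℳ hT₁ hT₂ hTT hq hT₂q (hSp.trans hpT₁) hSq hT₁two hℳq
      (Or.inl ⟨hb₁, hS1⟩) (𝒟 := {D | D ∈ components G S ∧ D ⊆ T₂ ∧ Disjoint D T₁})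
      (fun D hD => hD.1) ?_ ?_ hN
    · refine Set.Subset.antisymm ?_ ?_
      · rintro x ⟨hx₂, hx₁⟩
        have hxS : x ∉ S := fun h => hx₁ (hpT₁ (hSp h))
        obtain ⟨c, hxc, hcS, hcn⟩ := exists_supp (G := G) hxS
        have hK := conn_supp c
        set K : Set V := Subtype.val '' c.supp with hKdef
        have hKu : K ≠ Set.univ := by
          intro h
          rw [h] at hcS
          obtain ⟨s, hs⟩ := hS
          exact Set.disjoint_left.1 hcS trivial hs
        have hKn := nbhd_nonempty hG ⟨x, hxc⟩ hKu
        -- Since `G` is connected and `|S| ≤ 1`, every component of `G - S` is an `S`-component.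
        have hKS : nbhd G K = S := Set.eq_of_subset_of_ncard_le hcn (by
          have := (Set.ncard_pos (Set.toFinite _)).2 hKn
          omega) (Set.toFinite _)
        refine ⟨K, ⟨mem_components_iff.2 ⟨hK, hKS⟩, hwhole K T₂ hK hcS hb₂ ⟨x, hxc, hx₂⟩, ?_⟩, hxc⟩
        by_contra hd
        exact hx₁ (hwhole K T₁ hK hcS hb₁ (Set.not_disjoint_iff_nonempty_inter.1 hd) hxc)
      · rintro x ⟨D, ⟨_, h1, h2⟩, hxD⟩
        exact ⟨h1 hxD, Set.disjoint_left.1 h2 hxD⟩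
    -- The twelve exceptions are at most four branches begun at `p`, four unfinished at `q`, and
    -- four begun in the step after `T₂`. Every other branch is slow, or is started at a low state
    -- and finished at `T₂`.
    · obtain ⟨T', hn⟩ := hL.exists_next hT₂ (hun hb₂.ge)
      have hE₃ := ncard_branches_meeting_le hL hm (S := S) hT₂ hn
      have hsub : branches G S ⊆ (({D | D ∈ components G S ∧ D ⊆ T₂ ∧ Disjoint D T₁} ∪ ℳ) ∩
          branches G S) ∪ ({C | C ∈ branches G S ∧ ¬ Disjoint p C} ∪
          ({C | C ∈ branches G S ∧ ¬ C ⊆ q} ∪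
          {C | C ∈ branches G S ∧ (C ∩ (border G T₂ ∪ T' \ T₂)).Nonempty})) := by
        intro C hC
        by_cases hpC : Disjoint p C
        swap
        · exact Or.inr (Or.inl ⟨hC, hpC⟩)
        by_cases hCq : C ⊆ q
        swap
        · exact Or.inr (Or.inr (Or.inl ⟨hC, hCq⟩))
        by_cases hs : SlowTo G m 𝒜 C Set.univ
        · exact Or.inl ⟨Or.inr ((hmem C).2 ⟨hC, hpC, hCq, hs⟩), hC⟩
        obtain ⟨F₀, hF₀, hF₀C, hmax, hpF₀, hF₀q⟩ := hstart C hC hpC hCq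
        have hF₀l : Low G m F₀ := by
          by_contra hl
          exact hs (hO.slow_of_not_low hm hS hC.1 hp hSp hpC hq hSq hCq hF₀ hF₀C hmax hl)
        have hTF := hT₁min F₀ hF₀ ⟨hF₀l, hpF₀, hF₀q⟩
        have hFT := hT₂max F₀ hF₀ ⟨hF₀l, hpF₀, hF₀q⟩
        by_cases hCT : (C ∩ T₂).Nonempty
        · exact Or.inl ⟨Or.inl ⟨hC.1,
            hwhole C T₂ (comp_conn hC.1) (comp_disjoint hC.1) hb₂ hCT,
            (hF₀C.mono_left hTF).symm⟩, hC⟩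
        · have hCT' : ¬ Disjoint T' C := fun hd => hn.2.1.2 ((hmax T' hn.1 hd).trans hFT)
          obtain ⟨x, hxT, hxC⟩ := Set.not_disjoint_iff.1 hCT'
          exact Or.inr (Or.inr (Or.inr ⟨hC, x, hxC, Or.inr ⟨hxT, fun h => hCT ⟨x, hxC, h⟩⟩⟩))
      have e1 := (Set.ncard_le_ncard hsub (Set.toFinite _)).trans (Set.ncard_union_le _ _)
      have e2 := Set.ncard_union_le {C | C ∈ branches G S ∧ ¬ Disjoint p C}
        ({C | C ∈ branches G S ∧ ¬ C ⊆ q} ∪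
          {C | C ∈ branches G S ∧ (C ∩ (border G T₂ ∪ T' \ T₂)).Nonempty})
      have e3 := Set.ncard_union_le {C | C ∈ branches G S ∧ ¬ C ⊆ q}
        {C | C ∈ branches G S ∧ (C ∩ (border G T₂ ∪ T' \ T₂)).Nonempty}
      omega
  · have hslow : ∀ C ∈ branches G S, Disjoint p C → C ⊆ q → SlowTo G m 𝒜 C Set.univ := by
      intro C hC hpC hCq
      obtain ⟨F₀, hF₀, hF₀C, hmax, hpF₀, hF₀q⟩ := hstart C hC hpC hCq
      exact hO.slow_of_not_low hm hS hC.1 hp hSp hpC hq hSq hCq hF₀ hF₀C hmax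
        fun hl => hlow ⟨F₀, hF₀, hl, hpF₀, hF₀q⟩
    have hcard : (branches G S).ncard ≤ ((ℳ : Set (Set V)) ∩ branches G S).ncard + 8 := by
      have hsub : branches G S ⊆ ((ℳ : Set (Set V)) ∩ branches G S) ∪
          ({C | C ∈ branches G S ∧ ¬ Disjoint p C} ∪ {C | C ∈ branches G S ∧ ¬ C ⊆ q}) := by
        intro C hC
        by_cases hpC : Disjoint p C
        swap
        · exact Or.inr (Or.inl ⟨hC, hpC⟩)
        by_cases hCq : C ⊆ q
        swap
        · exact Or.inr (Or.inr ⟨hC, hCq⟩)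
        exact Or.inl ⟨(hmem C).2 ⟨hC, hpC, hCq, hslow C hC hpC hCq⟩, hC⟩
      have e1 := (Set.ncard_le_ncard hsub (Set.toFinite _)).trans (Set.ncard_union_le _ _)
      have e2 := Set.ncard_union_le {C | C ∈ branches G S ∧ ¬ Disjoint p C}
        {C | C ∈ branches G S ∧ ¬ C ⊆ q}
      omega
    have hne : ((ℳ : Set (Set V)) ∩ branches G S).Nonempty := by
      rw [← Set.ncard_pos (Set.toFinite _)]
      omega
    obtain ⟨C₀, hC₀ℳ, hC₀⟩ := hne
    obtain ⟨_, hpC₀, hC₀q, _⟩ := (hmem C₀).1 hC₀ℳ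
    obtain ⟨T, hT, hTC₀, hmax, hpT, hTq⟩ := hstart C₀ hC₀ hpC₀ hC₀q
    have hTu : T ≠ Set.univ := hun fun x hx => border_anti hTq (hSq hx) (hpT (hSp hx))
    obtain ⟨T', hn⟩ := hL.exists_next hT hTu
    have hT'C₀ : (T' ∩ C₀).Nonempty := by
      rw [← Set.not_disjoint_iff_nonempty_inter]
      exact fun hd => hn.2.1.2 (hmax T' hn.1 hd)
    -- Otherwise a single vertex `u` of `C₀` enters after `T`. Border vertices of `T` adjacent to
    -- `u` lie in `S` and stay in the border, as do the others, and a vertex of `C₀` is added; the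
    -- border of `T'` would fill a whole bag.
    have hTb : (border G T).ncard + 2 ≤ m := by
      by_contra hlt
      have h1 := hL.next_bound hT hn
      have hone : (T' \ T).ncard ≤ 1 := by omega
      obtain ⟨u, huT', huC⟩ := hT'C₀
      have huT : u ∉ T := fun h => Set.disjoint_left.1 hTC₀ h huC
      have honly : ∀ v ∈ T', v ∉ T → v = u := fun v hv hvT =>
        (Set.ncard_le_one (Set.toFinite _)).1 hone v ⟨hv, hvT⟩ u ⟨huT', huT⟩
      have hCT' : ¬ C₀ ⊆ T' := by
        intro h
        have : C₀ ⊆ {u} := fun v hv => honly v (h hv) (Set.disjoint_right.1 hTC₀ hv)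
        have h2 := Set.ncard_le_ncard this (Set.toFinite _)
        rw [Set.ncard_singleton] at h2
        have := branch_two_le hC₀
        omega
      have hT'q : T' ⊆ q := (hL.total hn.1 hq).resolve_right fun h => hCT' (hC₀q.trans h)
      have hbT' : border G T ⊆ border G T' := by
        rintro x ⟨hx, w, hw, hxw⟩
        by_cases hwT' : w ∈ T'
        · have hwu := honly w hwT' hw
          rcases comp_adj hC₀.1 (hwu ▸ huC) hxw.symm with h | h
          · exact absurd h (Set.disjoint_left.1 hTC₀ hx)
          · exact border_anti hT'q (hSq h) (hn.2.1.1 hx)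
        · exact ⟨hn.2.1.1 hx, w, hwT', hxw⟩
      obtain ⟨y, hy, hyb⟩ := (comp_conn hC₀.1).exists_border ⟨u, huC, huT'⟩ hCT'
      have hlt' : (border G T).ncard < (border G T').ncard := by
        refine Set.ncard_lt_ncard ⟨hbT', fun h => ?_⟩ (Set.toFinite _)
        exact Set.disjoint_left.1 hTC₀ (h hyb).1 hy
      have := hL.border_lt hn.1 fun h => hCT' (h ▸ Set.subset_univ _)
      omega
    refine hO.star_of_gather hm hS hℳ hT hT subset_rfl hq hTq (hSp.trans hpT) hSq hTb hℳq
      (Or.inr ⟨C₀, hC₀ℳ, hTC₀, T', hn, hT'C₀⟩) (𝒟 := ∅) (Set.empty_subset _) (by simp) ?_ hN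
    rw [Set.empty_union]
    omega

end ViolStar

/-! ### Invariance under automorphisms -/

section Transport

variable {V : Type*} {G : SimpleGraph V} {m : ℕ} {𝒜 : Set (Set V)} (σ : G ≃g G)

theorem border_image (A : Set V) : border G (σ '' A) = σ '' border G A := by
  ext x
  obtain ⟨v, rfl⟩ := σ.surjective x
  simp only [border, Set.mem_ofPred_eq, σ.injective.mem_set_image]
  refine and_congr_right fun _ => ⟨?_, ?_⟩
  · rintro ⟨u, hu, hadj⟩
    obtain ⟨u, rfl⟩ := σ.surjective u
    exact ⟨u, fun h => hu ⟨u, h, rfl⟩, σ.map_adj_iff.1 hadj⟩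
  · rintro ⟨u, hu, hadj⟩
    exact ⟨σ u, fun h => hu ((σ.injective.mem_set_image).1 h), σ.map_adj_iff.2 hadj⟩

theorem nbhd_image (A : Set V) : nbhd G (σ '' A) = σ '' nbhd G A := by
  ext x
  obtain ⟨v, rfl⟩ := σ.surjective x
  simp only [nbhd, Set.mem_ofPred_eq, σ.injective.mem_set_image]
  refine and_congr_right fun _ => ⟨?_, ?_⟩
  · rintro ⟨_, ⟨u, hu, rfl⟩, hadj⟩
    exact ⟨u, hu, σ.map_adj_iff.1 hadj⟩
  · rintro ⟨u, hu, hadj⟩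
    exact ⟨σ u, ⟨u, hu, rfl⟩, σ.map_adj_iff.2 hadj⟩

theorem Conn.image {H : Set V} (hH : Conn G H) : Conn G (σ '' H) := by
  refine ⟨hH.1.image _, fun A h1 h2 => ?_⟩
  obtain ⟨_, ⟨x, hx, rfl⟩, hxA⟩ := h1
  obtain ⟨u, ⟨hu, huA⟩, w, ⟨hw, hwA⟩, hadj⟩ := hH.2 (σ ⁻¹' A) ⟨x, hx, hxA⟩
    fun h => h2 (Set.image_subset_iff.2 h)
  exact ⟨σ u, ⟨⟨u, hu, rfl⟩, huA⟩, σ w, ⟨⟨w, hw, rfl⟩, hwA⟩, σ.map_adj_iff.2 hadj⟩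

theorem image_mem_components {S H : Set V} (h : H ∈ components G S) :
    σ '' H ∈ components G (σ '' S) :=
  mem_components_iff.2 ⟨(comp_conn h).image σ, by rw [nbhd_image, comp_nbhd h]⟩

theorem symm_image_image (A : Set V) : σ.symm '' (σ '' A) = A := by
  rw [Set.image_image]
  simp

theorem image_symm_image (A : Set V) : σ '' (σ.symm '' A) = A := symm_image_image σ.symm A

theorem image_mem_branches {S H : Set V} (h : H ∈ branches G S) :
    σ '' H ∈ branches G (σ '' S) := by
  refine ⟨image_mem_components σ h.1, ?_⟩
  rintro ⟨v, hv⟩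
  refine h.2 ⟨σ.symm v, ?_⟩
  rw [← symm_image_image σ H, hv, Set.image_singleton]

theorem branches_image (S : Set V) : branches G (σ '' S) = Set.image σ '' branches G S := by
  refine Set.Subset.antisymm (fun H hH => ⟨σ.symm '' H, ?_, image_symm_image σ H⟩) ?_
  · have := image_mem_branches σ.symm hH
    rwa [symm_image_image] at this
  · rintro _ ⟨H, hH, rfl⟩
    exact image_mem_branches σ hH

theorem Viol.image [Finite V] {S F : Set V} (h : Viol G S F) : Viol G (σ '' S) (σ '' F) := by
  have hinj : Function.Injective (Set.image σ) := Set.image_injective.2 σ.injective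
  constructor
  · refine h.1.trans (Set.ncard_le_ncard_of_injOn (Set.image σ) ?_ hinj.injOn (Set.toFinite _))
    exact fun C hC => ⟨image_mem_branches σ hC.1, Set.image_mono hC.2⟩
  · refine h.2.trans (Set.ncard_le_ncard_of_injOn (Set.image σ) ?_ hinj.injOn (Set.toFinite _))
    exact fun C hC => ⟨image_mem_branches σ hC.1,
      fun h' => hC.2 ((Set.image_subset_image_iff σ.injective).1 h')⟩

theorem Star.image {S : Set V} (h : Star G 𝒜 S) : Star G (Set.image σ '' 𝒜) (σ '' S) := by
  have hinj : Function.Injective (Set.image σ) := Set.image_injective.2 σ.injective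
  obtain ⟨hS, T₁, hT₁, T₂, hT₂, 𝒟, h𝒟, hTT, hY, hST, hSb, hcard, hN⟩ := h
  refine ⟨hS.image _, σ '' T₁, ⟨T₁, hT₁, rfl⟩, σ '' T₂, ⟨T₂, hT₂, rfl⟩, Set.image σ '' 𝒟, ?_,
    Set.image_mono hTT, ?_, Set.image_mono hST, ?_, ?_, ?_⟩
  · rintro _ ⟨D, hD, rfl⟩
    exact image_mem_components σ (h𝒟 hD)
  · rw [← Set.image_sdiff σ.injective, hY, Set.image_sUnion]
  · rw [border_image]
    exact Set.image_mono hSb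
  · rwa [branches_image, ← Set.image_inter hinj, Set.ncard_image_of_injective _ hinj,
      Set.ncard_image_of_injective _ hinj]
  · rwa [branches_image, Set.ncard_image_of_injective _ hinj]

theorem Lin.image (h : Lin G m 𝒜) : Lin G m (Set.image σ '' 𝒜) := by
  refine ⟨⟨⟨∅, h.empty_mem, Set.image_empty _⟩, ?_⟩, ?_⟩
  · rintro _ ⟨F, hF, rfl⟩ hu
    obtain ⟨F', hF', hlt, hb⟩ := h.step F hF fun h' => hu (by
      rw [h', Set.image_univ, σ.surjective.range_eq])
    refine ⟨σ '' F', ⟨F', hF', rfl⟩, ⟨Set.image_mono hlt.1,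
      fun h' => hlt.2 ((Set.image_subset_image_iff σ.injective).1 h')⟩, ?_⟩
    rwa [border_image, ← Set.image_sdiff σ.injective, Set.ncard_image_of_injective _ σ.injective,
      Set.ncard_image_of_injective _ σ.injective]
  · rintro _ ⟨A, hA, rfl⟩ _ ⟨B, hB, rfl⟩ _
    exact (h.total hA hB).imp (fun h => Set.image_mono h) fun h => Set.image_mono h

end Transport

/-! ### Putting the leaves in order -/

section Leaves

variable {V : Type*} [Finite V] {G : SimpleGraph V} {m : ℕ} {𝒜 : Set (Set V)}

/-- The `S`-leaves in `F` form an initial segment of the enumeration, for every `S`. -/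
def LeafInit (e : LeafEnum G) (F : Set V) : Prop :=
  ∀ (S : Set V) (i j : Fin (leaves G S).ncard), i ≤ j → (e S j : V) ∈ F → (e S i : V) ∈ F

/-- Each vertex is a leaf of exactly one set, its neighbourhood, so the permutations combine to one
map; it permutes twins and hence preserves adjacency. -/
theorem exists_leaf_automorphism (p : ∀ S : Set V, Equiv.Perm (leaves G S)) :
    ∃ σ : G ≃g G, ∀ S (x : leaves G S), σ x = (p S x : V) := by
  set f : V → V := fun v => p (G.neighborSet v) ⟨v, mem_leaves_iff.2 rfl⟩ with hf
  have hfp : ∀ S (x : leaves G S), f x = (p S x : V) := by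
    rintro S ⟨v, hv⟩
    obtain rfl := mem_leaves_iff.1 hv
    rfl
  have hnb : ∀ v, G.neighborSet (f v) = G.neighborSet v := fun v =>
    mem_leaves_iff.1 (p (G.neighborSet v) ⟨v, mem_leaves_iff.2 rfl⟩).2
  have hinj : Function.Injective f := by
    intro v w hvw
    have hN : G.neighborSet w = G.neighborSet v := by rw [← hnb v, ← hnb w, hvw]
    have h1 := hfp (G.neighborSet v) ⟨v, mem_leaves_iff.2 rfl⟩
    have h2 := hfp (G.neighborSet v) ⟨w, mem_leaves_iff.2 hN⟩
    have h3 := (p _).injective (Subtype.ext (h1.symm.trans (hvw.trans h2)))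
    exact congrArg Subtype.val h3
  have hadj : ∀ u v, G.Adj (f u) v ↔ G.Adj u v := fun u v => by
    rw [← SimpleGraph.mem_neighborSet, hnb, SimpleGraph.mem_neighborSet]
  refine ⟨⟨Equiv.ofBijective f (Finite.injective_iff_bijective.1 hinj), ?_⟩, hfp⟩
  intro u v
  change G.Adj (f u) (f v) ↔ G.Adj u v
  rw [hadj, G.adj_comm, hadj, G.adj_comm]

/-- The number `r v` of states that miss `v` measures its time of entry; sorting the leaves of each
`S` by `r` gives the permutations. -/
theorem Lin.exists_leafInit (h : Lin G m 𝒜) (e : LeafEnum G) :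
    ∃ σ : G ≃g G, ∀ F ∈ 𝒜, LeafInit e (σ '' F) := by
  set r : V → ℕ := fun v => {F | F ∈ 𝒜 ∧ v ∉ F}.ncard with hr
  have hrlt : ∀ F ∈ 𝒜, ∀ x y, y ∈ F → x ∉ F → r y < r x := by
    intro F hF x y hy hx
    refine Set.ncard_lt_ncard ⟨?_, fun h' => ?_⟩ (Set.toFinite _)
    · rintro K ⟨hK, hyK⟩
      refine ⟨hK, fun hxK => hx ?_⟩
      exact (h.total hK hF).elim (fun h' => h' hxK) fun h' => absurd (h' hy) hyK
    · exact (h' ⟨hF, hx⟩).2 hy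
  set π : ∀ S : Set V, Equiv.Perm (Fin (leaves G S).ncard) :=
    fun S => Tuple.sort fun i => r (e S i) with hπ
  obtain ⟨σ, hσ⟩ := exists_leaf_automorphism (G := G)
    fun S => (e S).symm.trans ((π S).symm.trans (e S))
  have hσe : ∀ S i, σ (e S (π S i)) = (e S i : V) := by
    intro S i
    rw [hσ]
    simp
  refine ⟨σ, fun F hF S i j hij hj => ?_⟩
  rw [← hσe, σ.injective.mem_set_image] at hj ⊢
  by_contra hi
  have h1 := hrlt F hF _ _ hj hi
  have h2 : r (e S (π S i)) ≤ r (e S (π S j)) := Tuple.monotone_sort (fun i => r (e S i)) hij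
  omega

/-- A graph with a path decomposition of length `l` has a linearly ordered schedule of at most
`l + 1` states that is compatible with the enumeration of the leaves, and in which each set with
more than twelve finished and more than twelve unfinished branches at some time has almost all of
its branches processed consecutively. -/
theorem Reach.exists_plan {l : ℕ} (hG : G.Preconnected) (hm : m ≤ 4)
    (h : Reach G m l ∅ Set.univ) (e : LeafEnum G) :
    ∃ 𝒜, Lin G m 𝒜 ∧ 𝒜.ncard ≤ l + 1 ∧ (∀ F ∈ 𝒜, LeafInit e F) ∧
      ∀ S, S.Nonempty → ∀ F ∈ 𝒜, Viol G S F → Star G 𝒜 S := by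
  obtain ⟨ℬ, hℬ, hℬc⟩ := h.exists_sched
  obtain ⟨𝒜, hO, hmin⟩ := exists_optimal ⟨ℬ, hℬ⟩
  obtain ⟨σ, hσ⟩ := hO.toLin.exists_leafInit e
  refine ⟨Set.image σ '' 𝒜, hO.toLin.image σ,
    (Set.ncard_image_le (Set.toFinite _)).trans ((hmin ℬ hℬ).trans hℬc), ?_, ?_⟩
  · rintro _ ⟨F, hF, rfl⟩
    exact hσ F hF
  · rintro S hS _ ⟨F, hF, rfl⟩ hv
    have hv' := hv.image σ.symm
    rw [symm_image_image] at hv'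
    have := (hO.star_of_viol hG hm (hS.image σ.symm) hF hv').image σ
    rwa [image_symm_image] at this

end Leaves

/-! ### Jump intervals and the states outside them -/

section Intervals

variable {V : Type*} {G : SimpleGraph V} {m : ℕ} {𝒜 : Set (Set V)}

/-- From `T₁` to `T₂` only `S`-components are processed, among them all but at most twelve
`S`-branches. -/
def JumpInterval (G : SimpleGraph V) (𝒜 : Set (Set V)) (S T₁ T₂ : Set V) : Prop :=
  S.Nonempty ∧ T₁ ∈ 𝒜 ∧ T₂ ∈ 𝒜 ∧ ∃ 𝒟 ⊆ components G S, T₁ ⊆ T₂ ∧ T₂ \ T₁ = ⋃₀ 𝒟 ∧ S ⊆ T₁ ∧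
    S ⊆ border G T₂ ∧ (branches G S).ncard ≤ (𝒟 ∩ branches G S).ncard + 12 ∧
    26 ≤ (branches G S).ncard

theorem Star.exists_interval {S : Set V} (h : Star G 𝒜 S) : ∃ T₁ T₂, JumpInterval G 𝒜 S T₁ T₂ := by
  obtain ⟨hS, T₁, hT₁, T₂, hT₂, h⟩ := h
  exact ⟨T₁, T₂, hS, hT₁, hT₂, h⟩

/-- The overlap lies in some `D ∈ 𝒟` and some `D' ∈ 𝒟'`. If `S' ⊊ S`, then `D'` would contain a
vertex of `S`, which was processed before `T₁'`. If `b ∈ S' \ S`, then `D` contains `b` and so every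
member of `𝒟'`, and the second interval would end within the first. -/
theorem JumpInterval.eq_of_crossing {S S' T₁ T₂ T₁' T₂' : Set V} (h : JumpInterval G 𝒜 S T₁ T₂)
    (h' : JumpInterval G 𝒜 S' T₁' T₂') (h1 : T₁ ⊆ T₁') (h2 : T₁' ⊂ T₂) (h3 : T₂ ⊂ T₂') :
    S' = S := by
  obtain ⟨_, _, _, 𝒟, h𝒟, hTT, hY, hST, _⟩ := h
  obtain ⟨_, _, _, 𝒟', h𝒟', hTT', hY', hST', _⟩ := h'
  have hD : ∀ D ∈ 𝒟, D ⊆ T₂ \ T₁ := fun D hD => hY ▸ Set.subset_sUnion_of_mem hD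
  have hD' : ∀ D ∈ 𝒟', D ⊆ T₂' \ T₁' := fun D hD => hY' ▸ Set.subset_sUnion_of_mem hD
  obtain ⟨x, hx2, hx1⟩ := Set.nonempty_of_ssubset h2
  have hxY : x ∈ ⋃₀ 𝒟 := hY ▸ ⟨hx2, fun h => hx1 (h1 h)⟩
  have hxY' : x ∈ ⋃₀ 𝒟' := hY' ▸ ⟨h3.1 hx2, hx1⟩
  obtain ⟨D, hD𝒟, hxD⟩ := hxY
  obtain ⟨D', hD𝒟', hxD'⟩ := hxY'
  by_contra hne
  have hdis : ∀ K ∈ 𝒟', Disjoint K S := fun K hK => Set.disjoint_left.2 fun y hy hyS =>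
    (hD' K hK hy).2 (h1 (hST hyS))
  by_cases hSS : S' ⊆ S
  · obtain ⟨s, hs, hsS'⟩ := Set.exists_of_ssubset (hSS.ssubset_of_ne hne)
    have hsub := comp_subset_of_inter (h𝒟' hD𝒟') ((comp_conn (h𝒟 hD𝒟)).insert (a := s)
      (by rwa [comp_nbhd (h𝒟 hD𝒟)])) (Set.disjoint_insert_left.2
        ⟨hsS', (comp_disjoint (h𝒟 hD𝒟)).mono_right hSS⟩) ⟨x, Or.inr hxD, hxD'⟩
    exact (hD' D' hD𝒟' (hsub (Set.mem_insert _ _))).2 (h1 (hST hs))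
  · obtain ⟨b, hb, hbS⟩ := Set.not_subset.1 hSS
    have hins : ∀ K ∈ 𝒟', (insert b K ∩ D).Nonempty → insert b K ⊆ D := fun K hK h =>
      comp_subset_of_inter (h𝒟 hD𝒟) ((comp_conn (h𝒟' hK)).insert
        (by rwa [comp_nbhd (h𝒟' hK)])) (Set.disjoint_insert_left.2 ⟨hbS, hdis K hK⟩) h
    have hbD : b ∈ D := hins D' hD𝒟' ⟨x, Or.inr hxD', hxD⟩ (Set.mem_insert _ _)
    refine h3.2 fun y hy => ?_
    by_cases hy1 : y ∈ T₁'
    · exact h2.1 hy1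
    · have hyY : y ∈ ⋃₀ 𝒟' := hY' ▸ ⟨hy, hy1⟩
      obtain ⟨K, hK, hyK⟩ := hyY
      exact (hD D hD𝒟 (hins K hK ⟨b, Set.mem_insert _ _, hbD⟩ (Or.inr hyK))).1

variable [Finite V]

theorem JumpInterval.merge {S T₁ T₂ T₁' T₂' : Set V} (h : JumpInterval G 𝒜 S T₁ T₂)
    (h' : JumpInterval G 𝒜 S T₁' T₂') (h1 : T₁ ⊆ T₁') (h2 : T₁' ⊆ T₂) (h3 : T₂ ⊆ T₂') :
    JumpInterval G 𝒜 S T₁ T₂' := by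
  obtain ⟨hS, hT₁, _, 𝒟, h𝒟, hTT, hY, hST, _, hc, hN⟩ := h
  obtain ⟨_, _, hT₂', 𝒟', h𝒟', hTT', hY', hST', hb', hc', _⟩ := h'
  refine ⟨hS, hT₁, hT₂', 𝒟 ∪ 𝒟', Set.union_subset h𝒟 h𝒟', hTT.trans h3, ?_, hST, hb', ?_, hN⟩
  · rw [Set.sUnion_union, ← hY, ← hY']
    ext x
    constructor
    · rintro ⟨hx, hx'⟩
      by_cases hx2 : x ∈ T₂
      · exact Or.inl ⟨hx2, hx'⟩
      · exact Or.inr ⟨hx, fun h => hx2 (h2 h)⟩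
    · rintro (⟨hx, hx'⟩ | ⟨hx, hx'⟩)
      · exact ⟨h3 hx, hx'⟩
      · exact ⟨hx, fun h => hx' (h1 h)⟩
  · have := Set.ncard_le_ncard (Set.inter_subset_inter_left (branches G S)
      (Set.subset_union_left : 𝒟 ⊆ 𝒟 ∪ 𝒟')) (Set.toFinite _)
    omega

theorem JumpInterval.strict_of_viol (hL : Lin G m 𝒜) {S T₁ T₂ F : Set V}
    (h : JumpInterval G 𝒜 S T₁ T₂) (hF : F ∈ 𝒜) (hv : Viol G S F) : T₁ ⊂ F ∧ F ⊂ T₂ := by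
  obtain ⟨_, hT₁, hT₂, 𝒟, h𝒟, hTT, hY, _, _, hc, _⟩ := h
  have hD : ∀ D ∈ 𝒟, D ⊆ T₂ \ T₁ := fun D hD => hY ▸ Set.subset_sUnion_of_mem hD
  have hrest : (branches G S \ 𝒟).ncard ≤ 12 := by
    have := Set.ncard_inter_add_ncard_sdiff_eq_ncard (branches G S) 𝒟 (Set.toFinite _)
    rw [Set.inter_comm] at this
    omega
  constructor
  · refine hL.ssubset_of_not_subset hT₁ hF fun hFT => ?_
    have hsub : {C | C ∈ branches G S ∧ C ⊆ F} ⊆ branches G S \ 𝒟 := by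
      rintro C ⟨hC, hCF⟩
      refine ⟨hC, fun hC𝒟 => ?_⟩
      obtain ⟨x, hx⟩ := (comp_conn hC.1).1
      exact (hD C hC𝒟 hx).2 (hFT (hCF hx))
    have := Set.ncard_le_ncard hsub (Set.toFinite _)
    have := hv.1
    omega
  · refine hL.ssubset_of_not_subset hF hT₂ fun hTF => ?_
    have hsub : {C | C ∈ branches G S ∧ ¬ C ⊆ F} ⊆ branches G S \ 𝒟 := fun C hC =>
      ⟨hC.1, fun hC𝒟 => hC.2 fun x hx => hTF (hD C hC𝒟 hx).1⟩
    have := Set.ncard_le_ncard hsub (Set.toFinite _)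
    have := hv.2
    omega

/-- The states that are not strictly inside of a jump interval. -/
def Kept (G : SimpleGraph V) (𝒜 : Set (Set V)) (F : Set V) : Prop :=
  F ∈ 𝒜 ∧ ∀ S T₁ T₂, JumpInterval G 𝒜 S T₁ T₂ → ¬ (T₁ ⊂ F ∧ F ⊂ T₂)

/-- If the successor is not kept, the interval around it begins at `F`. The farthest end `T` of an
interval that begins at `F` is kept: an interval around `T` would either contain `F` strictly, or
cross and merge into a longer one. -/
theorem Kept.next (hL : Lin G m 𝒜) {F : Set V} (hF : Kept G 𝒜 F) (hu : F ≠ Set.univ) :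
    (∃ F', Kept G 𝒜 F' ∧ IsNext 𝒜 F F') ∨
      ∃ S T, Kept G 𝒜 T ∧ F ⊂ T ∧ JumpInterval G 𝒜 S F T := by
  obtain ⟨F', hn⟩ := hL.exists_next hF.1 hu
  by_cases hK : Kept G 𝒜 F'
  · exact Or.inl ⟨F', hK, hn⟩
  right
  obtain ⟨S, T₁, T₂, hJ, h1, h2⟩ : ∃ S T₁ T₂, JumpInterval G 𝒜 S T₁ T₂ ∧ T₁ ⊂ F' ∧ F' ⊂ T₂ := by
    unfold Kept at hK
    push Not at hK
    obtain ⟨S, T₁, T₂, h⟩ := hK hn.1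
    exact ⟨S, T₁, T₂, h⟩
  have hT₁F : T₁ = F := by
    have h3 : T₁ ⊆ F := (hL.subset_or_next_subset hF.1 hn hJ.2.1).resolve_right h1.2
    by_contra hne
    exact hF.2 S T₁ T₂ hJ ⟨h3.ssubset_of_ne hne, hn.2.1.trans h2⟩
  subst hT₁F
  obtain ⟨T, hT, ⟨hTF', S, hJT⟩, hmax⟩ := hL.exists_greatest
    (p := fun T => F' ⊂ T ∧ ∃ S, JumpInterval G 𝒜 S T₁ T) ⟨T₂, hJ.2.2.1, h2, S, hJ⟩
  refine ⟨S, T, ⟨hT, ?_⟩, hn.2.1.trans hTF', hJT⟩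
  rintro S' T₁' T₂' hJ' ⟨h3, h4⟩
  have hsub : T₁ ⊆ T₁' := by
    refine (hL.total hF.1 hJ'.2.1).elim id fun h => ?_
    by_contra hno
    exact hF.2 S' T₁' T₂' hJ' ⟨⟨h, hno⟩, (hn.2.1.trans hTF').trans h4⟩
  have hSS := hJT.eq_of_crossing hJ' hsub h3 h4
  subst hSS
  exact h4.2 (hmax T₂' hJ'.2.2.1 ⟨hTF'.trans h4, _, hJT.merge hJ' hsub h3.1 h4.1⟩)

end Intervals

/-! ### Nodes, edges and the path obtained from a schedule -/

section Nodes

variable {V : Type*} {G : SimpleGraph V} {k m : ℕ} {e : LeafEnum G} {𝒜 : Set (Set V)}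

theorem LeafInit.lt_iff {F : Set V} (h : LeafInit e F) (S : Set V) (i : Fin (leaves G S).ncard) :
    i.val < (leaves G S ∩ F).ncard ↔ (e S i : V) ∈ F := by
  have hI : (leaves G S ∩ F).ncard = {j | (e S j : V) ∈ F}.ncard := by
    rw [← Set.ncard_image_of_injective {j | (e S j : V) ∈ F}
      (Subtype.val_injective.comp (e S).injective)]
    congr 1
    ext x
    constructor
    · rintro ⟨hx, hxF⟩
      exact ⟨(e S).symm ⟨x, hx⟩, by simpa using hxF, by simp⟩
    · rintro ⟨j, hj, rfl⟩
      exact ⟨(e S j).2, hj⟩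
  rw [hI]
  constructor
  · intro hlt
    by_contra hi
    have hsub : {j | (e S j : V) ∈ F} ⊆ Set.Iio i := fun j hj => by
      by_contra hij
      exact hi (h S i j (not_lt.1 hij) hj)
    have hc : (Set.Iio i).ncard = i := by
      rw [Set.ncard_eq_toFinset_card', Set.toFinset_Iio, Fin.card_Iio]
    have := Set.ncard_le_ncard hsub (Set.toFinite _)
    omega
  · intro hi
    have hsub : Set.Iic i ⊆ {j | (e S j : V) ∈ F} := fun j hj => h S j i hj hi
    have hc : (Set.Iic i).ncard = i + 1 := by
      rw [Set.ncard_eq_toFinset_card', Set.toFinset_Iic, Fin.card_Iic]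
    have := Set.ncard_le_ncard hsub (Set.toFinite _)
    omega

/-- `g` is an admissible set of branches when exactly the branches in `F` are finished. -/
def GreenOK (G : SimpleGraph V) (F S : Set V) (g : Set (branches G S)) : Prop :=
  (IsBottleneck G S → (branches G S).ncard ≤ g.ncard + 12 ∧
    ∀ H ∈ g, ∀ H' ∈ g, ((H : Set V) ⊆ F ↔ (H' : Set V) ⊆ F)) ∧ (¬ IsBottleneck G S → g = ∅)

theorem ncard_subtype_branches (S : Set V) (p : Set V → Prop) :
    {H : branches G S | p H}.ncard = {C | C ∈ branches G S ∧ p C}.ncard := by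
  rw [← Set.ncard_image_of_injective {H : branches G S | p H} Subtype.val_injective]
  congr 1
  ext C
  constructor
  · rintro ⟨H, hH, rfl⟩
    exact ⟨H.2, hH⟩
  · rintro ⟨hC, hp⟩
    exact ⟨⟨C, hC⟩, hp, rfl⟩

/-- Without a violation one of the two classes, finished or unfinished, has at most twelve branches;
the other class is taken. -/
theorem exists_greenOK [Finite V] {S F : Set V} (h : ¬ Viol G S F) : ∃ g, GreenOK G F S g := by
  by_cases hB : IsBottleneck G S
  swap
  · exact ⟨∅, fun h => absurd h hB, fun _ => rfl⟩
  have hsplit : {C | C ∈ branches G S ∧ C ⊆ F} ∪ {C | C ∈ branches G S ∧ ¬ C ⊆ F} =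
      branches G S := by
    ext C
    simp only [Set.mem_union, Set.mem_ofPred_eq]
    tauto
  have hle := Set.ncard_union_le {C | C ∈ branches G S ∧ C ⊆ F}
    {C | C ∈ branches G S ∧ ¬ C ⊆ F}
  rw [hsplit] at hle
  by_cases h1 : 13 ≤ {C | C ∈ branches G S ∧ C ⊆ F}.ncard
  · have h2 : ¬ 13 ≤ {C | C ∈ branches G S ∧ ¬ C ⊆ F}.ncard := fun h2 => h ⟨h1, h2⟩
    refine ⟨{H | (H : Set V) ⊆ F}, fun _ => ⟨?_, fun H hH H' hH' => ⟨fun _ => hH', fun _ => hH⟩⟩,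
      fun h => absurd hB h⟩
    rw [ncard_subtype_branches S (· ⊆ F)]
    omega
  · refine ⟨{H | ¬ (H : Set V) ⊆ F}, fun _ => ⟨?_, fun H hH H' hH' =>
      ⟨fun h => absurd h hH, fun h => absurd h hH'⟩⟩, fun h => absurd hB h⟩
    rw [ncard_subtype_branches S (¬ · ⊆ F)]
    omega

/-- Since `δ(F) ⊆ X`, a component `K` of `G - X` that meets `F` lies in `F`. By connectedness its
neighbourhood is a non-empty subset of `X`, so `R` records `K` as a leaf or a branch of `N(K)`. -/
theorem exists_node [Finite V] (hG : G.Preconnected) {F X : Set V} (hXk : X.ncard ≤ k + 1) (hXF : X ⊆ F)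
    (hb : border G F ⊆ X) (hne : X.Nonempty) (hF : LeafInit e F)
    (g : ∀ S, Set (branches G S)) (hg : ∀ S, S.Nonempty → GreenOK G F S (g S)) :
    ∃ v : Node G k, v.X = X ∧ v.covered e = F ∧
      ∀ S, (v.R S).1.l = (leaves G S.1 ∩ F).ncard ∧ (v.R S).1.green = g S.1 := by
  classical
  refine ⟨⟨X, hXk, fun S => ⟨⟨g S.1, fun H => decide ((H : Set V) ⊆ F),
    (leaves G S.1 ∩ F).ncard⟩, Set.ncard_le_ncard Set.inter_subset_left (Set.toFinite _),
    fun h => ⟨((hg S.1 S.2.1).1 h).1, fun H hH H' hH' => ?_⟩, (hg S.1 S.2.1).2⟩⟩, rfl, ?_,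
    fun S => ⟨rfl, rfl⟩⟩
  · exact decide_eq_decide.2 (((hg S.1 S.2.1).1 h).2 H hH H' hH')
  · refine Set.Subset.antisymm (Set.union_subset hXF (Set.iUnion_subset fun S =>
      Set.union_subset ?_ (Set.iUnion₂_subset fun H hH => ?_))) fun v hv => ?_
    · rintro _ ⟨i, _, hi, rfl⟩
      exact (hF.lt_iff S.1 i).1 hi
    · exact of_decide_eq_true hH
    · by_cases hvX : v ∈ X
      · exact Or.inl hvX
      right
      obtain ⟨c, hvc, hcX, hcn⟩ := exists_supp (G := G) hvX
      have hK := conn_supp c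
      set K : Set V := Subtype.val '' c.supp with hKdef
      have hKF : K ⊆ F := by
        by_contra hn
        obtain ⟨x, hx, hxb⟩ := hK.exists_border ⟨v, hvc, hv⟩ hn
        exact Set.disjoint_left.1 hcX hx (hb hxb)
      have hKu : K ≠ Set.univ := by
        intro h
        obtain ⟨x, hx⟩ := hne
        exact Set.disjoint_left.1 hcX (h ▸ Set.mem_univ x) hx
      have hKc : K ∈ components G (nbhd G K) := mem_components_iff.2 ⟨hK, rfl⟩
      refine Set.mem_iUnion.2 ⟨⟨nbhd G K, nbhd_nonempty hG ⟨v, hvc⟩ hKu, hcn⟩, ?_⟩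
      by_cases hleaf : ∃ w, K = {w}
      · obtain ⟨w, hw⟩ := hleaf
        have hvw : v = w := by
          rw [hw] at hvc
          exact hvc
        have hvl : v ∈ leaves G (nbhd G K) := by
          change {v} ∈ components G (nbhd G K)
          rw [hvw, ← hw]
          exact hKc
        refine Or.inl ⟨(e _).symm ⟨v, hvl⟩, Nat.zero_le _, (hF.lt_iff _ _).2 ?_, ?_⟩
        · simpa using hv
        · simp
      · right
        exact Set.mem_iUnion₂.2 ⟨⟨K, hKc, hleaf⟩, decide_eq_true hKF, hvc⟩

/-- The node `v` represents the state `F`. -/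
def Fits (e : LeafEnum G) (v : Node G k) (F : Set V) : Prop :=
  v.covered e = F ∧ border G F ⊆ v.X ∧ ∀ S, (v.R S).1.l = (leaves G S.1 ∩ F).ncard

theorem fits_empty : Fits e (Node.empty G k) ∅ := by
  refine ⟨?_, by simp [border_empty], fun S => ?_⟩
  · rw [Set.eq_empty_iff_forall_notMem]
    rintro x (hx | hx)
    · exact hx
    · obtain ⟨S, _⟩ := Set.mem_iUnion.1 hx
      exact S.2.1.ne_empty (Set.subset_empty_iff.1 S.2.2)
  · exact absurd (Set.subset_empty_iff.1 S.2.2) S.2.1.ne_empty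

/-- The new node carries the bag `δ(F) ∪ (F' \ F)` of the step. -/
theorem exists_step_edge [Finite V] (hG : G.Preconnected) (hL : Lin G (k + 1) 𝒜) {v : Node G k}
    {F F' : Set V} (hv : Fits e v F) (hF : F ∈ 𝒜) (hn : IsNext 𝒜 F F') (hF' : LeafInit e F')
    (hviol : ∀ S, S.Nonempty → ¬ Viol G S F') :
    ∃ v' : Node G k, Fits e v' F' ∧ (auxDigraph e k).Adj (.node v) (.node v') ∧
      weight e k (.node v) (.node v') ≤ 1 := by
  classical
  have hg : ∀ S : Set V, ∃ g, S.Nonempty → GreenOK G F' S g := fun S => by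
    by_cases hS : S.Nonempty
    · obtain ⟨g, hg⟩ := exists_greenOK (hviol S hS)
      exact ⟨g, fun _ => hg⟩
    · exact ⟨∅, fun h => absurd h hS⟩
  choose g hg using hg
  have hb : border G F' ⊆ border G F ∪ F' \ F := fun x hx => by
    by_cases hxF : x ∈ F
    · exact Or.inl (border_anti hn.2.1.1 hx hxF)
    · exact Or.inr ⟨hx.1, hxF⟩
  obtain ⟨v', hX, hc, hR⟩ := exists_node (e := e) hG (X := border G F ∪ F' \ F)
    ((Set.ncard_union_le _ _).trans (hL.next_bound hF hn))
    (Set.union_subset ((border_subset _).trans hn.2.1.1) Set.sdiff_subset) hb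
    ((Set.nonempty_of_ssubset hn.2.1).mono Set.subset_union_right) hF' g hg
  have hsub : v'.covered e \ v.covered e ⊆ v'.X := by
    rw [hc, hv.1, hX]
    exact Set.subset_union_right
  have hint : v'.X ∩ F = border G F := by
    rw [hX]
    ext x
    constructor
    · rintro ⟨h | h, hx⟩
      · exact h
      · exact absurd hx h.2
    · exact fun h => ⟨Or.inl h, h.1⟩
  refine ⟨v', ⟨hc, hX ▸ hb, fun S => (hR S).1⟩, Or.inl ⟨⟨?_, ?_, ?_⟩, hsub, ?_⟩, ?_⟩
  · rintro rfl
    exact hn.2.1.ne (hv.1.symm.trans hc)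
  · rw [hc, hv.1]
    exact hn.2.1.1
  · rw [hv.1, Set.eq_empty_iff_forall_notMem]
    rintro x ⟨⟨h1, h2⟩, h3⟩
    exact h2 (hint ▸ ⟨h1, h3⟩)
  · rw [hv.1, hint]
  · simp only [weight, hsub, if_true, le_refl]

/-- Only `S`-components are added from `F` to `T` and `S` stays in the border, so `δ(F) = δ(T)`, and
this set is the new `X'`. The states of the interval give the decomposition of `G[T \ F]`. -/
theorem exists_jump_edge [Finite V] (hG : G.Preconnected) (hL : Lin G (k + 1) 𝒜) {v : Node G k}
    {S F T : Set V} (hv : Fits e v F) (hFT : F ⊂ T) (hJ : JumpInterval G 𝒜 S F T)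
    (hF : LeafInit e F) (hT : LeafInit e T) (hviol : ∀ S, S.Nonempty → ¬ Viol G S T) :
    ∃ v' : Node G k, Fits e v' T ∧ (auxDigraph e k).Adj (.node v) (.node v') ∧
      weight e k (.node v) (.node v') ≤ {H | H ∈ 𝒜 ∧ F ⊂ H ∧ H ⊆ T}.ncard := by
  classical
  obtain ⟨hS, hF𝒜, hT𝒜, 𝒟, h𝒟, _, hY, hSF, hSb, hcard, hN⟩ := hJ
  have hD : ∀ D ∈ 𝒟, D ⊆ T \ F := fun D hD => hY ▸ Set.subset_sUnion_of_mem hD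
  have hgS : GreenOK G T S {H | (H : Set V) ∈ 𝒟} := by
    refine ⟨fun _ => ⟨?_, fun H hH H' hH' => ⟨fun _ => ?_, fun _ => ?_⟩⟩, fun h => ?_⟩
    · rw [ncard_subtype_branches S (· ∈ 𝒟)]
      have : {C | C ∈ branches G S ∧ C ∈ 𝒟} = 𝒟 ∩ branches G S := by
        ext C
        exact and_comm
      rwa [this]
    · exact (hD _ hH').trans Set.sdiff_subset
    · exact (hD _ hH).trans Set.sdiff_subset
    · exact absurd ⟨hS, by omega⟩ h
  have hg : ∀ S' : Set V, ∃ g, (S'.Nonempty → GreenOK G T S' g) ∧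
      (S' = S → g = {H : branches G S' | (H : Set V) ∈ 𝒟}) := fun S' => by
    by_cases hSS : S' = S
    · subst hSS
      exact ⟨_, fun _ => hgS, fun _ => rfl⟩
    by_cases hS' : S'.Nonempty
    · obtain ⟨g, hg⟩ := exists_greenOK (hviol S' hS')
      exact ⟨g, fun _ => hg, fun h => absurd h hSS⟩
    · exact ⟨∅, fun h => absurd h hS', fun h => absurd h hSS⟩
  choose g hg hgS using hg
  have hYadj : ∀ x ∈ T \ F, ∀ y, G.Adj x y → y ∈ T \ F ∨ y ∈ S := fun x hx y hxy => by
    rw [hY] at hx ⊢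
    obtain ⟨D, hD', hxD⟩ := hx
    exact (comp_adj (h𝒟 hD') hxD hxy).imp_left fun h => ⟨D, hD', h⟩
  have hb1 : border G T ⊆ border G F := by
    intro x hx
    by_cases hxF : x ∈ F
    · exact border_anti hFT.1 hx hxF
    · obtain ⟨hxT, w, hw, hxw⟩ := hx
      rcases hYadj x ⟨hxT, hxF⟩ w hxw with h | h
      · exact absurd h.1 hw
      · exact absurd (hFT.1 (hSF h)) hw
  have hb2 : border G F ⊆ border G T := by
    rintro x ⟨hx, w, hw, hxw⟩
    by_cases hwT : w ∈ T
    · rcases hYadj w ⟨hwT, hw⟩ x hxw.symm with h | h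
      · exact absurd hx h.2
      · exact hSb h
    · exact ⟨hFT.1 hx, w, hwT, hxw⟩
  have hSbF : S ⊆ border G F := hSb.trans hb1
  have hTu : F ≠ Set.univ := fun h => hFT.2 (h ▸ Set.subset_univ _)
  have hbk := hL.border_lt hF𝒜 hTu
  obtain ⟨v', hX, hc, hR⟩ := exists_node (e := e) hG (X := border G F) (k := k) (F := T)
    (by omega) ((border_subset _).trans hFT.1) hb1 (hS.mono hSbF) hT g hg
  have hXX : v.X ∩ v'.X = border G F := by
    rw [hX]
    exact Set.inter_eq_right.2 hv.2.1
  have hB : IsBottleneck G S := ⟨hS, by omega⟩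
  have hSv : S ⊆ v.X := hSbF.trans hv.2.1
  have hSv' : S ⊆ v'.X := hX ▸ hSbF
  have hl : (v.R ⟨S, hS, hSv⟩).1.l = (leaves G S ∩ F).ncard := hv.2.2 _
  have hl' : (v'.R ⟨S, hS, hSv'⟩).1.l = (leaves G S ∩ T).ncard := (hR _).1
  have hgr : (v'.R ⟨S, hS, hSv'⟩).1.green = {H : branches G S | (H : Set V) ∈ 𝒟} :=
    (hR _).2.trans (hgS S rfl)
  have hnsub : ¬ v'.covered e \ v.covered e ⊆ v'.X := by
    rw [hc, hv.1, hX]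
    intro h
    obtain ⟨x, hx⟩ := Set.nonempty_of_ssubset hFT
    exact hx.2 (h hx).1
  have hPD : HasPathDecomposition (G.induce (T \ F)) ((k : ℤ) - (border G F).ncard)
      {H | H ∈ 𝒜 ∧ F ⊂ H ∧ H ⊆ T}.ncard := by
    have hk : (k : ℤ) - (border G F).ncard = ((k + 1 - (border G F).ncard : ℕ) : ℤ) - 1 := by
      omega
    rw [hk, hasPathDecomposition_iff_reach]
    have hr := (hL.reach hF𝒜 hT𝒜 hFT.1).induce subset_rfl hb2
    have huniv : (Subtype.val ⁻¹' T : Set ↑(T \ F)) = Set.univ :=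
      Set.eq_univ_of_forall fun x => x.2.1
    rwa [huniv] at hr
  have hjump : T \ F = jumpSet e v v' S hS hSv hSv' := by
    unfold jumpSet
    rw [hgr, hl, hl']
    ext x
    constructor
    · intro hx
      have hxY : x ∈ ⋃₀ 𝒟 := hY ▸ hx
      obtain ⟨D, hD', hxD⟩ := hxY
      by_cases hleaf : ∃ w, D = {w}
      · left
        obtain ⟨w, rfl⟩ := hleaf
        obtain rfl : x = w := hxD
        have hxl : x ∈ leaves G S := h𝒟 hD'
        refine ⟨(e S).symm ⟨x, hxl⟩, ?_, (hT.lt_iff _ _).2 (by simpa using hx.1), by simp⟩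
        rw [← not_lt, hF.lt_iff]
        simpa using hx.2
      · right
        exact Set.mem_iUnion₂.2 ⟨⟨D, h𝒟 hD', hleaf⟩, hD', hxD⟩
    · rintro (⟨i, h1, h2, rfl⟩ | hx)
      · rw [← not_lt, hF.lt_iff] at h1
        exact ⟨(hT.lt_iff _ _).1 h2, h1⟩
      · obtain ⟨H, hH, hxH⟩ := Set.mem_iUnion₂.1 hx
        exact hD _ hH hxH
  refine ⟨v', ⟨hc, hX ▸ hb1, fun S => (hR S).1⟩, Or.inr ⟨⟨?_, ?_, ?_⟩, hnsub, S, hB, hSv, hSv', ?_, ?_, ?_, ?_⟩,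
    ?_⟩
  · rintro rfl
    exact hFT.ne (hv.1.symm.trans hc)
  · rw [hc, hv.1]
    exact hFT.1
  · rw [hv.1, hX, Set.sdiff_self]
    exact Set.empty_inter _
  · exact (congrArg₂ (· \ ·) hc hv.1).trans hjump
  · rw [hv.1, hXX]
  · rw [hXX, hX]
  · rw [hXX, ← hjump]
    exact ⟨_, hPD⟩
  · simp only [weight, hnsub, if_false]
    refine Nat.sInf_le ?_
    rw [hc, hv.1, hXX]
    exact hPD

theorem exists_path [Finite V] (hG : G.Preconnected) (hL : Lin G (k + 1) 𝒜)
    (hleaf : ∀ F ∈ 𝒜, LeafInit e F)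
    (hstar : ∀ S, S.Nonempty → ∀ F ∈ 𝒜, Viol G S F → Star G 𝒜 S)
    {F : Set V} (hF : Kept G 𝒜 F) {v : Node G k} (hv : Fits e v F) :
    ∃ (m : ℕ) (P : Fin (m + 1) → Vertex G k), Function.Injective P ∧ P 0 = .node v ∧
      P (Fin.last m) = .sink ∧ (∀ i : Fin m, (auxDigraph e k).Adj (P i.castSucc) (P i.succ)) ∧
      ∑ i : Fin m, weight e k (P i.castSucc) (P i.succ) ≤ {H | H ∈ 𝒜 ∧ F ⊂ H}.ncard ∧
      ∀ i u, P i = .node u → F ⊆ u.covered e := by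
  have hviol : ∀ F, Kept G 𝒜 F → ∀ S, S.Nonempty → ¬ Viol G S F := fun F hF S hS hV => by
    obtain ⟨T₁, T₂, hJ⟩ := (hstar S hS F hF.1 hV).exists_interval
    exact hF.2 S T₁ T₂ hJ (hJ.strict_of_viol hL hF.1 hV)
  induction hs : {H | H ∈ 𝒜 ∧ F ⊂ H}.ncard using Nat.strong_induction_on generalizing F v with
  | _ n ih =>
    by_cases hu : F = Set.univ
    · subst hu
      refine ⟨1, Fin.cons (.node v) fun _ => .sink, ?_, rfl, rfl, ?_, ?_, ?_⟩
      · rw [Fin.cons_injective_iff]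
        exact ⟨by simp, Function.injective_of_subsingleton _⟩
      · intro i
        obtain rfl := Subsingleton.elim i 0
        exact hv.1
      · simp [weight]
      · intro i
        refine Fin.cases (fun u h => ?_) (fun j u h => ?_) i
        · rw [Fin.cons_zero, Vertex.node.injEq] at h
          exact h ▸ hv.1.ge
        · rw [Fin.cons_succ] at h
          cases h
    · obtain ⟨F', v', hF', hlt, hv', hadj, hw⟩ : ∃ F' v', Kept G 𝒜 F' ∧ F ⊂ F' ∧ Fits e v' F' ∧
          (auxDigraph e k).Adj (.node v) (.node v') ∧
          weight e k (.node v) (.node v') ≤ {H | H ∈ 𝒜 ∧ F ⊂ H ∧ H ⊆ F'}.ncard := by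
        rcases hF.next hL hu with ⟨F', hF', hn⟩ | ⟨S, T, hT, hlt, hJ⟩
        · obtain ⟨v', h1, h2, h3⟩ := exists_step_edge hG hL hv hF.1 hn (hleaf _ hn.1) (hviol F' hF')
          refine ⟨F', v', hF', hn.2.1, h1, h2, h3.trans ?_⟩
          rw [Nat.one_le_iff_ne_zero, ← Nat.pos_iff_ne_zero, Set.ncard_pos (Set.toFinite _)]
          exact ⟨F', hn.1, hn.2.1, subset_rfl⟩
        · obtain ⟨v', h1, h2, h3⟩ := exists_jump_edge hG hL hv hlt hJ (hleaf _ hF.1) (hleaf _ hT.1)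
            (hviol T hT)
          exact ⟨T, v', hT, hlt, h1, h2, h3⟩
      have hsum : {H | H ∈ 𝒜 ∧ F ⊂ H ∧ H ⊆ F'}.ncard + {H | H ∈ 𝒜 ∧ F' ⊂ H}.ncard ≤ n := by
        rw [← hs, ← Set.ncard_union_eq _ (Set.toFinite _) (Set.toFinite _)]
        · refine Set.ncard_le_ncard ?_ (Set.toFinite _)
          rintro H (h | h)
          exacts [⟨h.1, h.2.1⟩, ⟨h.1, hlt.trans h.2⟩]
        · rw [Set.disjoint_left]
          exact fun H h1 h2 => h2.2.2 h1.2.2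
      have hpos : 0 < {H | H ∈ 𝒜 ∧ F ⊂ H ∧ H ⊆ F'}.ncard := by
        rw [Set.ncard_pos (Set.toFinite _)]
        exact ⟨F', hF'.1, hlt, subset_rfl⟩
      obtain ⟨m, P, h1, h2, h3, h4, h5, h6⟩ := ih _ (by omega) hF' hv' rfl
      refine ⟨m + 1, Fin.cons (.node v) P, ?_, rfl, ?_, ?_, ?_, ?_⟩
      · rw [Fin.cons_injective_iff]
        refine ⟨?_, h1⟩
        rintro ⟨i, hi⟩
        -- Covered sets grow strictly along the path, so `v` does not occur again.
        exact hlt.2 ((h6 i v hi).trans hv.1.le)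
      · rw [← Fin.succ_last, Fin.cons_succ, h3]
      · intro i
        refine Fin.cases ?_ (fun j => ?_) i
        · rw [Fin.castSucc_zero, Fin.cons_zero, Fin.cons_succ, h2]
          exact hadj
        · rw [← Fin.succ_castSucc, Fin.cons_succ, Fin.cons_succ]
          exact h4 j
      · rw [Fin.sum_univ_succ]
        simp only [← Fin.succ_castSucc, Fin.cons_succ, Fin.castSucc_zero, Fin.cons_zero, h2]
        omega
      · intro i
        refine Fin.cases (fun u h => ?_) (fun j u h => ?_) i
        · rw [Fin.cons_zero, Vertex.node.injEq] at h
          exact h ▸ hv.1.ge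
        · rw [Fin.cons_succ] at h
          exact hlt.1.trans (h6 j u h)

theorem exists_hasPath_of_reach [Finite V] (hG : G.Preconnected) (hk : k ≤ 3) {l : ℕ}
    (h : Reach G (k + 1) l ∅ Set.univ) : ∃ l' ≤ l, HasPath e k l' := by
  obtain ⟨𝒜, hL, hc, hleaf, hstar⟩ := h.exists_plan hG (by omega) e
  have h0 : Kept G 𝒜 ∅ := ⟨hL.empty_mem, fun _ _ _ _ h => h.1.2 (Set.empty_subset _)⟩
  obtain ⟨m, P, h1, h2, h3, h4, h5, _⟩ := exists_path hG hL hleaf hstar h0 (fits_empty (e := e))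
  refine ⟨_, h5.trans ?_, m, P, h1, h2, h3, h4, rfl⟩
  have hins : insert ∅ {H | H ∈ 𝒜 ∧ ∅ ⊂ H} ⊆ 𝒜 := by
    rintro H (rfl | h)
    exacts [hL.empty_mem, h.1]
  have := Set.ncard_le_ncard hins (Set.toFinite _)
  rw [Set.ncard_insert_of_notMem (fun h => h.2.2 subset_rfl) (Set.toFinite _)] at this
  omega

end Nodes

end PathLen

theorem mainTheorem5 {V : Type*} [Finite V] (G : SimpleGraph V) (hG : G.Preconnected)
    (k : ℕ) (hk : k = 1 ∨ k = 2 ∨ k = 3) (e : PathLen.LeafEnum G) :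
    (∀ l : ℕ, (∃ l' ≤ l, PathLen.HasPath e k l') ↔ HasPathDecomposition G k l) ∧
    (∀ l : ℕ, IsLeast {l | PathLen.HasPath e k l} l ↔
      IsLeast {l | HasPathDecomposition G k l} l) := by
  have key : ∀ l : ℕ, (∃ l' ≤ l, PathLen.HasPath e k l') ↔ HasPathDecomposition G k l := by
    intro l
    have hk1 : (k : ℤ) = ((k + 1 : ℕ) : ℤ) - 1 := by
      push_cast
      ring
    rw [hk1, PathLen.hasPathDecomposition_iff_reach]
    constructor
    · rintro ⟨l', hl, h⟩
      exact (PathLen.reach_of_hasPath h).pad hl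
    · exact PathLen.exists_hasPath_of_reach hG (by omega)
  refine ⟨key, fun l => ⟨fun h => ⟨(key l).1 ⟨l, le_rfl, h.1⟩, fun l' hl' => ?_⟩,
    fun h => ⟨?_, fun l' hl' => h.2 ((key l').1 ⟨l', le_rfl, hl'⟩)⟩⟩⟩
  · obtain ⟨l'', h1, h2⟩ := (key l').2 hl'
    exact (h.2 h2).trans h1
  · obtain ⟨l'', h1, h2⟩ := (key l).2 h.1
    have := h.2 ((key l'').1 ⟨l'', le_rfl, h2⟩)
    have heq : l'' = l := le_antisymm h1 this
    exact heq ▸ h2
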